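/- Let $L$ be a simple complex algebraic group (a connected Zariski closed subgroup of $\mathrm{GL}_n(\mathbb C)$ whose Lie algebra $\mathfrak l$ is simple), and let $\mathfrak l=\mathfrak l_{-1}\oplus\mathfrak l_0\oplus\mathfrak l_1$ be a short grading, i.e. a $\mathbb Z$-grading of the Lie algebra $\mathfrak l$ whose non-zero parts are exactly those of degrees $-1,0,1$. There is a unique $\xi\in\mathfrak l$ with $\mathfrak l_k=\{x\in\mathfrak l : [\xi,x]=kx\}$ for all $k$. Let $G$ be the identity component of the centralizer of $\xi$ in $L$; it acts on $\mathfrak l_{\pm1}$ by the adjoint action. Let $\mathfrak t\subset\mathfrak l_0$ be a Cartan subalgebra of $\mathfrak l$ (the Lie algebra of a maximal torus of $G$), let $\Delta$ be the root system of $(\mathfrak l,\mathfrak t)$, and let $\Delta_1\subset\Delta$ be the set of roots whose root spaces lie in $\mathfrak l_1$. Let $\alpha_1,\dots,\alpha_r$ be any sequence of pairwise orthogonal long roots in $\Delta_1$ that is maximal, i.e. no long root of $\Delta_1$ is orthogonal to all $\alpha_i$. Choose non-zero root vectors $e_{\alpha_i}$, $e_{-\alpha_i}$ for $\alpha_i$,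 $-\alpha_i$. For $k=0,\dots,r$ put $e_k=e_{\alpha_1}+\dots+e_{\alpha_k}$ and $f_k=e_{-\alpha_1}+\dots+e_{-\alpha_k}$ (so $e_0=f_0=0$), and let $\mathcal O_k=G\cdot e_k$, $\mathcal O'_k=G\cdot f_k$. Then: (a) $\mathfrak l_1=\bigsqcup_{k=0}^r\mathcal O_k$ and $\mathfrak l_{-1}=\bigsqcup_{k=0}^r\mathcal O'_k$. (b) For $0\le i,j\le r$: $\mathcal O_i\subset\overline{\mathcal O_j}$ if and only if $i\le j$, if and only if $\mathcal O'_i\subset\overline{\mathcal O'_j}$ (Zariski closures). (c) Identify $\mathfrak l_{-1}$ with $\mathfrak l_1^*$ by the Killing form. For $k=0,\dots,r$, $\mathcal O_k$ corresponds to $\mathcal O'_{r-k}$ in the Pyasetskii pairing, that is, the projectivizations of $\overline{\mathcal O_k}\subset\mathfrak l_1$ and $\overline{\mathcal O'_{r-k}}\subset\mathfrak l_1^*$ are projectively dual to each other. Here, for an irreducible closed cone $Y\subset V$, the dual cone in $V^*$ is the Zariski closure of the set of linear forms vanishing on the tangent space of $Y$ at some smooth point of $Y$ (so $\{0\}$ and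 $V^*$ are dual to $V$ and $\{0\}$, respectively). (d) Suppose that the root vectors are normalized by $[e_{\alpha_i},e_{-\alpha_i}]=\alpha_i^\vee$, where $\alpha_i^\vee\in\mathfrak t$ is the coroot. For $1\le k\le r$ let $h_k=\alpha_1^\vee+\dots+\alpha_k^\vee$. Then $\langle e_k,h_k,f_k\rangle$ is a homogeneous $\mathfrak{sl}_2$-subalgebra: $(e_k,h_k,f_k)$ is an $\mathfrak{sl}_2$-triple with $e_k\in\mathfrak l_1$, $h_k\in\mathfrak l_0$, $f_k\in\mathfrak l_{-1}$. -/

import Mathlib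

open Module Topology

attribute [local instance 100] LieRing.ofAssociativeRing

noncomputable section

namespace ShortGrading

/-! ### The Zariski topology on a finite-dimensional complex vector space -/

section Zariski

variable {V W : Type*} [AddCommGroup V] [Module ℂ V] [AddCommGroup W] [Module ℂ W]

/-- Polynomial functions on `V` are polynomials in the linear forms on `V` (no basis is chosen);
`polyEval p v` is the value at `v` of the polynomial function given by `p`. -/
def polyEval (p : MvPolynomial (Dual ℂ V) ℂ) (v : V) : ℂ :=
  MvPolynomial.eval (fun φ : Dual ℂ V => φ v) p

/-- The ideal `I(S)` of polynomial functions that vanish on `S`, as a set. -/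
def vanishing (S : Set V) : Set (MvPolynomial (Dual ℂ V) ℂ) :=
  {p | ∀ s ∈ S, polyEval p s = 0}

/-- The Zariski closure of `S`: the common zeros of all polynomial functions vanishing on `S`. -/
def zariskiClosure (S : Set V) : Set V :=
  {v | ∀ p ∈ vanishing S, polyEval p v = 0}

theorem subset_zariskiClosure (S : Set V) : S ⊆ zariskiClosure S :=
  fun _ hv _ hp => hp _ hv

theorem zariskiClosure_mono {S T : Set V} (h : S ⊆ T) : zariskiClosure S ⊆ zariskiClosure T :=
  fun _ hv p hp => hv p fun s hs => hp s (h hs)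

variable (V) in
/-- The Zariski topology: the closed sets are the common zero sets of polynomial functions. -/
@[reducible] def zariskiTopology : TopologicalSpace V :=
  TopologicalSpace.ofClosed {Z | zariskiClosure Z ⊆ Z}
    (fun v hv => by
      have h := hv 1 (fun s hs => hs.elim)
      simp [polyEval] at h)
    (fun A hA v hv Z hZ => hA hZ (zariskiClosure_mono (Set.sInter_subset_of_mem hZ) hv))
    (fun A hA B hB v hv => by
      by_contra hn
      rw [Set.mem_union, not_or] at hn
      have h1 : v ∉ zariskiClosure A := fun h => hn.1 (hA h)
      have h2 : v ∉ zariskiClosure B := fun h => hn.2 (hB h)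
      simp only [zariskiClosure, Set.mem_ofPred_eq, not_forall] at h1 h2
      obtain ⟨p, hp, hpv⟩ := h1
      obtain ⟨q, hq, hqv⟩ := h2
      have h := hv (p * q) (by
        rintro s (hs | hs)
        · simp only [polyEval, map_mul]
          exact mul_eq_zero_of_left (hp s hs) _
        · simp only [polyEval, map_mul]
          exact mul_eq_zero_of_right _ (hq s hs))
      simp only [polyEval, map_mul] at h
      exact (mul_eq_zero.1 h).elim hpv hqv)

theorem isClosed_zariski_iff {Z : Set V} :
    IsClosed[zariskiTopology V] Z ↔ zariskiClosure Z ⊆ Z := by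
  rw [← @isOpen_compl_iff _ _ (zariskiTopology V)]
  change Zᶜᶜ ∈ {Z : Set V | zariskiClosure Z ⊆ Z} ↔ _
  rw [compl_compl]
  rfl

/-- Linear maps are continuous for the Zariski topologies. -/
theorem continuous_zariski (f : V →ₗ[ℂ] W) :
    Continuous[zariskiTopology V, zariskiTopology W] f := by
  let := zariskiTopology V
  let := zariskiTopology W
  refine continuous_iff_isClosed.2 fun Z hZ => ?_
  rw [isClosed_zariski_iff] at hZ ⊢
  intro v hv
  refine hZ fun p hp => ?_
  have key : ∀ u : V, polyEval (MvPolynomial.rename (fun φ : Dual ℂ W => φ ∘ₗ f) p) u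
      = polyEval p (f u) := by
    intro u
    simp only [polyEval, MvPolynomial.eval_rename]
    rfl
  rw [← key]
  exact hv _ fun s hs => (key s).trans (hp _ hs)

/-! ### Tangent spaces, smooth points, projective duality of cones -/

/-- The differential at `v` of the polynomial function given by `p`, as a linear form on `V`:
apply to `p` the derivation sending each linear form `φ` to the constant `φ w`, and evaluate
at `v`. -/
def differential (p : MvPolynomial (Dual ℂ V) ℂ) (v : V) : V →ₗ[ℂ] ℂ where
  toFun w := polyEval (MvPolynomial.mkDerivation ℂ
    (fun φ : Dual ℂ V => (MvPolynomial.C (φ w) : MvPolynomial (Dual ℂ V) ℂ)) p) v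
  map_add' w w' := by
    have h : MvPolynomial.mkDerivation ℂ
        (fun φ : Dual ℂ V => (MvPolynomial.C (φ (w + w')) : MvPolynomial (Dual ℂ V) ℂ))
        = MvPolynomial.mkDerivation ℂ (fun φ => MvPolynomial.C (φ w))
          + MvPolynomial.mkDerivation ℂ (fun φ => MvPolynomial.C (φ w')) :=
      MvPolynomial.derivation_ext (by simp [MvPolynomial.mkDerivation_X])
    rw [h]
    simp [polyEval]
  map_smul' c w := by
    have h : MvPolynomial.mkDerivation ℂ
        (fun φ : Dual ℂ V => (MvPolynomial.C (φ (c • w)) : MvPolynomial (Dual ℂ V) ℂ))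
        = c • MvPolynomial.mkDerivation ℂ (fun φ => MvPolynomial.C (φ w)) :=
      MvPolynomial.derivation_ext
        (by simp [MvPolynomial.mkDerivation_X, MvPolynomial.smul_eq_C_mul])
    rw [h]
    simp [polyEval, MvPolynomial.smul_eq_C_mul]

/-- The tangent space `T_y Y ⊆ V` of a subvariety `Y` of the vector space `V` at `y`: the common
kernel of the differentials at `y` of the polynomials in the ideal of `Y`. -/
def tangentSpace (Y : Set V) (y : V) : Submodule ℂ V :=
  ⨅ p ∈ vanishing Y, LinearMap.ker (differential p y)

/-- Smooth points of an irreducible subvariety `Y` of `V`: the points of `Y` where the tangent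
space has the smallest possible dimension (which is the dimension of `Y`). -/
def IsSmoothPoint (Y : Set V) (y : V) : Prop :=
  y ∈ Y ∧ ∀ z ∈ Y, finrank ℂ (tangentSpace Y y) ≤ finrank ℂ (tangentSpace Y z)

/-- Projective duality on the level of cones.  For an irreducible closed cone `Y = Cone X` in `V`
this is the cone over the dual variety of `X`: the Zariski closure in the dual space of the set of
linear forms that vanish on the tangent space of `Y` at some smooth point of `Y`. Thus the dual of
the cone `{0}` (over the empty variety) is the whole dual space, and the dual of `V` is `{0}`. -/
def dualCone (Y : Set V) : Set (Dual ℂ V) :=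
  zariskiClosure {φ | ∃ y, IsSmoothPoint Y y ∧ ∀ v ∈ tangentSpace Y y, φ v = 0}

/-- An orbit `O` in `V` corresponds to an orbit `O'` in the dual space under the Pyasetskii pairing
if the projectivization of the closure of `O'` is the projective dual of the projectivization
of the closure of `O`. -/
def PyasetskiiCorresponds (O : Set V) (O' : Set (Dual ℂ V)) : Prop :=
  dualCone (zariskiClosure O) = zariskiClosure O'

end Zariski

/-! ### Linear algebraic groups -/

section Groups

variable {n : ℕ}

variable (n) in
/-- The Zariski topology on `GL_n(ℂ)`, induced from the space of matrices. -/
@[reducible] def zariskiGL : TopologicalSpace (GL (Fin n) ℂ) :=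
  (zariskiTopology (Matrix (Fin n) (Fin n) ℂ)).induced Units.val

theorem continuous_mul_left_zariskiGL (g : GL (Fin n) ℂ) :
    Continuous[zariskiGL n, zariskiGL n] (fun x => g * x) := by
  let := zariskiTopology (Matrix (Fin n) (Fin n) ℂ)
  let := zariskiGL n
  have h := continuous_zariski
    (LinearMap.mulLeft ℂ (g : Matrix (Fin n) (Fin n) ℂ))
  exact continuous_induced_rng.2 (h.comp continuous_induced_dom)

theorem mul_mem_connectedComponentIn_zariskiGL (C : Subgroup (GL (Fin n) ℂ))
    (g : GL (Fin n) ℂ) (hg : g ∈ C)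
    (hor : g ∈ @connectedComponentIn _ (zariskiGL n) (C : Set (GL (Fin n) ℂ)) 1 ∨
      g⁻¹ ∈ @connectedComponentIn _ (zariskiGL n) (C : Set (GL (Fin n) ℂ)) 1)
    (x : GL (Fin n) ℂ)
    (hx : x ∈ @connectedComponentIn _ (zariskiGL n) (C : Set (GL (Fin n) ℂ)) 1) :
    g * x ∈ @connectedComponentIn _ (zariskiGL n) (C : Set (GL (Fin n) ℂ)) 1 := by
  let := zariskiGL n
  have one_mem : (1 : GL (Fin n) ℂ) ∈ connectedComponentIn (C : Set (GL (Fin n) ℂ)) 1 :=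
    mem_connectedComponentIn C.one_mem
  have hpre : IsPreconnected ((fun x => g * x) ''
      connectedComponentIn (C : Set (GL (Fin n) ℂ)) 1) :=
    isPreconnected_connectedComponentIn.image _ (continuous_mul_left_zariskiGL g).continuousOn
  have hsub : (fun x => g * x) '' connectedComponentIn (C : Set (GL (Fin n) ℂ)) 1 ⊆ C := by
    rintro _ ⟨y, hy, rfl⟩
    exact C.mul_mem hg (connectedComponentIn_subset _ _ hy)
  rcases hor with h | h
  · have h1 := hpre.subset_connectedComponentIn (x := g) ⟨1, one_mem, mul_one g⟩ hsub
    rw [← connectedComponentIn_eq h] at h1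
    exact h1 ⟨x, hx, rfl⟩
  · exact hpre.subset_connectedComponentIn ⟨g⁻¹, h, mul_inv_cancel g⟩ hsub ⟨x, hx, rfl⟩

/-- The identity component of a subgroup of `GL_n(ℂ)`: its connected component at `1` for the
Zariski topology. -/
def identityComponent (C : Subgroup (GL (Fin n) ℂ)) : Subgroup (GL (Fin n) ℂ) where
  carrier := @connectedComponentIn _ (zariskiGL n) (C : Set (GL (Fin n) ℂ)) 1
  one_mem' := @mem_connectedComponentIn _ (zariskiGL n) _ _ C.one_mem
  mul_mem' {a b} ha hb := mul_mem_connectedComponentIn_zariskiGL C a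
    (@connectedComponentIn_subset _ (zariskiGL n) _ _ _ ha) (Or.inl ha) b hb
  inv_mem' {a} ha := by
    have h := mul_mem_connectedComponentIn_zariskiGL C a⁻¹
      (C.inv_mem (@connectedComponentIn_subset _ (zariskiGL n) _ _ _ ha))
      (Or.inr (by rwa [inv_inv])) 1 (@mem_connectedComponentIn _ (zariskiGL n) _ _ C.one_mem)
    rwa [mul_one] at h

/-- `L` is a connected linear algebraic group: a Zariski closed connected subgroup of `GL_n(ℂ)`. -/
structure IsConnectedAlgebraicGroup (L : Subgroup (GL (Fin n) ℂ)) : Prop where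
  isClosed : IsClosed[zariskiGL n] (L : Set (GL (Fin n) ℂ))
  connected : identityComponent L = L

/-- `𝔩` is the Lie algebra of the algebraic group `L`: it consists of the matrices `X` such
that `exp (t X)` lies in `L` for all complex `t`. -/
def IsLieAlgebraOf (L : Subgroup (GL (Fin n) ℂ))
    (𝔩 : LieSubalgebra ℂ (Matrix (Fin n) (Fin n) ℂ)) : Prop :=
  ∀ X : Matrix (Fin n) (Fin n) ℂ,
    X ∈ 𝔩 ↔ ∀ t : ℂ, ∃ g ∈ L, (g : Matrix (Fin n) (Fin n) ℂ) = NormedSpace.exp (t • X)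

/-- The centralizer in `L` of a matrix `ξ` (the stabilizer of `ξ` for the adjoint action). -/
def centralizerIn (L : Subgroup (GL (Fin n) ℂ)) (ξ : Matrix (Fin n) (Fin n) ℂ) :
    Subgroup (GL (Fin n) ℂ) where
  carrier := {g | g ∈ L ∧ (g : Matrix (Fin n) (Fin n) ℂ) * ξ = ξ * g}
  one_mem' := ⟨L.one_mem, by simp⟩
  mul_mem' := by
    rintro a b ⟨ha, ha'⟩ ⟨hb, hb'⟩
    refine ⟨L.mul_mem ha hb, ?_⟩
    rw [Units.val_mul, mul_assoc, hb', ← mul_assoc, ha', mul_assoc]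
  inv_mem' := by
    rintro a ⟨ha, ha'⟩
    refine ⟨L.inv_mem ha, ?_⟩
    rw [Units.inv_mul_eq_iff_eq_mul, ← mul_assoc, ha', mul_assoc, Units.mul_inv, mul_one]

/-- The orbit in `𝔩` of `x` under the adjoint action (conjugation of matrices) of `G`. -/
def adOrbit {𝔩 : LieSubalgebra ℂ (Matrix (Fin n) (Fin n) ℂ)}
    (G : Subgroup (GL (Fin n) ℂ)) (x : 𝔩) : Set 𝔩 :=
  {y | ∃ g ∈ G, (y : Matrix (Fin n) (Fin n) ℂ) =
    (g : Matrix (Fin n) (Fin n) ℂ) * (x : Matrix (Fin n) (Fin n) ℂ) *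
      ((g⁻¹ : GL (Fin n) ℂ) : Matrix (Fin n) (Fin n) ℂ)}

end Groups

/-! ### Gradings and roots -/

section Lie

variable {𝔩 : Type*} [LieRing 𝔩] [LieAlgebra ℂ 𝔩]

/-- A `ℤ`-grading is short if exactly the parts of degrees `-1`, `0`, `1` are non-zero. -/
def IsShort (ℒ : ℤ → Submodule ℂ 𝔩) : Prop :=
  ∀ k, ℒ k ≠ ⊥ ↔ k = -1 ∨ k = 0 ∨ k = 1

/-- `ξ` is the element that defines the grading: `ℒ k` is the `k`-eigenspace of `ad ξ`. -/
def IsGradingElement (ℒ : ℤ → Submodule ℂ 𝔩) (ξ : 𝔩) : Prop :=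
  ∀ (k : ℤ) (x : 𝔩), x ∈ ℒ k ↔ ⁅ξ, x⁆ = (k : ℂ) • x

/-- The partial sum `v_1 + … + v_k` of a finite sequence `v_1, …, v_r`. -/
def partialSum {M : Type*} [AddCommMonoid M] {r : ℕ} (v : Fin r → M) (k : ℕ) : M :=
  ∑ i with i.val < k, v i

variable [FiniteDimensional ℂ 𝔩] [LieAlgebra.IsKilling ℂ 𝔩]
  (H : LieSubalgebra ℂ 𝔩) [H.IsCartanSubalgebra]

/-- A long root: a root of maximal length, for the canonical Weyl-invariant form. -/
def IsLong (α : H.root) : Prop :=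
  ∀ β : H.root, ((LieAlgebra.IsKilling.rootSystem H).posRootForm ℤ).rootLength β ≤
    ((LieAlgebra.IsKilling.rootSystem H).posRootForm ℤ).rootLength α

/-- The coroot `α^∨` of a root `α`, as an element of `𝔩`. -/
def corootElement (α : H.root) : 𝔩 :=
  ((LieAlgebra.IsKilling.coroot α.1 : H) : 𝔩)

/-- `Δ_k`: the roots whose root space lies in the part of degree `k`. -/
def rootsOfDegree (ℒ : ℤ → Submodule ℂ 𝔩) (k : ℤ) : Set H.root :=
  {α | (LieAlgebra.rootSpace H α.1).toSubmodule ≤ ℒ k}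

/-- `α_1, …, α_r` is a maximal sequence of pairwise orthogonal long roots in `Δ_1`: it cannot be
extended by a further long root of `Δ_1` orthogonal to all its members. -/
structure IsMaximalOrthogonalLong (ℒ : ℤ → Submodule ℂ 𝔩) {r : ℕ} (α : Fin r → H.root) :
    Prop where
  mem : ∀ i, α i ∈ rootsOfDegree H ℒ 1
  long : ∀ i, IsLong H (α i)
  orthogonal : ∀ i j, i ≠ j → (LieAlgebra.IsKilling.rootSystem H).IsOrthogonal (α i) (α j)
  maximal : ∀ β ∈ rootsOfDegree H ℒ 1, IsLong H β →
    ∃ i, ¬ (LieAlgebra.IsKilling.rootSystem H).IsOrthogonal (α i) β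

end Lie

end ShortGrading

end

/-! Write h_T, e_T, f_T for the sums over i ∈ T of α_i^∨, e_i, f_i. All degrees lie in {-1, 0, 1},
so reflecting a root of degree one successively in the orthogonal roots α_i bounds its total
pairing: h_T acts on 𝔩_1 with weights 0, 1, 2 only (`sum_pairingIn_le_two`). Most vanishing
statements below are weight arguments of this kind. Everything about 𝔩_{-1} comes from
`IsFrame.neg`, which replaces ξ by -ξ and swaps e and f. Of the group G only three properties matter
(`IsGradedAction`): it acts by automorphisms, it fixes ξ, and it contains the exponentials of 𝔩_0.

Orbits. Irreducibility of the root system and maximality of the sequence show that the span of the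
orbit of y ≠ 0 contains some e_j (`exists_e_mem`). Hence a conjugate of y has a non-zero component
of α_j^∨-weight 2, which is a multiple of e_j because α_j is long. An exponential then removes the
component of weight 1, as in completing the square, and the remainder has weight 0. Induction inside
the part of 𝔩_1 killed by the coroots already used makes y conjugate to some e_T
(`exists_map_eq_vecSum`). Exchanging one index at a time shows that only the size of T matters
(`exists_map_vecSum_eq`).

Closures. The torus degenerates e_T to e_S for S ⊆ T. Conversely, the rank of (ad x)² is G-invariant
and does not go up in a closure. The image of (ad e_T)² is the space of h_T-weight 2 in 𝔩_1
(`range_ad_sq`), so this rank grows strictly with T. This gives the closure order, and with it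
disjointness.

Duality. The tangent space at e_T to the closure of its orbit is [h_T, 𝔩_1], the sum of the weight
spaces 1 and 2 (`tangentSpace_vec`). It contains [h_T, 𝔩_1] by differentiating the action; the other
inclusion comes from linearizing the minors of (ad x)². At any point of the closure the tangent
space contains a conjugate of [h_T, 𝔩_1], which is enough to control all smooth points. Under the
Killing form the annihilator of [h_T, 𝔩_1] is the subspace of 𝔩_{-1} killed by h_T. Its elements are
conjugate to f_S with S disjoint from T, and f_S for S the complement of T belongs to it, so the
dual cone is the closure of the orbit of that f_S (`pyasetskiiCorresponds`). -/

set_option linter.unusedSectionVars false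

/-! ### Combinatorics of roots of degree -1, 0, 1 -/

namespace RootPairing

variable {ι K M N : Type*} [Fintype ι] [Field K] [CharZero K] [AddCommGroup M] [Module K M]
  [AddCommGroup N] [Module K N] (P : RootPairing ι K M N) [P.IsCrystallographic]

theorem pairingIn_reflectionPerm_left (a b c : ι) :
    P.pairingIn ℤ (P.reflectionPerm a b) c =
      P.pairingIn ℤ b c - P.pairingIn ℤ b a * P.pairingIn ℤ a c := by
  have h := P.pairingIn_eq_add_of_root_eq_smul_add_smul (S := ℤ) (i := b) (j := c)
    (k := P.reflectionPerm a b) (l := a) (x := 1) (y := -P.pairingIn ℤ b a) (by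
      rw [root_reflectionPerm, reflection_apply_root' ℤ, one_smul, neg_smul, sub_eq_add_neg])
  rw [h]; simp; ring

theorem pairingIn_eq_zero_comm {a b : ι} : P.pairingIn ℤ a b = 0 ↔ P.pairingIn ℤ b a = 0 :=
  have : Module.IsReflexive K M := .of_isPerfPair P.toLinearMap
  P.pairingIn_eq_zero_iff

/-- In an irreducible root pairing, any two roots admit a root that is orthogonal to neither. -/
theorem exists_pairingIn_ne_zero_and_ne_zero [P.IsIrreducible] (i j : ι) :
    ∃ k, P.pairingIn ℤ k i ≠ 0 ∧ P.pairingIn ℤ k j ≠ 0 := by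
  set s : Set ι := {j | ∃ k, P.pairingIn ℤ k i ≠ 0 ∧ P.pairingIn ℤ k j ≠ 0} with hs
  -- The set `s` is closed under passing to a non-orthogonal root. The new link is the old `k`, or
  -- `a` itself, or, when both fail, the reflection of `k` in `a`.
  have closed : ∀ a b, a ∈ s → P.pairingIn ℤ b a ≠ 0 → b ∈ s := by
    rintro a b ⟨k, hki, hka⟩ hba
    by_cases hkb : P.pairingIn ℤ k b = 0
    · by_cases hai : P.pairingIn ℤ a i = 0
      · refine ⟨P.reflectionPerm a k, ?_, ?_⟩
        · rw [pairingIn_reflectionPerm_left, hai]; simpa using hki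
        · rw [pairingIn_reflectionPerm_left, hkb]
          have : P.pairingIn ℤ a b ≠ 0 := fun h => hba (P.pairingIn_eq_zero_comm.1 h)
          simp [hka, this]
      · exact ⟨a, hai, fun h => hba (P.pairingIn_eq_zero_comm.1 h)⟩
    · exact ⟨k, hki, hkb⟩
  have his : i ∈ s := ⟨i, by simp, by simp⟩
  by_contra hj
  have hjs : j ∉ s := hj
  -- By irreducibility `s` spans the whole space. If `j` were not in `s`, its coroot would vanish on
  -- this span, hence on the root of `j`.
  have htop := P.span_root_image_eq_top_of_forall_orthogonal s ⟨i, his⟩ (by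
    intro b hb a ha
    have hb' : b ∉ s := fun h => hb (Submodule.subset_span ⟨b, h, rfl⟩)
    have h0 : P.pairingIn ℤ b a = 0 := by
      by_contra h
      exact hb' (closed a b ha h)
    have h1 := P.pairingIn_eq_zero_comm.1 h0
    constructor
    · rw [← P.algebraMap_pairingIn ℤ, h0, map_zero]
    · rw [← P.algebraMap_pairingIn ℤ, h1, map_zero])
  have hle : Submodule.span K (P.root '' s) ≤ LinearMap.ker (P.coroot' j) := by
    rw [Submodule.span_le]
    rintro _ ⟨a, ha, rfl⟩
    have h0 : P.pairingIn ℤ a j = 0 := by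
      by_contra h
      exact hjs (closed a j ha fun h' => h (P.pairingIn_eq_zero_comm.1 h'))
    change P.pairing a j = 0
    rw [← P.algebraMap_pairingIn ℤ, h0, map_zero]
  rw [htop] at hle
  have h2 : P.pairing j j = 0 := hle (Submodule.mem_top (x := P.root j))
  simp at h2

/-- A root of maximal length. -/
def IsLongRoot (a : ι) : Prop :=
  ∀ b, (P.posRootForm ℤ).rootLength b ≤ (P.posRootForm ℤ).rootLength a

variable {P}

theorem IsLongRoot.abs_pairingIn_le {a : ι} (ha : P.IsLongRoot a) (b : ι) :
    |P.pairingIn ℤ b a| ≤ |P.pairingIn ℤ a b| := by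
  have h := (P.posRootForm ℤ).pairingIn_mul_eq_pairingIn_mul_swap (i := a) (j := b)
  have hb := (P.posRootForm ℤ).rootLength_pos b
  have hab := ha b
  have h' := congrArg abs h
  rw [abs_mul, abs_mul, abs_of_pos (hb.trans_le hab), abs_of_pos hb] at h'
  by_contra hlt
  push Not at hlt
  have := abs_nonneg (P.pairingIn ℤ a b)
  nlinarith

/-- In every other crystallographic case ⟨b, a^∨⟩ is ±2 or ±3 and ⟨a, b^∨⟩ is ±1, so `b` would be
longer than `a`. -/
theorem IsLongRoot.pairingIn_mem [P.IsReduced] {a b : ι} (ha : P.IsLongRoot a) (hab : b ≠ a)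
    (hab' : P.root b ≠ -P.root a) :
    P.pairingIn ℤ b a = -1 ∨ P.pairingIn ℤ b a = 0 ∨ P.pairingIn ℤ b a = 1 := by
  have h1 := P.pairingIn_pairingIn_mem_set_of_isCrystal_of_isRed' (i := b) (j := a)
    (fun h => hab (P.root.injective h)) hab'
  have h2 := ha.abs_pairingIn_le b
  simp only [Set.mem_insert_iff, Set.mem_singleton_iff, Prod.mk.injEq] at h1
  rcases h1 with h | h | h | h | h | h | h | h | h | h | h <;> rw [h.1, h.2] at h2 <;>
    simp [h.1] at h2 ⊢

variable (P) in
/-- A degree function on the roots, with values `-1`, `0`, `1`, that is additive with respect to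
reflections. -/
structure IsShortDegree (d : ι → ℤ) : Prop where
  mem : ∀ a, d a = -1 ∨ d a = 0 ∨ d a = 1
  reflectionPerm : ∀ a b, d (P.reflectionPerm a b) = d b - P.pairingIn ℤ b a * d a

namespace IsShortDegree

variable {d : ι → ℤ} (hd : P.IsShortDegree d)
include hd

theorem neg : P.IsShortDegree (fun a => -d a) where
  mem a := by rcases hd.mem a with h | h | h <;> simp [h]
  reflectionPerm a b := by rw [hd.reflectionPerm]; ring

theorem degree_neg (a : ι) : d (P.reflectionPerm a a) = -d a := by
  rw [hd.reflectionPerm]; simp; ring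

/-- The reflection of `b` in `a` has degree 1 - ⟨b, a^∨⟩, which is at most 1. -/
theorem pairingIn_nonneg {a b : ι} (ha : d a = 1) (hb : d b = 1) : 0 ≤ P.pairingIn ℤ b a := by
  have h := hd.reflectionPerm a b
  have := hd.mem (P.reflectionPerm a b)
  rw [ha, hb] at h
  omega

/-- Applying to `b` the reflections in all the roots `a i`, i ∈ T, produces `c`. -/
theorem exists_degree_eq_sub_sum {κ : Type*} {a : κ → ι} (ha : ∀ i, d (a i) = 1) (T : Finset κ)
    (horth : ∀ i ∈ T, ∀ j ∈ T, i ≠ j → P.pairingIn ℤ (a i) (a j) = 0) (b : ι) :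
    ∃ c, d c = d b - ∑ i ∈ T, P.pairingIn ℤ b (a i) := by
  classical
  -- The induction must also record that, by orthogonality, the pairings with the indices not yet
  -- used are unchanged.
  suffices h : ∀ T' ⊆ T, ∃ c, d c = d b - ∑ i ∈ T', P.pairingIn ℤ b (a i) ∧
      ∀ j ∈ T, j ∉ T' → P.pairingIn ℤ c (a j) = P.pairingIn ℤ b (a j) by
    obtain ⟨c, hc, -⟩ := h T subset_rfl
    exact ⟨c, hc⟩
  intro T'
  induction T' using Finset.induction_on with
  | empty => exact fun _ => ⟨b, by simp, fun _ _ _ => rfl⟩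
  | insert i T' hi ih =>
    intro hsub
    have hiT : i ∈ T := hsub (Finset.mem_insert_self _ _)
    obtain ⟨c, hc, hc'⟩ := ih fun x hx => hsub (Finset.mem_insert_of_mem hx)
    refine ⟨P.reflectionPerm (a i) c, ?_, fun j hj hjT => ?_⟩
    · rw [hd.reflectionPerm, hc, ha, hc' i hiT hi, Finset.sum_insert hi]; ring
    · rw [Finset.mem_insert, not_or] at hjT
      rw [pairingIn_reflectionPerm_left, horth i hiT j hj (Ne.symm hjT.1), hc' j hj hjT.2]
      ring

/-- The reflected root has degree 1 minus the sum, and no degree is below -1. -/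
theorem sum_pairingIn_le_two {κ : Type*} {a : κ → ι} (ha : ∀ i, d (a i) = 1) (T : Finset κ)
    (horth : ∀ i ∈ T, ∀ j ∈ T, i ≠ j → P.pairingIn ℤ (a i) (a j) = 0) {b : ι} (hb : d b = 1) :
    ∑ i ∈ T, P.pairingIn ℤ b (a i) ≤ 2 := by
  obtain ⟨c, hc⟩ := hd.exists_degree_eq_sub_sum ha T horth b
  have := hd.mem c
  omega

/-- Any root of degree one is linked to a long root of degree one that is orthogonal to all the
roots of degree one to which the given root is orthogonal. -/
theorem exists_isLongRoot [P.IsReduced] [P.IsIrreducible] {b : ι} (hb : d b = 1) :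
    ∃ c, P.IsLongRoot c ∧ d c = 1 ∧ P.pairingIn ℤ c b ≠ 0 ∧
      ∀ a, d a = 1 → P.pairingIn ℤ b a = 0 → P.pairingIn ℤ c a = 0 := by
  by_cases hbl : P.IsLongRoot b
  · exact ⟨b, hbl, hb, by simp, fun _ _ h => h⟩
  have : Nonempty ι := ⟨b⟩
  obtain ⟨l, hl⟩ := Finite.exists_max (P.posRootForm ℤ).rootLength
  obtain ⟨k, hk, hkb⟩ := P.exists_form_eq_form_and_form_ne_zero
    (P.posRootForm ℤ).toInvariantForm b l
  replace hk : (P.posRootForm ℤ).rootLength k = (P.posRootForm ℤ).rootLength l := by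
    apply FaithfulSMul.algebraMap_injective ℤ K
    simpa only [(P.posRootForm ℤ).algebraMap_rootLength] using! hk
  replace hkb : P.pairingIn ℤ k b ≠ 0 := by
    intro h
    apply hkb
    have h' : P.pairing b k = 0 := by
      rw [← P.algebraMap_pairingIn ℤ, P.pairingIn_eq_zero_comm.1 h, map_zero]
    exact ((P.posRootForm ℤ).toInvariantForm.apply_root_root_zero_iff b k).2 h'
  have hklong : P.IsLongRoot k := fun c => hk ▸ hl c
  obtain ⟨c, hcl, hcb⟩ : ∃ c, P.IsLongRoot c ∧ 0 < P.pairingIn ℤ c b := by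
    rcases lt_or_gt_of_ne hkb with h | h
    · refine ⟨P.reflectionPerm k k, fun x => ?_, ?_⟩
      · rw [(P.posRootForm ℤ).rootLength_reflectionPerm_self]; exact hklong x
      · rw [P.pairingIn_reflectionPerm_self_left]; omega
    · exact ⟨k, hklong, h⟩
  have hlen : (P.posRootForm ℤ).rootLength b < (P.posRootForm ℤ).rootLength c := by
    refine (hcl b).lt_of_ne fun h => hbl fun x => ?_
    rw [h]; exact hcl x
  -- Pairing 1 would force `c` to be no longer than `b`. With pairing at least 2, the degree of the
  -- reflection of `c` in `b` leaves only d c = 1 and pairing exactly 2.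
  have hge : 2 ≤ P.pairingIn ℤ c b := by
    by_contra hlt
    have h1 : P.pairingIn ℤ c b = 1 := by omega
    exact absurd ((P.posRootForm ℤ).rootLength_le_of_pairingIn_eq (Or.inr h1)) (not_le.2 hlen)
  have h1 := hd.reflectionPerm b c
  have h2 := hd.mem c
  have h3 := hd.mem (P.reflectionPerm b c)
  rw [hb] at h1
  have hc1 : d c = 1 := by omega
  have hcb2 : P.pairingIn ℤ c b = 2 := by omega
  refine ⟨c, hcl, hc1, by omega, fun a ha hba => ?_⟩
  -- The negative of the reflection of `c` in `b` has degree one and pairs with `a` to -⟨c, a^∨⟩,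
  -- because `b` is orthogonal to `a`. Both ⟨c, a^∨⟩ and its negative are therefore non-negative.
  have h4 := P.pairingIn_reflectionPerm_left b (P.reflectionPerm b c) a
  have h5 := hd.degree_neg (P.reflectionPerm b c)
  have h6 := hd.pairingIn_nonneg ha (b := P.reflectionPerm (P.reflectionPerm b c)
    (P.reflectionPerm b c)) (by omega)
  rw [P.pairingIn_reflectionPerm_self_left, P.pairingIn_reflectionPerm_left, hba] at h6
  have h7 := hd.pairingIn_nonneg ha hc1
  omega

/-- A root of degree one and any other root admit a root of degree one that is orthogonal to
neither. -/
theorem exists_degree_one [P.IsIrreducible] {a b : ι} (ha : d a = 1) :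
    ∃ c, d c = 1 ∧ P.pairingIn ℤ c a ≠ 0 ∧ P.pairingIn ℤ c b ≠ 0 := by
  by_cases hab : P.pairingIn ℤ a b = 0
  swap
  · exact ⟨a, ha, by simp, hab⟩
  have key : ∀ c, d c ≠ 0 → P.pairingIn ℤ c a ≠ 0 → P.pairingIn ℤ c b ≠ 0 →
      ∃ c, d c = 1 ∧ P.pairingIn ℤ c a ≠ 0 ∧ P.pairingIn ℤ c b ≠ 0 := by
    intro c hc hca hcb
    rcases hd.mem c with h | h | h
    · refine ⟨P.reflectionPerm c c, ?_, ?_, ?_⟩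
      · rw [hd.degree_neg]; omega
      · rw [P.pairingIn_reflectionPerm_self_left]; omega
      · rw [P.pairingIn_reflectionPerm_self_left]; omega
    · exact absurd h hc
    · exact ⟨c, h, hca, hcb⟩
  obtain ⟨c, hca, hcb⟩ := P.exists_pairingIn_ne_zero_and_ne_zero a b
  -- A link of degree zero gets degree -⟨c, a^∨⟩ ≠ 0 by reflection in `a`, which does not change its
  -- pairing with `b`; the sign is then adjusted by `key`.
  by_cases hc : d c = 0
  · refine key (P.reflectionPerm a c) ?_ ?_ ?_
    · rw [hd.reflectionPerm, hc, ha]; omega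
    · rw [P.pairingIn_reflectionPerm_left]; simp; omega
    · rw [P.pairingIn_reflectionPerm_left, hab]; simpa using hcb
  · exact key c hc hca hcb

/-- If `b` is orthogonal to a non-empty orthogonal sequence of roots of degree one, then there is a
root of degree one that is not orthogonal to `b` and whose pairings with the sequence add up to
one. -/
theorem exists_sum_pairingIn_eq_one [P.IsReduced] [P.IsIrreducible] {κ : Type*} {a : κ → ι}
    (ha : ∀ i, d (a i) = 1) (T : Finset κ) (hT : T.Nonempty)
    (horth : ∀ i ∈ T, ∀ j ∈ T, i ≠ j → P.pairingIn ℤ (a i) (a j) = 0) {b : ι} (hb : d b = 1)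
    (hbT : ∑ i ∈ T, P.pairingIn ℤ b (a i) = 0) :
    ∃ c, d c = 1 ∧ P.pairingIn ℤ b c ≠ 0 ∧ ∑ i ∈ T, P.pairingIn ℤ c (a i) = 1 := by
  obtain ⟨i, hi⟩ := hT
  obtain ⟨c, hc, hci, hcb⟩ := hd.exists_degree_one (b := b) (ha i)
  refine ⟨c, hc, fun h => hcb (P.pairingIn_eq_zero_comm.1 h), ?_⟩
  have hpos : 0 < ∑ i ∈ T, P.pairingIn ℤ c (a i) :=
    Finset.sum_pos' (fun j _ => hd.pairingIn_nonneg (ha j) hc)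
      ⟨i, hi, (hd.pairingIn_nonneg (ha i) hc).lt_of_ne' hci⟩
  have hle := hd.sum_pairingIn_le_two ha T horth hc
  by_contra hne
  have h2 : ∑ i ∈ T, P.pairingIn ℤ c (a i) = 2 := by omega
  -- Reflecting `c` first in `b` and then in all `a i` gives degree 1 - ⟨c, b^∨⟩ - 2, which is below
  -- -1.
  have hs : ∑ i ∈ T, P.pairingIn ℤ (P.reflectionPerm b c) (a i) = 2 := by
    simp only [P.pairingIn_reflectionPerm_left, Finset.sum_sub_distrib, ← Finset.mul_sum, hbT, h2]
    simp
  obtain ⟨c', hc'⟩ := hd.exists_degree_eq_sub_sum ha T horth (P.reflectionPerm b c)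
  rw [hs, hd.reflectionPerm, hc, hb] at hc'
  have h3 := hd.mem c'
  have h4 := hd.pairingIn_nonneg hb hc
  omega

end IsShortDegree

end RootPairing

/-! ### Weight spaces of coroot sums on a short grading -/

noncomputable section

namespace ShortGrading

open LieAlgebra LieAlgebra.IsKilling

section Eigen

variable {𝔩 : Type*} [LieRing 𝔩] [LieAlgebra ℂ 𝔩]

/-- The eigenspace of `ad x` for the eigenvalue `k`. -/
def lieEigenspace (x : 𝔩) (k : ℂ) : Submodule ℂ 𝔩 where
  carrier := {y | ⁅x, y⁆ = k • y}
  add_mem' {a b} ha hb := by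
    rw [Set.mem_ofPred_eq] at *
    rw [lie_add, ha, hb, smul_add]
  zero_mem' := by simp
  smul_mem' c a ha := by
    rw [Set.mem_ofPred_eq] at *
    rw [lie_smul, ha, smul_comm]

theorem mem_lieEigenspace {x : 𝔩} {k : ℂ} {y : 𝔩} : y ∈ lieEigenspace x k ↔ ⁅x, y⁆ = k • y :=
  Iff.rfl

theorem lie_mem_lieEigenspace {x y z : 𝔩} {a b c : ℂ} (hy : y ∈ lieEigenspace x a)
    (hz : z ∈ lieEigenspace x b) (h : a + b = c) : ⁅y, z⁆ ∈ lieEigenspace x c := by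
  rw [mem_lieEigenspace] at *
  rw [leibniz_lie, hy, hz, smul_lie, lie_smul, ← add_smul, h]

theorem lieEigenspace_neg (x : 𝔩) (k : ℂ) : lieEigenspace (-x) k = lieEigenspace x (-k) := by
  ext y
  rw [mem_lieEigenspace, mem_lieEigenspace, neg_lie, neg_smul, neg_eq_iff_eq_neg]

theorem eq_zero_of_mem_lieEigenspace {x y : 𝔩} {a b : ℂ} (ha : y ∈ lieEigenspace x a)
    (hb : y ∈ lieEigenspace x b) (h : a ≠ b) : y = 0 := by
  rw [mem_lieEigenspace] at *
  have : (a - b) • y = 0 := by rw [sub_smul, ← ha, ← hb, sub_self]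
  exact (smul_eq_zero.1 this).resolve_left (sub_ne_zero.2 h)

end Eigen

section Roots

variable {𝔩 : Type*} [LieRing 𝔩] [LieAlgebra ℂ 𝔩] [FiniteDimensional ℂ 𝔩]
  [LieAlgebra.IsKilling ℂ 𝔩] {H : LieSubalgebra ℂ 𝔩} [H.IsCartanSubalgebra]

theorem lie_rootVector {β : H.root} {v : 𝔩} (hv : v ∈ rootSpace H β.1) {h : 𝔩} (hh : h ∈ H) :
    ⁅h, v⁆ = β.1 ⟨h, hh⟩ • v :=
  lie_eq_smul_of_mem_rootSpace hv ⟨h, hh⟩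

theorem corootElement_mem (a : H.root) : corootElement H a ∈ H :=
  Subtype.property _

theorem corootElement_lie {β : H.root} {v : 𝔩} (hv : v ∈ rootSpace H β.1) (a : H.root) :
    ⁅corootElement H a, v⁆ = ((rootSystem H).pairingIn ℤ β a : ℂ) • v := by
  rw [lie_rootVector hv (corootElement_mem a)]
  congr 1
  have := (rootSystem H).algebraMap_pairingIn ℤ β a
  rw [rootSystem_pairing_apply] at this
  exact this.symm

theorem coe_reflectionPerm_self (a : H.root) :
    (((rootSystem H).reflectionPerm a a).1 : LieModule.Weight ℂ H 𝔩) = -a.1 := by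
  have h := (rootSystem H).root_reflectionPerm a a
  rw [RootPairing.reflection_apply_self] at h
  ext x
  exact LinearMap.congr_fun h x

theorem corootElement_reflectionPerm_self (a : H.root) :
    corootElement H ((rootSystem H).reflectionPerm a a) = -corootElement H a := by
  rw [corootElement, coe_reflectionPerm_self, coroot_neg]
  rfl

/-- A predicate that is additive and true for all weight vectors in an `H`-stable subspace is true
on the subspace. -/
theorem stable_induction (N : Submodule ℂ 𝔩) (hN : ∀ h ∈ H, ∀ y ∈ N, ⁅h, y⁆ ∈ N)
    {p : 𝔩 → Prop} (hzero : p 0) (hadd : ∀ x y, p x → p y → p (x + y))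
    (hroot : ∀ β : H.root, ∀ v ∈ N, v ∈ rootSpace H β.1 → p v)
    (hcartan : ∀ v ∈ N, v ∈ H → p v) {y : 𝔩} (hy : y ∈ N) : p y := by
  let N' : LieSubmodule ℂ H 𝔩 := { N with lie_mem := fun {h y} hy => hN h h.2 y hy }
  have htop := LieModule.iSup_genWeightSpace_eq_top ℂ H N'
  have hmem : (⟨y, hy⟩ : N') ∈ ⨆ χ : H → ℂ, LieModule.genWeightSpace N' χ := by
    rw [htop]; exact LieSubmodule.mem_top _
  refine LieSubmodule.iSup_induction (motive := fun x : N' => p x) _ hmem ?_ hzero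
    (fun x y hx hy => hadd x y hx hy)
  intro χ v hv
  have hv' : (v : 𝔩) ∈ rootSpace H χ :=
    LieModule.map_genWeightSpace_le N'.incl (LieSubmodule.mem_map_of_mem hv)
  by_cases hχ : χ = 0
  · subst hχ
    refine hcartan _ v.2 ?_
    rw [rootSpace_zero_eq] at hv'
    simpa using hv'
  · by_cases hv0 : (v : 𝔩) = 0
    · rw [hv0]; exact hzero
    · have hne : rootSpace H χ ≠ ⊥ := fun h => hv0 (by rw [h] at hv'; simpa using hv')
      let w : LieModule.Weight ℂ H 𝔩 := ⟨χ, hne⟩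
      have hw : w ∈ H.root := by
        rw [LieSubalgebra.root, Finset.mem_filter]
        exact ⟨Finset.mem_univ _, hχ⟩
      exact hroot ⟨w, hw⟩ v v.2 hv'

end Roots

section Frame

variable {𝔩 : Type*} [LieRing 𝔩] [LieAlgebra ℂ 𝔩] [FiniteDimensional ℂ 𝔩]
  [LieAlgebra.IsKilling ℂ 𝔩] (H : LieSubalgebra ℂ 𝔩) [H.IsCartanSubalgebra]

/-- A short grading element `ξ` in the Cartan subalgebra `H`, with a maximal sequence of pairwise
orthogonal long roots of degree one and normalized root vectors. -/
structure IsFrame (ξ : 𝔩) (d : H.root → ℤ) {r : ℕ} (α : Fin r → H.root) (e f : Fin r → 𝔩) :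
    Prop where
  mem_cartan : ξ ∈ H
  apply_eq : ∀ β : H.root, β.1 ⟨ξ, mem_cartan⟩ = d β
  degree_mem : ∀ β, d β = -1 ∨ d β = 0 ∨ d β = 1
  degree_one : ∀ i, d (α i) = 1
  long : ∀ i, (rootSystem H).IsLongRoot (α i)
  orthogonal : ∀ i j, i ≠ j → (rootSystem H).pairingIn ℤ (α i) (α j) = 0
  maximal : ∀ β, d β = 1 → (rootSystem H).IsLongRoot β →
    ∃ i, (rootSystem H).pairingIn ℤ (α i) β ≠ 0
  triple : ∀ i, IsSl2Triple (corootElement H (α i)) (e i) (f i)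
  e_mem : ∀ i, e i ∈ rootSpace H (α i).1
  f_mem : ∀ i, f i ∈ rootSpace H (-(α i).1 : LieModule.Weight ℂ H 𝔩)

variable {H} {ξ : 𝔩} {d : H.root → ℤ} {r : ℕ} {α : Fin r → H.root} {e f : Fin r → 𝔩}

namespace IsFrame

variable (F : IsFrame H ξ d α e f)
include F

theorem lie_grading {β : H.root} {v : 𝔩} (hv : v ∈ rootSpace H β.1) :
    v ∈ lieEigenspace ξ (d β) := by
  rw [mem_lieEigenspace, lie_rootVector hv F.mem_cartan, F.apply_eq]

theorem isShortDegree : (rootSystem H).IsShortDegree d where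
  mem := F.degree_mem
  reflectionPerm a b := by
    have h := LinearMap.congr_fun ((rootSystem H).root_reflectionPerm a b) ⟨ξ, F.mem_cartan⟩
    rw [RootPairing.reflection_apply_root' ℤ] at h
    simp only [rootSystem_root_apply, LieModule.Weight.toLinear_apply, LinearMap.sub_apply,
      LinearMap.smul_apply, F.apply_eq] at h
    simp only [zsmul_eq_mul] at h
    exact_mod_cast h

theorem e_mem_one (i : Fin r) : e i ∈ lieEigenspace ξ 1 := by
  have := F.lie_grading (F.e_mem i)
  rwa [F.degree_one, Int.cast_one] at this

theorem f_mem_reflectionPerm (i : Fin r) :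
    f i ∈ rootSpace H ((rootSystem H).reflectionPerm (α i) (α i)).1 := by
  rw [coe_reflectionPerm_self]; exact F.f_mem i

theorem f_mem_neg_one (i : Fin r) : f i ∈ lieEigenspace ξ (-1) := by
  have := F.lie_grading (F.f_mem_reflectionPerm i)
  rwa [F.isShortDegree.degree_neg, F.degree_one, Int.cast_neg, Int.cast_one] at this

/-- The opposite frame. -/
theorem neg : IsFrame H (-ξ) (fun β => -d β)
    (fun i => (rootSystem H).reflectionPerm (α i) (α i)) f e where
  mem_cartan := H.neg_mem F.mem_cartan
  apply_eq β := by
    have h := F.apply_eq β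
    have h' : (⟨-ξ, H.neg_mem F.mem_cartan⟩ : H) = -⟨ξ, F.mem_cartan⟩ := rfl
    rw [h', ← LieModule.Weight.toLinear_apply, map_neg, LieModule.Weight.toLinear_apply, h,
      Int.cast_neg]
  degree_mem := F.isShortDegree.neg.mem
  degree_one i := by rw [F.isShortDegree.degree_neg, F.degree_one]; rfl
  long i β := by
    rw [((rootSystem H).posRootForm ℤ).rootLength_reflectionPerm_self]; exact F.long i β
  orthogonal i j hij := by
    rw [RootPairing.pairingIn_reflectionPerm_self_left,
      RootPairing.pairingIn_reflectionPerm_self_right, F.orthogonal i j hij]; rfl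
  maximal β hβ hlong := by
    obtain ⟨i, hi⟩ := F.maximal ((rootSystem H).reflectionPerm β β)
      (by rw [F.isShortDegree.degree_neg, hβ]) (fun γ => by
        rw [((rootSystem H).posRootForm ℤ).rootLength_reflectionPerm_self]; exact hlong γ)
    refine ⟨i, fun h => hi ?_⟩
    rw [RootPairing.pairingIn_reflectionPerm_self_left, neg_eq_zero] at h
    rw [RootPairing.pairingIn_reflectionPerm_self_right, h, neg_zero]
  triple i := by
    rw [corootElement_reflectionPerm_self]; exact (F.triple i).symm
  e_mem := F.f_mem_reflectionPerm
  f_mem i := by rw [coe_reflectionPerm_self, neg_neg]; exact F.e_mem i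

theorem eq_zero_of_degree {k : ℂ} (h0 : k ≠ 0) (h1 : k ≠ 1) (h2 : k ≠ -1) {y : 𝔩}
    (hy : y ∈ lieEigenspace ξ k) : y = 0 := by
  refine stable_induction (H := H) (lieEigenspace ξ k) (fun h hh y hy => ?_) (p := fun y => y = 0)
    rfl (fun x y hx hy => by rw [hx, hy, add_zero]) ?_ ?_ hy
  · refine lie_mem_lieEigenspace (a := 0) (b := k) ?_ hy (zero_add k)
    rw [mem_lieEigenspace, zero_smul]
    exact congrArg Subtype.val (LieModule.IsTrivial.trivial (⟨ξ, F.mem_cartan⟩ : H) (⟨h, hh⟩ : H))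
  · intro β v hv hv'
    refine eq_zero_of_mem_lieEigenspace hv (F.lie_grading hv') ?_
    rcases F.degree_mem β with h | h | h <;> rw [h] <;> simpa
  · intro v hv hv'
    refine eq_zero_of_mem_lieEigenspace hv (b := 0) ?_ h0
    rw [mem_lieEigenspace, zero_smul]
    exact congrArg Subtype.val (LieModule.IsTrivial.trivial (⟨ξ, F.mem_cartan⟩ : H) (⟨v, hv'⟩ : H))

theorem cartan_lie_grading {h : 𝔩} (hh : h ∈ H) : h ∈ lieEigenspace ξ 0 := by
  rw [mem_lieEigenspace, zero_smul]
  exact congrArg Subtype.val (LieModule.IsTrivial.trivial (⟨ξ, F.mem_cartan⟩ : H) (⟨h, hh⟩ : H))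

theorem grading_lie_cartan {h : 𝔩} (hh : h ∈ H) : ⁅ξ, h⁆ = 0 := by
  simpa [mem_lieEigenspace] using F.cartan_lie_grading hh

/-- Induction over the root vectors in an `H`-stable subspace of `𝔩_1`. -/
theorem induction_one (N : Submodule ℂ 𝔩) (hN : ∀ h ∈ H, ∀ y ∈ N, ⁅h, y⁆ ∈ N)
    (hN1 : N ≤ lieEigenspace ξ 1)
    {p : 𝔩 → Prop} (hzero : p 0) (hadd : ∀ x y, p x → p y → p (x + y))
    (hroot : ∀ β : H.root, d β = 1 → ∀ v ∈ N, v ∈ rootSpace H β.1 → p v)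
    {y : 𝔩} (hy : y ∈ N) : p y := by
  refine stable_induction N hN hzero hadd (fun β v hv hv' => ?_) (fun v hv hv' => ?_) hy
  · by_cases hβ : d β = 1
    · exact hroot β hβ v hv hv'
    · rw [eq_zero_of_mem_lieEigenspace (hN1 hv) (F.lie_grading hv')
        (by exact_mod_cast Ne.symm hβ)]
      exact hzero
  · rw [eq_zero_of_mem_lieEigenspace (hN1 hv) (F.cartan_lie_grading hv') one_ne_zero]
    exact hzero

theorem stable_one {h : 𝔩} (hh : h ∈ H) {y : 𝔩} (hy : y ∈ lieEigenspace ξ 1) :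
    ⁅h, y⁆ ∈ lieEigenspace ξ 1 :=
  lie_mem_lieEigenspace (F.cartan_lie_grading hh) hy (zero_add 1)

/-- The bracket has degree two. -/
theorem lie_eq_zero_of_one {x y : 𝔩} (hx : x ∈ lieEigenspace ξ 1) (hy : y ∈ lieEigenspace ξ 1) :
    ⁅x, y⁆ = 0 :=
  F.eq_zero_of_degree (k := 2) (by norm_num) (by norm_num) (by norm_num)
    (lie_mem_lieEigenspace hx hy (by norm_num))

omit F in
variable (α) in
/-- The sum of the coroots with index in `T`. -/
def _root_.ShortGrading.corootSum (T : Finset (Fin r)) : 𝔩 := ∑ i ∈ T, corootElement H (α i)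

omit F in
theorem _root_.ShortGrading.corootSum_mem (T : Finset (Fin r)) : corootSum α T ∈ H :=
  sum_mem fun _ _ => corootElement_mem _

omit F in
theorem _root_.ShortGrading.corootSum_lie {β : H.root} {v : 𝔩} (hv : v ∈ rootSpace H β.1)
    (T : Finset (Fin r)) :
    ⁅corootSum α T, v⁆ = ((∑ i ∈ T, (rootSystem H).pairingIn ℤ β (α i) : ℤ) : ℂ) • v := by
  rw [corootSum, sum_lie]
  simp_rw [corootElement_lie hv]
  rw [← Finset.sum_smul]
  push_cast; rfl

theorem sum_pairingIn_mem (T : Finset (Fin r)) {β : H.root} (hβ : d β = 1) :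
    ∑ i ∈ T, (rootSystem H).pairingIn ℤ β (α i) = 0 ∨
    ∑ i ∈ T, (rootSystem H).pairingIn ℤ β (α i) = 1 ∨
    ∑ i ∈ T, (rootSystem H).pairingIn ℤ β (α i) = 2 := by
  have h1 := F.isShortDegree.sum_pairingIn_le_two F.degree_one T
    (fun i _ j _ hij => F.orthogonal i j hij) hβ
  have h2 : 0 ≤ ∑ i ∈ T, (rootSystem H).pairingIn ℤ β (α i) :=
    Finset.sum_nonneg fun i _ => F.isShortDegree.pairingIn_nonneg (F.degree_one i) hβ
  omega

/-- The weights of `∑ i ∈ T, α_i^∨` on `𝔩_1` are `0`, `1`, `2`. -/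
theorem exists_weight_decomposition (T : Finset (Fin r)) (N : Submodule ℂ 𝔩)
    (hN : ∀ h ∈ H, ∀ y ∈ N, ⁅h, y⁆ ∈ N) (hN1 : N ≤ lieEigenspace ξ 1) {y : 𝔩} (hy : y ∈ N) :
    ∃ y₀ ∈ N, ∃ y₁ ∈ N, ∃ y₂ ∈ N, y = y₀ + y₁ + y₂ ∧ y₀ ∈ lieEigenspace (corootSum α T) 0 ∧
      y₁ ∈ lieEigenspace (corootSum α T) 1 ∧ y₂ ∈ lieEigenspace (corootSum α T) 2 := by
  refine F.induction_one N hN hN1 (p := fun y => ∃ y₀ ∈ N, ∃ y₁ ∈ N, ∃ y₂ ∈ N, y = y₀ + y₁ + y₂ ∧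
      y₀ ∈ lieEigenspace (corootSum α T) 0 ∧ y₁ ∈ lieEigenspace (corootSum α T) 1 ∧
      y₂ ∈ lieEigenspace (corootSum α T) 2) ?_ ?_ ?_ hy
  · exact ⟨0, N.zero_mem, 0, N.zero_mem, 0, N.zero_mem, by simp, Submodule.zero_mem _,
      Submodule.zero_mem _, Submodule.zero_mem _⟩
  · rintro _ _ ⟨a0, ha0, a1, ha1, a2, ha2, rfl, ka0, ka1, ka2⟩
      ⟨b0, hb0, b1, hb1, b2, hb2, rfl, kb0, kb1, kb2⟩
    exact ⟨a0 + b0, N.add_mem ha0 hb0, a1 + b1, N.add_mem ha1 hb1, a2 + b2, N.add_mem ha2 hb2,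
      by abel, Submodule.add_mem _ ka0 kb0, Submodule.add_mem _ ka1 kb1,
      Submodule.add_mem _ ka2 kb2⟩
  · intro β hβ v hv hv'
    have h := corootSum_lie (α := α) hv' T
    rcases F.sum_pairingIn_mem T hβ with hs | hs | hs <;> rw [hs] at h
    · exact ⟨v, hv, 0, N.zero_mem, 0, N.zero_mem, by simp, by simpa [mem_lieEigenspace] using h,
        Submodule.zero_mem _, Submodule.zero_mem _⟩
    · exact ⟨0, N.zero_mem, v, hv, 0, N.zero_mem, by simp, Submodule.zero_mem _,
        by simpa [mem_lieEigenspace] using h, Submodule.zero_mem _⟩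
    · exact ⟨0, N.zero_mem, 0, N.zero_mem, v, hv, by simp, Submodule.zero_mem _,
        Submodule.zero_mem _, by simpa [mem_lieEigenspace] using h⟩

omit F in
theorem _root_.ShortGrading.cartan_stable_lieEigenspace {x : 𝔩} (hx : x ∈ H) {h : 𝔩} (hh : h ∈ H)
    {k : ℂ} {y : 𝔩} (hy : y ∈ lieEigenspace x k) : ⁅h, y⁆ ∈ lieEigenspace x k := by
  refine lie_mem_lieEigenspace (a := 0) ?_ hy (zero_add k)
  rw [mem_lieEigenspace, zero_smul]
  exact congrArg Subtype.val (LieModule.IsTrivial.trivial (⟨x, hx⟩ : H) (⟨h, hh⟩ : H))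

theorem eq_zero_of_weight (T : Finset (Fin r)) {k : ℂ} (h0 : k ≠ 0) (h1 : k ≠ 1) (h2 : k ≠ 2)
    {y : 𝔩} (hy1 : y ∈ lieEigenspace ξ 1) (hy : y ∈ lieEigenspace (corootSum α T) k) : y = 0 := by
  refine F.induction_one (lieEigenspace ξ 1 ⊓ lieEigenspace (corootSum α T) k)
    (fun h hh y hy => ⟨F.stable_one hh hy.1, cartan_stable_lieEigenspace (corootSum_mem T) hh hy.2⟩)
    inf_le_left (p := fun y => y = 0) rfl (fun x y hx hy => by rw [hx, hy, add_zero]) ?_ ⟨hy1, hy⟩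
  intro β hβ v hv hv'
  refine eq_zero_of_mem_lieEigenspace hv.2 (corootSum_lie hv' T) ?_
  rcases F.sum_pairingIn_mem T hβ with hs | hs | hs <;> rw [hs] <;> simpa

omit F in
theorem _root_.ShortGrading.exists_eq_smul_of_mem_rootSpace {β : H.root} {v w : 𝔩}
    (hv : v ∈ rootSpace H β.1) (hv0 : v ≠ 0) (hw : w ∈ rootSpace H β.1) : ∃ c : ℂ, w = c • v := by
  have h1 := finrank_rootSpace_eq_one β.1 (LieSubalgebra.isNonZero_coe_root β)
  obtain ⟨c, hc⟩ := (finrank_eq_one_iff_of_nonzero' (⟨v, hv⟩ : rootSpace H β.1)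
    (by simpa [Subtype.ext_iff] using hv0)).1 h1 ⟨w, hw⟩
  exact ⟨c, (congrArg Subtype.val hc).symm⟩

theorem root_ne_neg {β : H.root} (hβ : d β = 1) (i : Fin r) :
    (rootSystem H).root β ≠ -(rootSystem H).root (α i) := by
  intro h
  have h' := LinearMap.congr_fun h ⟨ξ, F.mem_cartan⟩
  simp only [rootSystem_root_apply, LinearMap.neg_apply, LieModule.Weight.toLinear_apply,
    F.apply_eq, hβ, F.degree_one] at h'
  norm_num at h'

/-- The weight space of `α_i^∨` for the weight `2` in `𝔩_1` is spanned by `e_i`. -/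
theorem exists_eq_smul_e {i : Fin r} {y : 𝔩} (hy1 : y ∈ lieEigenspace ξ 1)
    (hy : y ∈ lieEigenspace (corootElement H (α i)) 2) : ∃ c : ℂ, y = c • e i := by
  refine F.induction_one (lieEigenspace ξ 1 ⊓ lieEigenspace (corootElement H (α i)) 2)
    (fun h hh y hy => ⟨F.stable_one hh hy.1,
      cartan_stable_lieEigenspace (corootElement_mem _) hh hy.2⟩)
    inf_le_left (p := fun y => ∃ c : ℂ, y = c • e i) ⟨0, by simp⟩ ?_ ?_ ⟨hy1, hy⟩
  · rintro _ _ ⟨a, rfl⟩ ⟨b, rfl⟩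
    exact ⟨a + b, by rw [add_smul]⟩
  · intro β hβ v hv hv'
    by_cases hv0 : v = 0
    · exact ⟨0, by simp [hv0]⟩
    have h2 : (rootSystem H).pairingIn ℤ β (α i) = 2 := by
      by_contra hne
      exact hv0 (eq_zero_of_mem_lieEigenspace hv.2 (corootElement_lie hv' _)
        (by exact_mod_cast Ne.symm hne))
    -- The root α_i is long, so no other root of degree one has pairing 2 with it.
    by_cases hβi : β = α i
    · subst hβi
      exact exists_eq_smul_of_mem_rootSpace (F.e_mem i) (F.triple i).e_ne_zero hv'
    · have := (F.long i).pairingIn_mem hβi (F.root_ne_neg hβ i)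
      omega

theorem corootElement_lie_e (i j : Fin r) :
    ⁅corootElement H (α i), e j⁆ = (if i = j then 2 else 0 : ℂ) • e j := by
  rw [corootElement_lie (F.e_mem j)]
  split_ifs with h
  · subst h; simp
  · rw [F.orthogonal j i (Ne.symm h)]; simp

theorem corootElement_lie_f (i j : Fin r) :
    ⁅corootElement H (α i), f j⁆ = (if i = j then -2 else 0 : ℂ) • f j := by
  have h := F.neg.corootElement_lie_e i j
  rw [corootElement_reflectionPerm_self, neg_lie, neg_eq_iff_eq_neg] at h
  rw [h, ← neg_smul]
  split_ifs <;> simp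

omit F in
theorem _root_.ShortGrading.corootSum_singleton (i : Fin r) :
    corootSum α {i} = corootElement H (α i) := by
  simp [corootSum]

/-- The element x = [e_i, f_j] has α_i^∨-weight 2. It is killed by e_i, since [e_i, x] would have
degree 1 and weight 4, and by f_i, which commutes with f_j. Hence α_i^∨ = [e_i, f_i] kills x as
well, so x = 0. -/
theorem lie_e_f_of_ne {i j : Fin r} (hij : i ≠ j) : ⁅e i, f j⁆ = 0 := by
  have he : ⁅e i, ⁅e i, f j⁆⁆ = 0 := by
    refine F.eq_zero_of_weight {i} (k := 4) (by norm_num) (by norm_num) (by norm_num) ?_ ?_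
    · exact lie_mem_lieEigenspace (F.e_mem_one i)
        (lie_mem_lieEigenspace (F.e_mem_one i) (F.f_mem_neg_one j) rfl) (by norm_num)
    · rw [corootSum_singleton]
      have h1 : e i ∈ lieEigenspace (corootElement H (α i)) 2 := by
        rw [mem_lieEigenspace, F.corootElement_lie_e]; simp
      have h2 : f j ∈ lieEigenspace (corootElement H (α i)) 0 := by
        rw [mem_lieEigenspace, F.corootElement_lie_f]; simp [hij]
      exact lie_mem_lieEigenspace h1 (lie_mem_lieEigenspace h1 h2 rfl) (by norm_num)
  have hff : ⁅f i, f j⁆ = 0 := F.neg.lie_eq_zero_of_one (F.neg.e_mem_one i) (F.neg.e_mem_one j)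
  have hf : ⁅f i, ⁅e i, f j⁆⁆ = 0 := by
    rw [leibniz_lie, hff, lie_zero, add_zero, ← lie_skew (f i) (e i), (F.triple i).lie_e_f, neg_lie,
      F.corootElement_lie_f]
    simp [hij]
  have h0 : ⁅corootElement H (α i), ⁅e i, f j⁆⁆ = 0 := by
    rw [← (F.triple i).lie_e_f, lie_lie, he, hf]; simp
  have h2 : ⁅corootElement H (α i), ⁅e i, f j⁆⁆ = (2 : ℂ) • ⁅e i, f j⁆ := by
    rw [leibniz_lie, F.corootElement_lie_e, F.corootElement_lie_f]; simp [hij]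
  rw [h0] at h2
  exact (smul_eq_zero.1 h2.symm).resolve_left (by norm_num)

omit F in
variable (e) in
/-- The sum of the vectors with index in `T`. -/
def _root_.ShortGrading.vecSum (T : Finset (Fin r)) : 𝔩 := ∑ i ∈ T, e i

theorem vecSum_mem_one (T : Finset (Fin r)) : vecSum e T ∈ lieEigenspace ξ 1 :=
  sum_mem fun i _ => F.e_mem_one i

theorem lie_vecSum (T : Finset (Fin r)) : ⁅vecSum e T, vecSum f T⁆ = corootSum α T := by
  rw [vecSum, sum_lie, corootSum]
  refine Finset.sum_congr rfl fun i hi => ?_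
  rw [vecSum, lie_sum, Finset.sum_eq_single_of_mem i hi, (F.triple i).lie_e_f]
  exact fun j _ hj => F.lie_e_f_of_ne (Ne.symm hj)

theorem corootSum_lie_e (T : Finset (Fin r)) (j : Fin r) :
    ⁅corootSum α T, e j⁆ = (if j ∈ T then 2 else 0 : ℂ) • e j := by
  rw [corootSum, sum_lie]
  simp_rw [F.corootElement_lie_e]
  rw [← Finset.sum_smul, Finset.sum_ite_eq']

theorem corootSum_lie_vecSum (T : Finset (Fin r)) :
    ⁅corootSum α T, vecSum e T⁆ = (2 : ℂ) • vecSum e T := by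
  rw [vecSum, lie_sum, Finset.smul_sum]
  exact Finset.sum_congr rfl fun i hi => by rw [F.corootSum_lie_e, if_pos hi]

omit F in
theorem _root_.ShortGrading.corootSum_reflectionPerm (T : Finset (Fin r)) :
    corootSum (fun i => (rootSystem H).reflectionPerm (α i) (α i)) T = -corootSum α T := by
  simp [corootSum, corootElement_reflectionPerm_self]

theorem corootSum_lie_vecSum_f (T : Finset (Fin r)) :
    ⁅corootSum α T, vecSum f T⁆ = -((2 : ℂ) • vecSum f T) := by
  have := F.neg.corootSum_lie_vecSum T
  rwa [corootSum_reflectionPerm, neg_lie, neg_eq_iff_eq_neg] at this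

theorem isSl2Triple_sum {T : Finset (Fin r)} (hT : T.Nonempty) :
    IsSl2Triple (corootSum α T) (vecSum e T) (vecSum f T) where
  h_ne_zero h := by
    obtain ⟨i, hi⟩ := hT
    have := F.corootSum_lie_e T i
    rw [h, zero_lie, if_pos hi] at this
    exact (F.triple i).e_ne_zero ((smul_eq_zero.1 this.symm).resolve_left (by norm_num))
  lie_e_f := F.lie_vecSum T
  lie_h_e_nsmul := by rw [F.corootSum_lie_vecSum]; norm_cast
  lie_h_f_nsmul := by rw [F.corootSum_lie_vecSum_f]; norm_cast

/-- The image of `(ad e_T)²` is the weight space of `∑ i ∈ T, α_i^∨` in `𝔩_1` for the weight `2`. -/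
theorem range_ad_sq (T : Finset (Fin r)) :
    LinearMap.range ((ad ℂ 𝔩 (vecSum e T)) ^ 2) =
      lieEigenspace ξ 1 ⊓ lieEigenspace (corootSum α T) 2 := by
  apply le_antisymm
  · rintro _ ⟨w, rfl⟩
    rw [pow_two, Module.End.mul_apply, ad_apply, ad_apply]
    have hw : w ∈ (⊤ : Submodule ℂ 𝔩) := Submodule.mem_top
    have h1 := F.vecSum_mem_one T
    -- Only the part of degree -1 survives two brackets with an element of degree one.
    have hbig : ∀ k : ℂ, k = 0 ∨ k = 1 → ∀ v ∈ lieEigenspace ξ k,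
        ⁅vecSum e T, ⁅vecSum e T, v⁆⁆ = 0 := by
      intro k hk v hv
      refine F.eq_zero_of_degree (k := 2 + k) ?_ ?_ ?_
        (lie_mem_lieEigenspace h1 (lie_mem_lieEigenspace h1 hv rfl) (by ring)) <;>
      rcases hk with rfl | rfl <;> norm_num
    refine stable_induction (H := H) ⊤ (fun _ _ _ _ => Submodule.mem_top)
      (p := fun w => ⁅vecSum e T, ⁅vecSum e T, w⁆⁆ ∈
        lieEigenspace ξ 1 ⊓ lieEigenspace (corootSum α T) 2) ?_ ?_ ?_ ?_ hw
    · simp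
    · intro x y hx hy
      rw [lie_add, lie_add]
      exact Submodule.add_mem _ hx hy
    · intro β v _ hv
      have hv' := F.lie_grading hv
      rcases F.degree_mem β with h | h | h
      · rw [h] at hv'
        have hdeg : ⁅vecSum e T, ⁅vecSum e T, v⁆⁆ ∈ lieEigenspace ξ 1 :=
          lie_mem_lieEigenspace h1 (lie_mem_lieEigenspace h1 hv' rfl) (by push_cast; norm_num)
        refine ⟨hdeg, ?_⟩
        have hwt := corootSum_lie (α := α) hv T
        have hwt' : ⁅vecSum e T, ⁅vecSum e T, v⁆⁆ ∈ lieEigenspace (corootSum α T)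
            (4 + ((∑ i ∈ T, (rootSystem H).pairingIn ℤ β (α i) : ℤ) : ℂ)) :=
          lie_mem_lieEigenspace (F.corootSum_lie_vecSum T)
            (lie_mem_lieEigenspace (F.corootSum_lie_vecSum T) hwt rfl) (by ring)
        have hs := F.sum_pairingIn_mem T (β := (rootSystem H).reflectionPerm β β)
          (by rw [F.isShortDegree.degree_neg, h]; rfl)
        simp only [RootPairing.pairingIn_reflectionPerm_self_left, Finset.sum_neg_distrib] at hs
        obtain ⟨s, hs'⟩ : ∃ s, s = ∑ i ∈ T, (rootSystem H).pairingIn ℤ β (α i) := ⟨_, rfl⟩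
        rw [← hs'] at hs hwt'
        -- On degree -1 the weights are 0, -1, -2, and (ad e_T)² raises them by 4. As 𝔩_1 has no
        -- weights 3 and 4, only -2 contributes.
        by_cases hs2 : s = -2
        · rw [hs2] at hwt'
          convert hwt' using 2
          push_cast; norm_num
        · have hs3 : s = 0 ∨ s = -1 := by omega
          rw [F.eq_zero_of_weight T (k := 4 + s) ?_ ?_ ?_ hdeg hwt']
          · exact Submodule.zero_mem _
          all_goals rcases hs3 with rfl | rfl <;> push_cast <;> norm_num
      · rw [hbig (d β) (Or.inl (by rw [h]; simp)) v hv']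
        exact Submodule.zero_mem _
      · rw [hbig (d β) (Or.inr (by rw [h]; simp)) v hv']
        exact Submodule.zero_mem _
    · intro v _ hv
      rw [hbig 0 (Or.inl rfl) v (F.cartan_lie_grading hv)]
      exact Submodule.zero_mem _
  · rintro y ⟨hy1, hy⟩
    have h0 : ⁅vecSum e T, y⁆ = 0 := F.lie_eq_zero_of_one (F.vecSum_mem_one T) hy1
    replace hy : ⁅corootSum α T, y⁆ = (2 : ℂ) • y := hy
    have h1 : ⁅vecSum e T, ⁅vecSum f T, y⁆⁆ = (2 : ℂ) • y := by
      rw [leibniz_lie, F.lie_vecSum, h0, lie_zero, add_zero, hy]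
    have h2 : ⁅vecSum e T, ⁅vecSum f T, ⁅vecSum f T, y⁆⁆⁆ = (2 : ℂ) • ⁅vecSum f T, y⁆ := by
      rw [leibniz_lie, F.lie_vecSum, h1, leibniz_lie, F.corootSum_lie_vecSum_f, hy]
      simp
    -- On a vector of weight 2 killed by e_T, (ad e_T)²(ad f_T)² is multiplication by 2 · 2.
    refine ⟨(4⁻¹ : ℂ) • ⁅vecSum f T, ⁅vecSum f T, y⁆⁆, ?_⟩
    rw [map_smul, pow_two, Module.End.mul_apply, ad_apply, ad_apply, h2, lie_smul, h1, smul_smul,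
      smul_smul]
    norm_num

omit F in
variable (e) in
/-- The rank of `(ad e_T)²`. -/
def _root_.ShortGrading.adSqRank (T : Finset (Fin r)) : ℕ :=
  finrank ℂ (LinearMap.range ((ad ℂ 𝔩 (vecSum e T)) ^ 2))

/-- The spaces of weight 2 are nested: pairings are non-negative with sum at most 2, so the value 2
on `S` persists on `T`. For i in `T` but not in `S`, e_i lies only in the larger one. -/
theorem adSqRank_lt {S T : Finset (Fin r)} (hST : S ⊂ T) : adSqRank e S < adSqRank e T := by
  rw [adSqRank, adSqRank, F.range_ad_sq, F.range_ad_sq]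
  apply Submodule.finrank_lt_finrank_of_lt
  rw [SetLike.lt_iff_le_and_exists]
  constructor
  · intro y hy
    refine F.induction_one (lieEigenspace ξ 1 ⊓ lieEigenspace (corootSum α S) 2)
      (fun h hh y hy => ⟨F.stable_one hh hy.1,
        cartan_stable_lieEigenspace (corootSum_mem S) hh hy.2⟩)
      inf_le_left (p := fun y => y ∈ lieEigenspace ξ 1 ⊓ lieEigenspace (corootSum α T) 2)
      (Submodule.zero_mem _) (fun _ _ => Submodule.add_mem _) ?_ hy
    intro β hβ v hv hv'
    refine ⟨hv.1, ?_⟩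
    by_cases hv0 : v = 0
    · rw [hv0]; exact Submodule.zero_mem _
    have hS : ∑ i ∈ S, (rootSystem H).pairingIn ℤ β (α i) = 2 := by
      by_contra hne
      exact hv0 (eq_zero_of_mem_lieEigenspace hv.2 (corootSum_lie hv' S)
        (by exact_mod_cast Ne.symm hne))
    have hle : ∑ i ∈ S, (rootSystem H).pairingIn ℤ β (α i) ≤
        ∑ i ∈ T, (rootSystem H).pairingIn ℤ β (α i) :=
      Finset.sum_le_sum_of_subset_of_nonneg hST.1
        fun i _ _ => F.isShortDegree.pairingIn_nonneg (F.degree_one i) hβ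
    have hT : ∑ i ∈ T, (rootSystem H).pairingIn ℤ β (α i) = 2 := by
      have := F.sum_pairingIn_mem T hβ
      omega
    have := corootSum_lie (α := α) hv' T
    rw [hT] at this
    rw [SetLike.mem_coe, mem_lieEigenspace]
    exact_mod_cast this
  · obtain ⟨i, hiT, hiS⟩ := Finset.exists_of_ssubset hST
    refine ⟨e i, ⟨F.e_mem_one i, ?_⟩, fun h => ?_⟩
    · rw [SetLike.mem_coe, mem_lieEigenspace, F.corootSum_lie_e, if_pos hiT]
    · refine (F.triple i).e_ne_zero (eq_zero_of_mem_lieEigenspace h.2 (b := 0) ?_ (by norm_num))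
      rw [mem_lieEigenspace, F.corootSum_lie_e, if_neg hiS]

theorem adSqRank_singleton (i : Fin r) : adSqRank e {i} ≤ 1 := by
  rw [adSqRank, F.range_ad_sq, corootSum_singleton]
  refine (Submodule.finrank_mono (t := Submodule.span ℂ {e i}) ?_).trans
    (finrank_span_singleton (F.triple i).e_ne_zero).le
  rintro y ⟨hy1, hy⟩
  obtain ⟨c, rfl⟩ := F.exists_eq_smul_e hy1 hy
  exact Submodule.smul_mem _ _ (Submodule.mem_span_singleton_self _)

end IsFrame

end Frame

end ShortGrading

end

/-! ### Group actions containing the exponentials of the degree-zero part -/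

noncomputable section

namespace ShortGrading

open LieAlgebra LieAlgebra.IsKilling

section Action

variable {𝔩 : Type*} [LieRing 𝔩] [LieAlgebra ℂ 𝔩] {𝒢 : Type*} [Group 𝒢]

/-- An action by automorphisms of the Lie algebra that fix `ξ`, such that the group contains the
exponentials of the elements of the centralizer of `ξ`. -/
structure IsGradedAction (ξ : 𝔩) (ρ : Representation ℂ 𝒢 𝔩) : Prop where
  map_lie : ∀ (g : 𝒢) (x y : 𝔩), ρ g ⁅x, y⁆ = ⁅ρ g x, ρ g y⁆
  map_grading : ∀ g, ρ g ξ = ξ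
  exists_exp : ∀ z : 𝔩, ⁅ξ, z⁆ = 0 → ∃ γ : ℂ → 𝒢, γ 0 = 1 ∧ ∀ (x : 𝔩) (φ : Dual ℂ 𝔩) (t : ℂ),
    HasDerivAt (fun t => φ (ρ (γ t) x)) (φ (ρ (γ t) ⁅z, x⁆)) t

/-- `γ` is the one-parameter group generated by `z`. -/
structure IsExpCurve (ρ : Representation ℂ 𝒢 𝔩) (z : 𝔩) (γ : ℂ → 𝒢) : Prop where
  map_zero : γ 0 = 1
  hasDerivAt : ∀ (x : 𝔩) (φ : Dual ℂ 𝔩) (t : ℂ),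
    HasDerivAt (fun t => φ (ρ (γ t) x)) (φ (ρ (γ t) ⁅z, x⁆)) t

variable {ξ : 𝔩} {ρ : Representation ℂ 𝒢 𝔩}

namespace IsGradedAction

variable (A : IsGradedAction ξ ρ)
include A

theorem exists_isExpCurve {z : 𝔩} (hz : ⁅ξ, z⁆ = 0) : ∃ γ, IsExpCurve ρ z γ := by
  obtain ⟨γ, h0, h⟩ := A.exists_exp z hz
  exact ⟨γ, h0, h⟩

theorem neg : IsGradedAction (-ξ) ρ where
  map_lie := A.map_lie
  map_grading g := by rw [map_neg, A.map_grading]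
  exists_exp z hz := A.exists_exp z (by rwa [neg_lie, neg_eq_zero] at hz)

theorem map_mem {g : 𝒢} {x : 𝔩} (hx : ρ g x = x) {k : ℂ} {y : 𝔩} (hy : y ∈ lieEigenspace x k) :
    ρ g y ∈ lieEigenspace x k := by
  rw [mem_lieEigenspace] at hy ⊢
  nth_rewrite 1 [← hx]
  rw [← A.map_lie, hy, map_smul]

theorem map_mem_grading (g : 𝒢) {k : ℂ} {y : 𝔩} (hy : y ∈ lieEigenspace ξ k) :
    ρ g y ∈ lieEigenspace ξ k :=
  A.map_mem (A.map_grading g) hy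

end IsGradedAction

theorem rep_inv_apply (g : 𝒢) (x : 𝔩) : ρ g⁻¹ (ρ g x) = x := by
  rw [← Module.End.mul_apply, ← map_mul, inv_mul_cancel, map_one, Module.End.one_apply]

theorem rep_apply_inv (g : 𝒢) (x : 𝔩) : ρ g (ρ g⁻¹ x) = x := by
  rw [← Module.End.mul_apply, ← map_mul, mul_inv_cancel, map_one, Module.End.one_apply]

theorem rep_mul_apply (g g' : 𝒢) (x : 𝔩) : ρ (g * g') x = ρ g (ρ g' x) := by
  rw [map_mul, Module.End.mul_apply]

theorem rep_injective (g : 𝒢) : Function.Injective (ρ g) :=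
  Function.LeftInverse.injective (rep_inv_apply g)

theorem eq_of_forall_dual {x y : 𝔩} (h : ∀ φ : Dual ℂ 𝔩, φ x = φ y) : x = y := by
  rw [← sub_eq_zero]
  refine (Module.forall_dual_apply_eq_zero_iff ℂ _).1 fun φ => ?_
  rw [map_sub, h, sub_self]

namespace IsExpCurve

variable {z : 𝔩} {γ : ℂ → 𝒢} (E : IsExpCurve ρ z γ)
include E

/-- The function exp(-sc) φ(ρ(γ s) x) of s has derivative zero for every linear form φ. -/
theorem apply_eigenvector {x : 𝔩} {c : ℂ} (hx : ⁅z, x⁆ = c • x) (t : ℂ) :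
    ρ (γ t) x = Complex.exp (t * c) • x := by
  refine eq_of_forall_dual fun φ => ?_
  have hconst : ∀ s : ℂ, HasDerivAt (fun s => Complex.exp (-(s * c)) * φ (ρ (γ s) x)) 0 s := by
    intro s
    have h1 : HasDerivAt (fun s : ℂ => Complex.exp (-(s * c)))
        (Complex.exp (-(s * c)) * (-(1 * c))) s :=
      (((hasDerivAt_id s).mul_const c).neg).cexp
    have h2 := h1.mul (E.hasDerivAt x φ s)
    rw [hx, map_smul, map_smul, smul_eq_mul] at h2
    refine h2.congr_deriv ?_
    ring
  have h := is_const_of_deriv_eq_zero (fun s => (hconst s).differentiableAt)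
    (fun s => (hconst s).deriv) t 0
  simp only [zero_mul, neg_zero, Complex.exp_zero, one_mul, E.map_zero, map_one,
    Module.End.one_apply] at h
  rw [map_smul, smul_eq_mul, ← h, ← mul_assoc, ← Complex.exp_add, add_neg_cancel,
    Complex.exp_zero, one_mul]

theorem apply_of_lie_eq_zero {x : 𝔩} (hx : ⁅z, x⁆ = 0) (t : ℂ) : ρ (γ t) x = x := by
  have := E.apply_eigenvector (c := 0) (by rw [hx, zero_smul]) t
  simpa using this

/-- This is the truncated series of exp(-t ad z). Applying ρ(γ t) to the right-hand side gives a
curve with zero derivative, so no group law for γ is needed. -/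
theorem inv_apply_of_nilpotent {x : 𝔩} (hx : ⁅z, ⁅z, ⁅z, x⁆⁆⁆ = 0) (t : ℂ) :
    ρ (γ t)⁻¹ x = x - t • ⁅z, x⁆ + (t ^ 2 / 2) • ⁅z, ⁅z, x⁆⁆ := by
  apply rep_injective (ρ := ρ) (γ t)
  rw [rep_apply_inv]
  refine eq_of_forall_dual fun φ => ?_
  have hconst : ∀ s : ℂ, HasDerivAt (fun s => φ (ρ (γ s) x) - s * φ (ρ (γ s) ⁅z, x⁆)
      + (s ^ 2 / 2) * φ (ρ (γ s) ⁅z, ⁅z, x⁆⁆)) 0 s := by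
    intro s
    have h0 := E.hasDerivAt x φ s
    have h1 := (hasDerivAt_id s).mul (E.hasDerivAt ⁅z, x⁆ φ s)
    have h2 := (((hasDerivAt_id s).pow 2).div_const 2).mul (E.hasDerivAt ⁅z, ⁅z, x⁆⁆ φ s)
    have h3 := (h0.sub h1).add h2
    rw [hx] at h3
    refine h3.congr_deriv ?_
    simp
  have h := is_const_of_deriv_eq_zero (fun s => (hconst s).differentiableAt)
    (fun s => (hconst s).deriv) t 0
  simp only [E.map_zero, map_one, Module.End.one_apply] at h
  simp only [map_add, map_sub, map_smul, smul_eq_mul]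
  rw [h]; ring

/-- A linear form that annihilates `N` vanishes along the curve, hence also on its derivative at 0.
-/
theorem lie_mem {N : Submodule ℂ 𝔩} {y : 𝔩} (hN : ∀ t, ρ (γ t) y ∈ N) : ⁅z, y⁆ ∈ N := by
  rw [← Subspace.forall_mem_dualAnnihilator_apply_eq_zero_iff]
  intro φ hφ
  have h := E.hasDerivAt y φ 0
  rw [Submodule.mem_dualAnnihilator] at hφ
  simp only [fun t => hφ _ (hN t), E.map_zero, map_one, Module.End.one_apply] at h
  exact h.unique (hasDerivAt_const _ _)

end IsExpCurve

end Action

section Rank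

variable {𝔩 : Type*} [LieRing 𝔩] [LieAlgebra ℂ 𝔩] {𝒢 : Type*} [Group 𝒢]
  {ξ : 𝔩} {ρ : Representation ℂ 𝒢 𝔩}

theorem IsGradedAction.finrank_range_ad_sq (A : IsGradedAction ξ ρ) (g : 𝒢) (y : 𝔩) :
    finrank ℂ (LinearMap.range ((ad ℂ 𝔩 (ρ g y)) ^ 2)) =
      finrank ℂ (LinearMap.range ((ad ℂ 𝔩 y) ^ 2)) := by
  have h : LinearMap.range ((ad ℂ 𝔩 (ρ g y)) ^ 2) =
      (LinearMap.range ((ad ℂ 𝔩 y) ^ 2)).map (ρ g) := by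
    ext x
    simp only [LinearMap.mem_range, Submodule.mem_map, pow_two, Module.End.mul_apply, ad_apply]
    constructor
    · rintro ⟨w, rfl⟩
      refine ⟨_, ⟨ρ g⁻¹ w, rfl⟩, ?_⟩
      rw [A.map_lie, A.map_lie, rep_apply_inv]
    · rintro ⟨_, ⟨w, rfl⟩, rfl⟩
      exact ⟨ρ g w, by rw [A.map_lie, A.map_lie]⟩
  rw [h, ← (Submodule.equivMapOfInjective _ (rep_injective g) _).finrank_eq]

end Rank

/-! ### Normal forms for elements of degree one -/

section Frame

variable {𝔩 : Type*} [LieRing 𝔩] [LieAlgebra ℂ 𝔩] [FiniteDimensional ℂ 𝔩]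
  [LieAlgebra.IsKilling ℂ 𝔩] {H : LieSubalgebra ℂ 𝔩} [H.IsCartanSubalgebra]
  {ξ : 𝔩} {d : H.root → ℤ} {r : ℕ} {α : Fin r → H.root} {e f : Fin r → 𝔩}
  {𝒢 : Type*} [Group 𝒢] {ρ : Representation ℂ 𝒢 𝔩}

variable (ρ α) in
/-- The stabilizer of the coroots with index in `S`. -/
def coStabilizer (S : Finset (Fin r)) : Subgroup 𝒢 where
  carrier := {g | ∀ i ∈ S, ρ g (corootElement H (α i)) = corootElement H (α i)}
  mul_mem' {a b} ha hb i hi := by rw [rep_mul_apply, hb i hi, ha i hi]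
  one_mem' i _ := by rw [map_one, Module.End.one_apply]
  inv_mem' {a} ha i hi := by
    nth_rewrite 1 [← ha i hi]
    rw [rep_inv_apply]

theorem coStabilizer_mono {S S' : Finset (Fin r)} (h : S ⊆ S') :
    coStabilizer α ρ S' ≤ coStabilizer α ρ S :=
  fun _ hg i hi => hg i (h hi)

variable (ξ α) in
/-- The elements of degree one on which the coroots with index in `S` act trivially. -/
def orthPart (S : Finset (Fin r)) : Submodule ℂ 𝔩 :=
  lieEigenspace ξ 1 ⊓ ⨅ i ∈ S, lieEigenspace (corootElement H (α i)) 0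

theorem mem_orthPart {S : Finset (Fin r)} {y : 𝔩} :
    y ∈ orthPart ξ α S ↔
      y ∈ lieEigenspace ξ 1 ∧ ∀ i ∈ S, y ∈ lieEigenspace (corootElement H (α i)) 0 := by
  simp [orthPart]

theorem IsExpCurve.mem_coStabilizer {z : 𝔩} {γ : ℂ → 𝒢} (E : IsExpCurve ρ z γ)
    {S : Finset (Fin r)} (hz : ∀ i ∈ S, ⁅corootElement H (α i), z⁆ = 0) (t : ℂ) :
    γ t ∈ coStabilizer α ρ S :=
  fun i hi => E.apply_of_lie_eq_zero (by rw [← lie_skew, hz i hi, neg_zero]) t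

theorem cartan_lie_cartan {x h : 𝔩} (hx : x ∈ H) (hh : h ∈ H) : ⁅x, h⁆ = 0 :=
  congrArg Subtype.val (LieModule.IsTrivial.trivial (⟨x, hx⟩ : H) (⟨h, hh⟩ : H))

namespace IsFrame

variable (F : IsFrame H ξ d α e f) (A : IsGradedAction ξ ρ)
include F A

theorem map_orthPart {S : Finset (Fin r)} {g : 𝒢} (hg : g ∈ coStabilizer α ρ S) {y : 𝔩}
    (hy : y ∈ orthPart ξ α S) : ρ g y ∈ orthPart ξ α S := by
  rw [mem_orthPart] at hy ⊢
  exact ⟨A.map_mem_grading g hy.1, fun i hi => A.map_mem (hg i hi) (hy.2 i hi)⟩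

/-- An element fixing ξ and α_i^∨ preserves the line of α_i^∨-weight 2 in 𝔩_1. -/
theorem exists_map_e {S : Finset (Fin r)} {g : 𝒢} (hg : g ∈ coStabilizer α ρ S) {i : Fin r}
    (hi : i ∈ S) : ∃ c : ℂ, c ≠ 0 ∧ ρ g (e i) = c • e i := by
  have h2 : e i ∈ lieEigenspace (corootElement H (α i)) 2 := by
    rw [mem_lieEigenspace, F.corootElement_lie_e, if_pos rfl]
  obtain ⟨c, hc⟩ := F.exists_eq_smul_e (A.map_mem_grading g (F.e_mem_one i))
    (A.map_mem (hg i hi) h2)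
  refine ⟨c, fun h => (F.triple i).e_ne_zero ?_, hc⟩
  apply rep_injective (ρ := ρ) g
  rw [hc, h, zero_smul, map_zero]

/-- The torus acts on the vectors `e_i` by arbitrary non-zero scalars. -/
theorem exists_scaling (c : Fin r → ℂ) (hc : ∀ i, c i ≠ 0) :
    ∃ g : 𝒢, (∀ h ∈ H, ρ g h = h) ∧ (∀ i, ρ g (e i) = c i • e i) ∧
      ∀ i, ρ g (f i) = (c i)⁻¹ • f i := by
  -- Only α_i^∨ acts non-trivially on e_i, by 2, so `z` acts on it by log c_i.
  set z : 𝔩 := ∑ i, (Complex.log (c i) / 2) • corootElement H (α i) with hz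
  have hzH : z ∈ H := sum_mem fun i _ => H.smul_mem _ (corootElement_mem _)
  obtain ⟨γ, E⟩ := A.exists_isExpCurve (F.grading_lie_cartan hzH)
  refine ⟨γ 1, fun h hh => E.apply_of_lie_eq_zero (cartan_lie_cartan hzH hh) 1, fun i => ?_,
    fun i => ?_⟩
  · have h1 : ⁅z, e i⁆ = Complex.log (c i) • e i := by
      rw [hz, sum_lie]
      simp_rw [smul_lie, F.corootElement_lie_e, smul_smul, ← Finset.sum_smul]
      congr 1
      rw [Finset.sum_eq_single_of_mem i (Finset.mem_univ i) fun j _ hj => by rw [if_neg hj, mul_zero],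
        if_pos rfl]
      ring
    rw [E.apply_eigenvector h1, one_mul, Complex.exp_log (hc i)]
  · have h1 : ⁅z, f i⁆ = (-Complex.log (c i)) • f i := by
      rw [hz, sum_lie]
      simp_rw [smul_lie, F.corootElement_lie_f, smul_smul, ← Finset.sum_smul]
      congr 1
      rw [Finset.sum_eq_single_of_mem i (Finset.mem_univ i) fun j _ hj => by rw [if_neg hj, mul_zero],
        if_pos rfl]
      ring
    rw [E.apply_eigenvector h1, one_mul, Complex.exp_neg, Complex.exp_log (hc i)]

/-- A subspace that is stable under `coStabilizer α ρ S` is stable under its Lie algebra. -/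
theorem lie_mem_of_stable {S : Finset (Fin r)} {N : Submodule ℂ 𝔩}
    (hN : ∀ g ∈ coStabilizer α ρ S, ∀ y ∈ N, ρ g y ∈ N) {z : 𝔩} (hz0 : ⁅ξ, z⁆ = 0)
    (hz : ∀ i ∈ S, ⁅corootElement H (α i), z⁆ = 0) {y : 𝔩} (hy : y ∈ N) : ⁅z, y⁆ ∈ N := by
  obtain ⟨γ, E⟩ := A.exists_isExpCurve hz0
  exact E.lie_mem fun t => hN _ (E.mem_coStabilizer hz t) _ hy

/-- For f' opposite to `v`, the element [w, f'] centralizes ξ and the coroots in `S`, and it sends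
`v` to a non-zero multiple of ⟨δ, β^∨⟩ w. So membership in `N` propagates between non-orthogonal
roots. -/
theorem rootSpace_le_of_linked {S : Finset (Fin r)} {N : Submodule ℂ 𝔩}
    (hN : ∀ g ∈ coStabilizer α ρ S, ∀ y ∈ N, ρ g y ∈ N) {β δ : H.root} (hβ : d β = 1)
    (hδ : d δ = 1) (hβS : ∀ i ∈ S, (rootSystem H).pairingIn ℤ β (α i) = 0)
    (hδS : ∀ i ∈ S, (rootSystem H).pairingIn ℤ δ (α i) = 0)
    (hδβ : (rootSystem H).pairingIn ℤ δ β ≠ 0) {v : 𝔩} (hv : v ∈ rootSpace H β.1) (hv0 : v ≠ 0)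
    (hvN : v ∈ N) {w : 𝔩} (hw : w ∈ rootSpace H δ.1) : w ∈ N := by
  obtain ⟨h, e', f', ht, he', hf'⟩ :=
    exists_isSl2Triple_of_weight_isNonZero (LieSubalgebra.isNonZero_coe_root β)
  have hh : h = corootElement H β :=
    ht.h_eq_coroot (LieSubalgebra.isNonZero_coe_root β) he' hf'
  obtain ⟨c, rfl⟩ := exists_eq_smul_of_mem_rootSpace hv hv0 he'
  have hfr : f' ∈ rootSpace H ((rootSystem H).reflectionPerm β β).1 := by
    rw [coe_reflectionPerm_self]; exact hf'
  have hf1 := F.lie_grading hfr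
  rw [F.isShortDegree.degree_neg, hβ] at hf1
  have hv1 := F.lie_grading hv
  have hw1 := F.lie_grading hw
  rw [hβ] at hv1
  rw [hδ] at hw1
  have hz0 : ⁅w, f'⁆ ∈ lieEigenspace ξ 0 := lie_mem_lieEigenspace hw1 hf1 (by push_cast; ring)
  have hmem := F.lie_mem_of_stable A hN (z := ⁅w, f'⁆) (by simpa [mem_lieEigenspace] using hz0)
    (fun i hi => by
      rw [leibniz_lie, corootElement_lie hw, corootElement_lie hfr, hδS i hi,
        RootPairing.pairingIn_reflectionPerm_self_left, hβS i hi]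
      simp) (N.smul_mem c hvN)
  have hwv : ⁅w, c • v⁆ = 0 := by
    rw [lie_smul, F.lie_eq_zero_of_one (by simpa using hw1) (by simpa using hv1), smul_zero]
  rw [lie_lie, hwv, lie_zero, sub_zero, ← lie_skew f' (c • v), ht.lie_e_f, lie_neg, lie_skew, hh,
    corootElement_lie hw] at hmem
  have h0 : ((rootSystem H).pairingIn ℤ δ β : ℂ) ≠ 0 := by exact_mod_cast hδβ
  simpa [smul_smul, inv_mul_cancel₀ h0] using
    N.smul_mem ((rootSystem H).pairingIn ℤ δ β : ℂ)⁻¹ hmem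

theorem stable_cartan {S : Finset (Fin r)} {N : Submodule ℂ 𝔩}
    (hN : ∀ g ∈ coStabilizer α ρ S, ∀ y ∈ N, ρ g y ∈ N) : ∀ h ∈ H, ∀ y ∈ N, ⁅h, y⁆ ∈ N :=
  fun _ hh _ hy => F.lie_mem_of_stable A hN (F.grading_lie_cartan hh)
    (fun _ _ => cartan_lie_cartan (corootElement_mem _) hh) hy

theorem pairingIn_eq_zero_of_mem {S : Finset (Fin r)} {β : H.root} {v : 𝔩}
    (hv : v ∈ rootSpace H β.1) (hv0 : v ≠ 0) (hvS : v ∈ orthPart ξ α S) :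
    ∀ i ∈ S, (rootSystem H).pairingIn ℤ β (α i) = 0 := by
  intro i hi
  by_contra hne
  exact hv0 (eq_zero_of_mem_lieEigenspace ((mem_orthPart.1 hvS).2 i hi) (corootElement_lie hv _)
    (by exact_mod_cast Ne.symm hne))

/-- From a root vector in `N` one passes to a linked long root δ still orthogonal to `S`. By
maximality δ is linked to some α_j, and j ∉ S since δ is orthogonal to `S`. -/
theorem exists_e_mem [(rootSystem H).IsIrreducible] {S : Finset (Fin r)} {N : Submodule ℂ 𝔩}
    (hN : ∀ g ∈ coStabilizer α ρ S, ∀ y ∈ N, ρ g y ∈ N) (hNS : N ≤ orthPart ξ α S)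
    {y : 𝔩} (hy : y ∈ N) (hy0 : y ≠ 0) : ∃ j ∉ S, e j ∈ N := by
  by_contra hcon
  apply hy0
  refine F.induction_one N (F.stable_cartan A hN) (hNS.trans inf_le_left) (p := fun y => y = 0) rfl
    (fun x y hx hy => by rw [hx, hy, add_zero]) ?_ hy
  intro β hβ v hvN hv
  by_contra hv0
  have hβS := F.pairingIn_eq_zero_of_mem A hv hv0 (hNS hvN)
  obtain ⟨δ, hδlong, hδ, hδβ, hδS⟩ := F.isShortDegree.exists_isLongRoot hβ
  have hδS' : ∀ i ∈ S, (rootSystem H).pairingIn ℤ δ (α i) = 0 :=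
    fun i hi => hδS _ (F.degree_one i) (hβS i hi)
  obtain ⟨w, hw, hw0⟩ := δ.1.exists_ne_zero
  have hwN := F.rootSpace_le_of_linked A hN hβ hδ hβS hδS' hδβ hv hv0 hvN hw
  obtain ⟨j, hj⟩ := F.maximal δ hδ hδlong
  have hjS : j ∉ S := fun h => hj ((rootSystem H).pairingIn_eq_zero_comm.1 (hδS' j h))
  refine hcon ⟨j, hjS, F.rootSpace_le_of_linked A hN hδ (F.degree_one j) hδS' ?_ hj hw hw0 hwN
    (F.e_mem j)⟩
  intro i hi
  exact F.orthogonal j i fun h => hjS (h ▸ hi)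

/-- Completing the square: y₂ = c e_j, and z = c⁻¹ [f_j, y₁] lowers the α_j^∨-weight by 1 and sends
c e_j to -y₁. Hence exp(ad z) maps y to c e_j + y₀ + ½ [z, y₁], without a component of weight 1. -/
theorem exists_map_eq_smul_add {S : Finset (Fin r)} {y y₀ y₁ y₂ : 𝔩} {j : Fin r}
    (hy : y = y₀ + y₁ + y₂) (h0 : y₀ ∈ orthPart ξ α S) (h1 : y₁ ∈ orthPart ξ α S)
    (h2 : y₂ ∈ orthPart ξ α S) (hj : j ∉ S)
    (h0j : y₀ ∈ lieEigenspace (corootElement H (α j)) 0)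
    (h1j : y₁ ∈ lieEigenspace (corootElement H (α j)) 1)
    (h2j : y₂ ∈ lieEigenspace (corootElement H (α j)) 2) (h2ne : y₂ ≠ 0) :
    ∃ g ∈ coStabilizer α ρ S, ∃ c : ℂ, c ≠ 0 ∧ ∃ y' ∈ orthPart ξ α (insert j S),
      ρ g y = c • e j + y' := by
  obtain ⟨c, rfl⟩ := F.exists_eq_smul_e (mem_orthPart.1 h2).1 h2j
  have hc : c ≠ 0 := fun h => h2ne (by rw [h, zero_smul])
  have hfj : f j ∈ lieEigenspace (corootElement H (α j)) (-2) := by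
    rw [mem_lieEigenspace, F.corootElement_lie_f, if_pos rfl]
  set z : 𝔩 := c⁻¹ • ⁅f j, y₁⁆ with hz
  have hz0 : z ∈ lieEigenspace ξ 0 := Submodule.smul_mem _ _
    (lie_mem_lieEigenspace (F.f_mem_neg_one j) (mem_orthPart.1 h1).1 (by ring))
  have hzj : z ∈ lieEigenspace (corootElement H (α j)) (-1) := Submodule.smul_mem _ _
    (lie_mem_lieEigenspace hfj h1j (by ring))
  have hzS : ∀ i ∈ S, z ∈ lieEigenspace (corootElement H (α i)) 0 := by
    intro i hi
    refine Submodule.smul_mem _ _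
      (lie_mem_lieEigenspace (a := 0) (b := 0) ?_ ((mem_orthPart.1 h1).2 i hi) (by ring))
    rw [mem_lieEigenspace, F.corootElement_lie_f, if_neg (by rintro rfl; exact hj hi)]
  have hze : ⁅z, c • e j⁆ = -y₁ := by
    rw [hz, smul_lie, lie_smul, smul_smul, inv_mul_cancel₀ hc, one_smul, lie_lie,
      F.lie_eq_zero_of_one (mem_orthPart.1 h1).1 (F.e_mem_one j), lie_zero, zero_sub,
      ← lie_skew (f j) (e j), (F.triple j).lie_e_f, lie_neg, lie_skew, neg_inj]
    simpa [mem_lieEigenspace] using h1j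
  have hneg : ∀ w ∈ lieEigenspace ξ 1, w ∈ lieEigenspace (corootElement H (α j)) 0 →
      ⁅z, w⁆ = 0 := by
    intro w hw hwj
    refine F.eq_zero_of_weight {j} (k := -1) (by norm_num) (by norm_num) (by norm_num)
      (lie_mem_lieEigenspace hz0 hw (by ring)) ?_
    rw [corootSum_singleton]
    exact lie_mem_lieEigenspace hzj hwj (by ring)
  have hz1 : ⁅z, y₁⁆ ∈ lieEigenspace ξ 1 :=
    lie_mem_lieEigenspace hz0 (mem_orthPart.1 h1).1 (by ring)
  have hz1j : ⁅z, y₁⁆ ∈ lieEigenspace (corootElement H (α j)) 0 :=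
    lie_mem_lieEigenspace hzj h1j (by ring)
  have hzy : ⁅z, y⁆ = -y₁ + ⁅z, y₁⁆ := by
    rw [hy, lie_add, lie_add, hze, hneg _ (mem_orthPart.1 h0).1 h0j, zero_add, add_comm]
  have hzzy : ⁅z, ⁅z, y⁆⁆ = -⁅z, y₁⁆ := by
    rw [hzy, lie_add, hneg _ hz1 hz1j, lie_neg, add_zero]
  have hzzzy : ⁅z, ⁅z, ⁅z, y⁆⁆⁆ = 0 := by
    rw [hzzy, lie_neg, hneg _ hz1 hz1j, neg_zero]
  obtain ⟨γ, E⟩ := A.exists_isExpCurve (z := z) (by simpa [mem_lieEigenspace] using hz0)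
  -- The inverse at parameter -1 acts on y as exp(ad z), in the form given by
  -- `inv_apply_of_nilpotent`.
  refine ⟨(γ (-1))⁻¹, inv_mem (E.mem_coStabilizer (fun i hi => by
    simpa [mem_lieEigenspace] using hzS i hi) _), c, hc, y₀ + (2⁻¹ : ℂ) • ⁅z, y₁⁆, ?_, ?_⟩
  · rw [mem_orthPart]
    refine ⟨Submodule.add_mem _ (mem_orthPart.1 h0).1 (Submodule.smul_mem _ _ hz1), fun i hi => ?_⟩
    rw [Finset.mem_insert] at hi
    rcases hi with rfl | hi
    · exact Submodule.add_mem _ h0j (Submodule.smul_mem _ _ hz1j)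
    · exact Submodule.add_mem _ ((mem_orthPart.1 h0).2 i hi) (Submodule.smul_mem _ _
        (lie_mem_lieEigenspace (hzS i hi) ((mem_orthPart.1 h1).2 i hi) (by ring)))
  · rw [E.inv_apply_of_nilpotent hzzzy, hzzy, hzy, hy]
    module

/-- If no conjugate of y had a component of α_j^∨-weight 2, the span of the orbit would lie in
weights 0 and 1, yet it contains e_j. -/
theorem exists_map_eq_smul_add_of_mem_span {S : Finset (Fin r)} {y : 𝔩} (hy : y ∈ orthPart ξ α S)
    {j : Fin r} (hj : j ∉ S)
    (hjy : e j ∈ Submodule.span ℂ {x | ∃ g ∈ coStabilizer α ρ S, x = ρ g y}) :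
    ∃ g ∈ coStabilizer α ρ S, ∃ c : ℂ, c ≠ 0 ∧ ∃ y' ∈ orthPart ξ α (insert j S),
      ρ g y = c • e j + y' := by
  have hstab : ∀ h ∈ H, ∀ y ∈ orthPart ξ α S, ⁅h, y⁆ ∈ orthPart ξ α S :=
    F.stable_cartan A fun g hg y hy => F.map_orthPart A hg hy
  by_contra hcon
  have hall : ∀ g ∈ coStabilizer α ρ S, ρ g y ∈
      lieEigenspace (corootElement H (α j)) 0 ⊔ lieEigenspace (corootElement H (α j)) 1 := by
    intro g hg
    obtain ⟨y₀, h0, y₁, h1, y₂, h2, hy', h0j, h1j, h2j⟩ := F.exists_weight_decomposition {j} _ hstab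
      inf_le_left (F.map_orthPart A hg hy)
    rw [corootSum_singleton] at h0j h1j h2j
    by_cases h2ne : y₂ = 0
    · rw [hy', h2ne, add_zero]
      exact Submodule.add_mem_sup h0j h1j
    · obtain ⟨g', hg', c, hc, y', hy'', hg⟩ :=
        F.exists_map_eq_smul_add A hy' h0 h1 h2 hj h0j h1j h2j h2ne
      exact (hcon ⟨g' * g, mul_mem hg' ‹_›, c, hc, y', hy'', by rw [rep_mul_apply, hg]⟩).elim
  have hle : Submodule.span ℂ {x | ∃ g ∈ coStabilizer α ρ S, x = ρ g y} ≤
      lieEigenspace (corootElement H (α j)) 0 ⊔ lieEigenspace (corootElement H (α j)) 1 := by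
    rw [Submodule.span_le]
    rintro _ ⟨g, hg, rfl⟩
    exact hall g hg
  obtain ⟨a, ha, b, hb, hab⟩ := Submodule.mem_sup.1 (hle hjy)
  rw [mem_lieEigenspace] at ha hb
  have h1 : ⁅corootElement H (α j), e j⁆ = (2 : ℂ) • e j := by
    rw [F.corootElement_lie_e, if_pos rfl]
  have h2 : ⁅corootElement H (α j), e j⁆ = b := by
    rw [← hab, lie_add, ha, hb, zero_smul, one_smul, zero_add]
  -- On weights 0 and 1 the operator ad α_j^∨ is idempotent, whereas on e_j it is multiplication by
  -- 2.
  have h3 : ⁅corootElement H (α j), ⁅corootElement H (α j), e j⁆⁆ =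
      ⁅corootElement H (α j), e j⁆ := by
    rw [h2, hb, one_smul]
  rw [h1, lie_smul, h1, smul_smul] at h3
  have h4 : (2 : ℂ) • e j = 0 := by
    have : (2 * 2 - 2 : ℂ) • e j = 0 := by rw [sub_smul, h3, sub_self]
    norm_num at this
    simp [this]
  exact (F.triple j).e_ne_zero ((smul_eq_zero.1 h4).resolve_left (by norm_num))

theorem span_stable {S : Finset (Fin r)} (y : 𝔩) : ∀ g ∈ coStabilizer α ρ S,
    ∀ x ∈ Submodule.span ℂ {x | ∃ g ∈ coStabilizer α ρ S, x = ρ g y},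
      ρ g x ∈ Submodule.span ℂ {x | ∃ g ∈ coStabilizer α ρ S, x = ρ g y} := by
  intro g hg x hx
  induction hx using Submodule.span_induction with
  | mem x hx =>
    obtain ⟨g', hg', rfl⟩ := hx
    exact Submodule.subset_span ⟨g * g', mul_mem hg hg', by rw [rep_mul_apply]⟩
  | zero => rw [map_zero]; exact Submodule.zero_mem _
  | add x y _ _ hx hy => rw [map_add]; exact Submodule.add_mem _ hx hy
  | smul c x _ hx => rw [map_smul]; exact Submodule.smul_mem _ _ hx

theorem map_vecSum_of_disjoint {T : Finset (Fin r)} {j : Fin r} (hj : j ∉ T) {c : ℂ} (hc : c ≠ 0) :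
    ∃ g : 𝒢, (∀ h ∈ H, ρ g h = h) ∧ ρ g (c • e j + vecSum e T) = vecSum e (insert j T) := by
  obtain ⟨g, hg, hge, -⟩ := F.exists_scaling A (fun i => if i = j then c⁻¹ else 1) (fun i => by
    split_ifs <;> simp [hc])
  refine ⟨g, hg, ?_⟩
  rw [map_add, map_smul, hge, if_pos rfl, smul_smul, mul_inv_cancel₀ hc, one_smul, vecSum, vecSum,
    Finset.sum_insert hj, map_sum]
  congr 1
  refine Finset.sum_congr rfl fun i hi => ?_
  rw [hge, if_neg (by rintro rfl; exact hj hi), one_smul]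

/-- Every element of degree one is conjugate to a sum of vectors `e_i`; the conjugation can be
chosen in the stabilizer of the coroots that act trivially. -/
theorem exists_map_eq_vecSum [(rootSystem H).IsIrreducible] (S : Finset (Fin r)) {y : 𝔩}
    (hy : y ∈ orthPart ξ α S) :
    ∃ g ∈ coStabilizer α ρ S, ∃ T, Disjoint T S ∧ ρ g y = vecSum e T := by
  induction hn : Sᶜ.card using Nat.strong_induction_on generalizing S y with
  | h n ih =>
  by_cases hy0 : y = 0
  · exact ⟨1, one_mem _, ∅, Finset.disjoint_empty_left _, by simp [hy0, vecSum]⟩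
  set N := Submodule.span ℂ {x | ∃ g ∈ coStabilizer α ρ S, x = ρ g y} with hNdef
  have hN := F.span_stable A (S := S) y
  have hNS : N ≤ orthPart ξ α S := by
    rw [hNdef, Submodule.span_le]
    rintro _ ⟨g, hg, rfl⟩
    exact F.map_orthPart A hg hy
  have hyN : y ∈ N := Submodule.subset_span ⟨1, one_mem _, by simp⟩
  obtain ⟨j, hj, hjN⟩ := F.exists_e_mem A hN hNS hyN hy0
  obtain ⟨g, hg, c, hc, y', hy', hgy⟩ := F.exists_map_eq_smul_add_of_mem_span A hy hj hjN
  have hcard : (insert j S)ᶜ.card < n := by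
    rw [← hn]
    apply Finset.card_lt_card
    rw [Finset.compl_ssubset_compl]
    exact Finset.ssubset_insert hj
  obtain ⟨g', hg', T, hT, hgT⟩ := ih _ hcard (insert j S) hy' rfl
  -- The element reducing y' fixes the coroot of α_j, so it only rescales e_j; the torus corrects
  -- the scalar.
  obtain ⟨c', hc', hge⟩ := F.exists_map_e A hg' (Finset.mem_insert_self j S)
  rw [Finset.disjoint_insert_right] at hT
  obtain ⟨g'', hg'', hgs⟩ := F.map_vecSum_of_disjoint A hT.1 (mul_ne_zero hc hc')
  refine ⟨g'' * (g' * g), mul_mem (fun i _ => hg'' _ (corootElement_mem _))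
    (mul_mem (coStabilizer_mono (Finset.subset_insert _ _) hg') hg), insert j T, ?_, ?_⟩
  · rw [Finset.disjoint_insert_left]
    exact ⟨hj, hT.2⟩
  · rw [rep_mul_apply, rep_mul_apply, hgy, map_add, map_smul, hge, hgT, smul_smul, hgs]

/-- The pairings with i, j, k are non-negative with sum at most 2, and the first two already use it
up. -/
theorem orthogonal_of_linked {S : Finset (Fin r)} {i j : Fin r} (hi : i ∉ S) (hj : j ∉ S)
    (hij : i ≠ j) {δ : H.root} (hδ : d δ = 1)
    (hδi : (rootSystem H).pairingIn ℤ δ (α i) ≠ 0)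
    (hδj : (rootSystem H).pairingIn ℤ δ (α j) ≠ 0) :
    ∀ k ∈ S, (rootSystem H).pairingIn ℤ δ (α k) = 0 := by
  intro k hk
  have hki : k ≠ i := fun h => hi (h ▸ hk)
  have hkj : k ≠ j := fun h => hj (h ▸ hk)
  have h := F.isShortDegree.sum_pairingIn_le_two F.degree_one {i, j, k}
    (fun a _ b _ hab => F.orthogonal a b hab) hδ
  rw [Finset.sum_insert (by simp [hij, hki.symm]), Finset.sum_insert (by simp [hkj.symm]),
    Finset.sum_singleton] at h
  have := F.isShortDegree.pairingIn_nonneg (F.degree_one i) hδ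
  have := F.isShortDegree.pairingIn_nonneg (F.degree_one j) hδ
  have := F.isShortDegree.pairingIn_nonneg (F.degree_one k) hδ
  omega

/-- In a sum of vectors `e_i` an index can be replaced by another one, up to conjugation. -/
theorem exists_map_vecSum_insert [(rootSystem H).IsIrreducible] {S : Finset (Fin r)} {i j : Fin r}
    (hi : i ∉ S) (hj : j ∉ S) (hij : i ≠ j) :
    ∃ g, ρ g (vecSum e (insert i S)) = vecSum e (insert j S) := by
  have hiS : e i ∈ orthPart ξ α S := by
    rw [mem_orthPart]
    refine ⟨F.e_mem_one i, fun k hk => ?_⟩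
    rw [mem_lieEigenspace, F.corootElement_lie_e, if_neg (by rintro rfl; exact hi hk)]
  obtain ⟨δ, hδ, hδi, hδj⟩ := F.isShortDegree.exists_degree_one (b := α j) (F.degree_one i)
  have hδS := F.orthogonal_of_linked A hi hj hij hδ hδi hδj
  obtain ⟨w, hw, hw0⟩ := δ.1.exists_ne_zero
  have hN := F.span_stable A (S := S) (e i)
  have hwN := F.rootSpace_le_of_linked A hN (F.degree_one i) hδ
    (fun k hk => F.orthogonal i k fun h => hi (h ▸ hk)) hδS hδi (F.e_mem i)
    (F.triple i).e_ne_zero (Submodule.subset_span ⟨1, one_mem _, by simp⟩) hw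
  have hjN := F.rootSpace_le_of_linked A hN hδ (F.degree_one j) hδS
    (fun k hk => F.orthogonal j k fun h => hj (h ▸ hk))
    (fun h => hδj ((rootSystem H).pairingIn_eq_zero_comm.1 h)) hw hw0 hwN (F.e_mem j)
  obtain ⟨g, hg, c, hc, y', hy', hgy⟩ := F.exists_map_eq_smul_add_of_mem_span A hiS hj hjN
  obtain ⟨g', hg', T, hT, hgT⟩ := F.exists_map_eq_vecSum A (insert j S) hy'
  obtain ⟨c', hc', hge⟩ := F.exists_map_e A hg' (Finset.mem_insert_self j S)
  rw [Finset.disjoint_insert_right] at hT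
  obtain ⟨g'', hg'', hgs⟩ := F.map_vecSum_of_disjoint A hT.1 (mul_ne_zero hc hc')
  have hall : ρ (g'' * (g' * g)) (e i) = vecSum e (insert j T) := by
    rw [rep_mul_apply, rep_mul_apply, hgy, map_add, map_smul, hge, hgT, smul_smul, hgs]
  -- The rank of (ad x)² is at most 1 at e_i, and each enlargement of an index set raises it by at
  -- least 1, so e_i is conjugate to e_j alone.
  have hTe : T = ∅ := by
    by_contra hne
    have h1 := A.finrank_range_ad_sq (g'' * (g' * g)) (e i)
    rw [hall] at h1
    have h2 := F.adSqRank_singleton i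
    have h3 := F.adSqRank_lt (S := {j}) (T := insert j T) (by
      rw [Finset.ssubset_iff_subset_ne]
      refine ⟨by simp, fun h => hne ?_⟩
      rw [Finset.eq_empty_iff_forall_notMem]
      intro x hx
      have : x ∈ ({j} : Finset (Fin r)) := h ▸ Finset.mem_insert_of_mem hx
      exact hT.1 (Finset.mem_singleton.1 this ▸ hx))
    have h4 := F.adSqRank_lt (S := ∅) (T := {j}) (Finset.empty_ssubset.2 (Finset.singleton_nonempty j))
    simp only [adSqRank] at h2 h3 h4
    have h5 : vecSum e {i} = e i := by simp [vecSum]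
    rw [h5] at h2
    omega
  rw [hTe] at hall
  have hG : g'' * (g' * g) ∈ coStabilizer α ρ S :=
    mul_mem (fun i _ => hg'' _ (corootElement_mem _))
      (mul_mem (coStabilizer_mono (Finset.subset_insert _ _) hg') hg)
  -- The element moving e_i to e_j may rescale the e_k with k ∈ S; a torus element `s` fixing e_j
  -- undoes this.
  have hex : ∀ k, ∃ c : ℂ, c ≠ 0 ∧ (k ∈ S → ρ (g'' * (g' * g)) (e k) = c • e k) := by
    intro k
    by_cases hk : k ∈ S
    · obtain ⟨c, hc, h⟩ := F.exists_map_e A hG hk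
      exact ⟨c, hc, fun _ => h⟩
    · exact ⟨1, one_ne_zero, fun h => (hk h).elim⟩
  choose b hb hbe using hex
  obtain ⟨s, -, hs, -⟩ := F.exists_scaling A (fun k => if k = j then 1 else (b k)⁻¹) (fun k => by
    split_ifs <;> simp [hb])
  refine ⟨s * (g'' * (g' * g)), ?_⟩
  rw [rep_mul_apply, vecSum, Finset.sum_insert hi, map_add, hall, map_sum]
  simp only [vecSum, insert_empty_eq, Finset.sum_singleton]
  rw [map_add, hs, if_pos rfl, one_smul, Finset.sum_insert hj, map_sum]
  congr 1
  refine Finset.sum_congr rfl fun k hk => ?_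
  rw [hbe k hk, map_smul, hs, if_neg (by rintro rfl; exact hj hk), smul_smul, mul_inv_cancel₀ (hb k),
    one_smul]

/-- Each exchange of an index of `S` outside `T` for one of `T` outside `S` brings the sets closer.
-/
theorem exists_map_vecSum_eq [(rootSystem H).IsIrreducible] {S T : Finset (Fin r)}
    (h : S.card = T.card) : ∃ g, ρ g (vecSum e S) = vecSum e T := by
  induction hn : (S \ T).card generalizing S with
  | zero =>
    have hST : S ⊆ T := by rwa [Finset.card_eq_zero, Finset.sdiff_eq_empty_iff_subset] at hn
    rw [Finset.eq_of_subset_of_card_le hST h.ge]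
    exact ⟨1, by simp⟩
  | succ n ih =>
    obtain ⟨i, hi⟩ : (S \ T).Nonempty := by rw [← Finset.card_pos]; omega
    obtain ⟨j, hj⟩ : (T \ S).Nonempty := by
      rw [← Finset.card_pos, ← Finset.card_sdiff_comm h]; omega
    rw [Finset.mem_sdiff] at hi hj
    have hij : i ≠ j := fun hh => hj.2 (hh ▸ hi.1)
    have hiS : i ∉ S.erase i := Finset.notMem_erase i S
    have hjS : j ∉ S.erase i := fun hh => hj.2 (Finset.mem_of_mem_erase hh)
    obtain ⟨g, hg⟩ := F.exists_map_vecSum_insert A hiS hjS hij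
    rw [Finset.insert_erase hi.1] at hg
    obtain ⟨g', hg'⟩ := ih (S := insert j (S.erase i)) (by
      rw [Finset.card_insert_of_notMem hjS, Finset.card_erase_of_mem hi.1, ← h]
      have := Finset.card_pos.2 ⟨i, hi.1⟩
      omega) (by
      rw [Finset.insert_sdiff_of_mem _ hj.1, Finset.erase_sdiff_comm,
        Finset.card_erase_of_mem (Finset.mem_sdiff.2 hi), hn]
      omega)
    exact ⟨g' * g, by rw [rep_mul_apply, hg, hg']⟩

end IsFrame

end Frame

end ShortGrading

end

/-! ### Zariski closures and tangent vectors -/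

noncomputable section

namespace ShortGrading

section ZariskiLemmas

variable {V W : Type*} [AddCommGroup V] [Module ℂ V] [AddCommGroup W] [Module ℂ W]

theorem vanishing_zariskiClosure (S : Set V) : vanishing (zariskiClosure S) = vanishing S :=
  Set.Subset.antisymm (fun _ hp s hs => hp s (subset_zariskiClosure S hs)) fun _ hp _ hv => hv _ hp

theorem zariskiClosure_subset_of_subset {S T : Set V} (h : S ⊆ zariskiClosure T) :
    zariskiClosure S ⊆ zariskiClosure T := by
  intro v hv p hp
  rw [← vanishing_zariskiClosure] at hp
  exact hv p fun s hs => hp s (h hs)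

/-- The composition of a polynomial function with a linear map. -/
def polyComp (f : V →ₗ[ℂ] W) (p : MvPolynomial (Dual ℂ W) ℂ) : MvPolynomial (Dual ℂ V) ℂ :=
  MvPolynomial.rename (fun φ : Dual ℂ W => φ ∘ₗ f) p

theorem polyEval_polyComp (f : V →ₗ[ℂ] W) (p : MvPolynomial (Dual ℂ W) ℂ) (v : V) :
    polyEval (polyComp f p) v = polyEval p (f v) := by
  simp only [polyEval, polyComp, MvPolynomial.eval_rename]
  rfl

theorem map_mem_zariskiClosure (f : V →ₗ[ℂ] W) {S : Set V} {T : Set W} (h : ∀ s ∈ S, f s ∈ T)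
    {v : V} (hv : v ∈ zariskiClosure S) : f v ∈ zariskiClosure T := by
  intro p hp
  rw [← polyEval_polyComp]
  exact hv _ fun s hs => by rw [polyEval_polyComp]; exact hp _ (h s hs)

/-! ### Polynomial functions -/

/-- A function that is given by a polynomial in the linear forms. -/
def IsPolyFun (q : V → ℂ) : Prop := ∃ p : MvPolynomial (Dual ℂ V) ℂ, ∀ v, polyEval p v = q v

namespace IsPolyFun

theorem const (c : ℂ) : IsPolyFun fun _ : V => c :=
  ⟨MvPolynomial.C c, fun v => by simp [polyEval]⟩

theorem linear (φ : Dual ℂ V) : IsPolyFun fun v => φ v :=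
  ⟨MvPolynomial.X φ, fun v => by simp [polyEval]⟩

theorem mul {q q' : V → ℂ} (h : IsPolyFun q) (h' : IsPolyFun q') :
    IsPolyFun fun v => q v * q' v := by
  obtain ⟨p, hp⟩ := h
  obtain ⟨p', hp'⟩ := h'
  exact ⟨p * p', fun v => by simp [← hp, ← hp', polyEval]⟩

theorem sum {κ : Type*} (s : Finset κ) {q : κ → V → ℂ} (h : ∀ i, IsPolyFun (q i)) :
    IsPolyFun fun v => ∑ i ∈ s, q i v := by
  choose p hp using h
  exact ⟨∑ i ∈ s, p i, fun v => by simp [← hp, polyEval]⟩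

theorem prod {κ : Type*} (s : Finset κ) {q : κ → V → ℂ} (h : ∀ i, IsPolyFun (q i)) :
    IsPolyFun fun v => ∏ i ∈ s, q i v := by
  choose p hp using h
  exact ⟨∏ i ∈ s, p i, fun v => by simp [← hp, polyEval]⟩

theorem det {κ : Type*} [Fintype κ] [DecidableEq κ] {q : κ → κ → V → ℂ}
    (h : ∀ i j, IsPolyFun (q i j)) :
    IsPolyFun fun v => (Matrix.of fun i j => q i j v).det := by
  simp only [Matrix.det_apply']
  exact sum _ fun σ => (const _).mul (prod _ fun i => h _ _)

theorem bilin [FiniteDimensional ℂ V] (B : V →ₗ[ℂ] V →ₗ[ℂ] ℂ) : IsPolyFun fun v => B v v := by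
  let b := Module.finBasis ℂ V
  have h : ∀ v, B v v = ∑ i, ∑ j, b.coord i v * (b.coord j v * B (b i) (b j)) := by
    intro v
    have hv := b.sum_repr v
    calc B v v = B (∑ i, b.repr v i • b i) (∑ j, b.repr v j • b j) := by rw [hv]
      _ = _ := by
        simp only [map_sum, LinearMap.sum_apply, map_smul, LinearMap.smul_apply, smul_eq_mul,
          Finset.mul_sum, Basis.coord_apply]
        rw [Finset.sum_comm]
        exact Finset.sum_congr rfl fun i _ => Finset.sum_congr rfl fun j _ => by ring
  rw [funext h]
  exact sum _ fun i => sum _ fun j => (linear _).mul ((linear _).mul (const _))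

theorem eq_zero_of_mem_zariskiClosure {q : V → ℂ} (h : IsPolyFun q) {S : Set V}
    (hS : ∀ s ∈ S, q s = 0) {v : V} (hv : v ∈ zariskiClosure S) : q v = 0 := by
  obtain ⟨p, hp⟩ := h
  rw [← hp]
  exact hv p fun s hs => by rw [hp]; exact hS s hs

end IsPolyFun

/-! ### Differentials and tangent spaces -/

theorem differential_C (c : ℂ) (y v : V) : differential (MvPolynomial.C c) y v = 0 := by
  simp [differential, polyEval]

theorem differential_X (φ : Dual ℂ V) (y v : V) :
    differential (MvPolynomial.X φ) y v = φ v := by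
  simp [differential, polyEval, MvPolynomial.mkDerivation_X]

theorem differential_add (p q : MvPolynomial (Dual ℂ V) ℂ) (y v : V) :
    differential (p + q) y v = differential p y v + differential q y v := by
  simp [differential, polyEval]

theorem differential_mul (p q : MvPolynomial (Dual ℂ V) ℂ) (y v : V) :
    differential (p * q) y v = polyEval p y * differential q y v +
      polyEval q y * differential p y v := by
  simp [differential, polyEval, Derivation.leibniz]

theorem hasDerivAt_polyEval (p : MvPolynomial (Dual ℂ V) ℂ) {c : ℂ → V} {v : V} {t : ℂ}
    (hc : ∀ φ : Dual ℂ V, HasDerivAt (fun s => φ (c s)) (φ v) t) :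
    HasDerivAt (fun s => polyEval p (c s)) (differential p (c t) v) t := by
  induction p using MvPolynomial.induction_on with
  | C a =>
    rw [differential_C]
    simpa [polyEval] using hasDerivAt_const t a
  | add p q hp hq =>
    rw [differential_add]
    refine (hp.add hq).congr_of_eventuallyEq (Filter.Eventually.of_forall fun s => ?_)
    simp [polyEval]
  | mul_X p φ hp =>
    rw [differential_mul, differential_X]
    have hφ : ∀ u : V, polyEval (MvPolynomial.X φ) u = φ u := fun u => by simp [polyEval]
    rw [hφ]
    refine ((hp.mul (hc φ)).congr_of_eventuallyEq
      (Filter.Eventually.of_forall fun s => ?_)).congr_deriv ?_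
    · simp [polyEval]
    · ring

theorem hasDerivAt_polyEval_line (p : MvPolynomial (Dual ℂ V) ℂ) (y v : V) (t : ℂ) :
    HasDerivAt (fun s : ℂ => polyEval p (y + s • v)) (differential p (y + t • v) v) t := by
  refine hasDerivAt_polyEval p fun φ => ?_
  simpa using ((hasDerivAt_id t).mul_const (φ v)).const_add (φ y)

/-- Polynomials are continuous along a complex line. -/
theorem polyEval_eq_zero_of_line {p : MvPolynomial (Dual ℂ V) ℂ} {y v : V}
    (h : ∀ s : ℂ, s ≠ 0 → polyEval p (y + s • v) = 0) : polyEval p y = 0 := by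
  have hcont := (hasDerivAt_polyEval_line p y v 0).continuousAt
  have h1 : Filter.Tendsto (fun s : ℂ => polyEval p (y + s • v)) (𝓝[≠] 0) (𝓝 (polyEval p y)) := by
    have := hcont.tendsto.mono_left (nhdsWithin_le_nhds (s := {0}ᶜ))
    simpa using this
  have h2 : Filter.Tendsto (fun s : ℂ => polyEval p (y + s • v)) (𝓝[≠] 0) (𝓝 0) := by
    refine tendsto_const_nhds.congr' ?_
    filter_upwards [self_mem_nhdsWithin] with s hs
    exact (h s hs).symm
  exact tendsto_nhds_unique h1 h2

theorem mem_zariskiClosure_of_line {S : Set V} {y v : V}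
    (h : ∀ s : ℂ, s ≠ 0 → y + s • v ∈ S) : y ∈ zariskiClosure S :=
  fun _ hp => polyEval_eq_zero_of_line fun s hs => hp _ (h s hs)

theorem mem_tangentSpace {Y : Set V} {y v : V} :
    v ∈ tangentSpace Y y ↔ ∀ p ∈ vanishing Y, differential p y v = 0 := by
  simp [tangentSpace]

theorem mem_tangentSpace_of_curve {Y : Set V} {c : ℂ → V} {v : V} (hY : ∀ t, c t ∈ Y)
    (hc : ∀ φ : Dual ℂ V, HasDerivAt (fun s => φ (c s)) (φ v) 0) :
    v ∈ tangentSpace Y (c 0) := by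
  rw [mem_tangentSpace]
  intro p hp
  have h := hasDerivAt_polyEval p hc
  simp only [fun t => hp _ (hY t)] at h
  exact h.unique (hasDerivAt_const _ _)

/-- A vector that is tangent at all the points `y + s v ≠ y` of a line is tangent at `y`. -/
theorem mem_tangentSpace_of_line {Y : Set V} {y v w : V}
    (h : ∀ s : ℂ, s ≠ 0 → w ∈ tangentSpace Y (y + s • v)) : w ∈ tangentSpace Y y := by
  rw [mem_tangentSpace]
  intro p hp
  exact polyEval_eq_zero_of_line fun s hs => mem_tangentSpace.1 (h s hs) p hp

theorem differential_polyComp (f : V →ₗ[ℂ] W) (p : MvPolynomial (Dual ℂ W) ℂ) (y v : V) :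
    differential (polyComp f p) y v = differential p (f y) (f v) := by
  have h1 := hasDerivAt_polyEval_line (polyComp f p) y v 0
  have h2 := hasDerivAt_polyEval_line p (f y) (f v) 0
  simp only [polyEval_polyComp, map_add, map_smul, zero_smul, add_zero] at h1 h2
  exact h1.unique h2

theorem map_mem_tangentSpace (f : V →ₗ[ℂ] V) {Y : Set V} (hf : ∀ y ∈ Y, f y ∈ Y) {y v : V}
    (hv : v ∈ tangentSpace Y y) : f v ∈ tangentSpace Y (f y) := by
  rw [mem_tangentSpace] at hv ⊢
  intro p hp
  rw [← differential_polyComp]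
  exact hv _ fun s hs => by rw [polyEval_polyComp]; exact hp _ (hf s hs)

theorem IsPolyFun.hasDerivAt_zero_of_mem_tangentSpace {q : V → ℂ} (hq : IsPolyFun q) {Y : Set V}
    (hY : ∀ y ∈ Y, q y = 0) {y v : V} (hv : v ∈ tangentSpace Y y) :
    HasDerivAt (fun s : ℂ => q (y + s • v)) 0 0 := by
  obtain ⟨p, hp⟩ := hq
  have h := hasDerivAt_polyEval_line p y v 0
  rw [zero_smul, add_zero, mem_tangentSpace.1 hv p fun s hs => by rw [hp, hY s hs]] at h
  simpa only [hp] using h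

end ZariskiLemmas

/-! ### Loci of bounded rank and their tangent vectors -/

section Determinantal

variable {U W : Type*} [AddCommGroup U] [Module ℂ U] [AddCommGroup W] [Module ℂ W]
  [FiniteDimensional ℂ W]

theorem det_eq_zero_of_finrank_lt {κ : Type*} [Fintype κ] [DecidableEq κ] (C : U →ₗ[ℂ] W)
    (h : finrank ℂ (LinearMap.range C) < Fintype.card κ) (u : κ → U) (φ : κ → Dual ℂ W) :
    (Matrix.of fun i j => φ i (C (u j))).det = 0 := by
  by_contra hdet
  have hli : LinearIndependent ℂ fun j => (⟨C (u j), u j, rfl⟩ : LinearMap.range C) := by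
    rw [Fintype.linearIndependent_iff]
    intro c hc
    have hc' : ∑ j, c j • C (u j) = 0 := by
      have := congrArg Subtype.val hc
      simpa using this
    have hmul : (Matrix.of fun i j => φ i (C (u j))).mulVec c = 0 := by
      ext i
      have := congrArg (φ i) hc'
      rw [map_sum, map_zero] at this
      rw [Matrix.mulVec, dotProduct, Pi.zero_apply, ← this]
      exact Finset.sum_congr rfl fun j _ => by
        rw [map_smul, smul_eq_mul, mul_comm, Matrix.of_apply]
    exact congrFun (Matrix.eq_zero_of_mulVec_eq_zero hdet hmul)
  exact absurd hli.fintype_card_le_finrank (not_le.2 h)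

/-- A basis of the range and extensions of its dual basis exhibit the rank by a minor equal to 1. -/
theorem exists_dual_families (C : U →ₗ[ℂ] W) {m : ℕ} (hm : finrank ℂ (LinearMap.range C) = m) :
    ∃ (u : Fin m → U) (φ : Fin m → Dual ℂ W), (Matrix.of fun i j => φ i (C (u j))) = 1 := by
  let b := Module.finBasisOfFinrankEq ℂ (LinearMap.range C) hm
  choose u hu using fun j => (b j).2
  choose φ hφ using fun i => LinearMap.exists_extend (b.coord i)
  refine ⟨u, φ, ?_⟩
  ext i j
  have h := LinearMap.congr_fun (hφ i) (b j)
  rw [Matrix.of_apply, hu]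
  simp only [LinearMap.comp_apply, Submodule.subtype_apply, Basis.coord_apply, Basis.repr_self] at h
  rw [h, Matrix.one_apply, Finsupp.single_apply]
  simp [eq_comm]

variable {V : Type*} [AddCommGroup V] [Module ℂ V] [FiniteDimensional ℂ V]

theorem isPolyFun_bilin (B : V →ₗ[ℂ] V →ₗ[ℂ] U →ₗ[ℂ] W) (φ : Dual ℂ W) (u : U) :
    IsPolyFun fun x => φ (B x x u) :=
  IsPolyFun.bilin (B.compr₂ (φ ∘ₗ LinearMap.applyₗ u))

/-- Semicontinuity of the rank of a quadratic family of linear maps. -/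
theorem finrank_range_le_of_mem_zariskiClosure (B : V →ₗ[ℂ] V →ₗ[ℂ] U →ₗ[ℂ] W) {S : Set V} {m : ℕ}
    (hS : ∀ s ∈ S, finrank ℂ (LinearMap.range (B s s)) ≤ m) {x : V} (hx : x ∈ zariskiClosure S) :
    finrank ℂ (LinearMap.range (B x x)) ≤ m := by
  by_contra hlt
  obtain ⟨u, φ, h1⟩ := exists_dual_families (B x x) rfl
  have h0 : (Matrix.of fun i j => φ i (B x x (u j))).det = 0 := by
    refine IsPolyFun.eq_zero_of_mem_zariskiClosure
      (IsPolyFun.det fun i j => isPolyFun_bilin B (φ i) (u j)) (fun s hs => ?_) hx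
    refine det_eq_zero_of_finrank_lt (B s s) ?_ u φ
    rw [Fintype.card_fin]
    exact (hS s hs).trans_lt (not_le.1 hlt)
  rw [h1, Matrix.det_one] at h0
  exact one_ne_zero h0

/-- The tangent vectors of a locus where the rank of a quadratic family of linear maps does not
exceed its value at the given point. -/
theorem mem_range_of_mem_tangentSpace (B : V →ₗ[ℂ] V →ₗ[ℂ] U →ₗ[ℂ] W) {Y : Set V} {x v : V}
    (hY : ∀ y ∈ Y, finrank ℂ (LinearMap.range (B y y)) ≤ finrank ℂ (LinearMap.range (B x x)))
    (hv : v ∈ tangentSpace Y x) {w : U} (hw : B x x w = 0) :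
    B x v w + B v x w ∈ LinearMap.range (B x x) := by
  rw [← Subspace.forall_mem_dualAnnihilator_apply_eq_zero_iff]
  intro ψ hψ
  rw [Submodule.mem_dualAnnihilator] at hψ
  obtain ⟨m, hm⟩ : ∃ m, finrank ℂ (LinearMap.range (B x x)) = m := ⟨_, rfl⟩
  obtain ⟨u, φ, h1⟩ := exists_dual_families (B x x) hm
  rw [hm] at hY
  -- The unit minor at x is bordered by the column `w`, in the kernel, and the row ψ, which
  -- annihilates the range. The bordered minor vanishes on `Y`, so its derivative along v is zero.
  let u' : Fin m ⊕ Unit → U := Sum.elim u fun _ => w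
  let φ' : Fin m ⊕ Unit → Dual ℂ W := Sum.elim φ fun _ => ψ
  have hder := IsPolyFun.hasDerivAt_zero_of_mem_tangentSpace
    (IsPolyFun.det fun i j => isPolyFun_bilin B (φ' i) (u' j)) (fun y hy =>
      det_eq_zero_of_finrank_lt (B y y) (by
        rw [Fintype.card_sum, Fintype.card_fin, Fintype.card_unit]
        exact Nat.lt_succ_of_le (hY y hy)) u' φ') hv
  let col : ℂ → Fin m ⊕ Unit → ℂ := fun s i => φ' i (B x v w + B v x w) + s * φ' i (B v v w)
  let M : ℂ → Matrix (Fin m ⊕ Unit) (Fin m ⊕ Unit) ℂ := fun s =>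
    Matrix.of fun i j => φ' i (B (x + s • v) (x + s • v) (u' j))
  let M' : ℂ → Matrix (Fin m ⊕ Unit) (Fin m ⊕ Unit) ℂ := fun s =>
    (M s).updateCol (Sum.inr ()) (col s)
  have hexp : ∀ (s : ℂ) (z : U), B (x + s • v) (x + s • v) z =
      B x x z + s • (B x v z + B v x z) + (s * s) • B v v z := by
    intro s z
    simp only [map_add, map_smul, LinearMap.add_apply, LinearMap.smul_apply, smul_add, smul_smul]
    abel
  -- The column of `w` vanishes at s = 0, so a factor s splits off and the derivative at 0 is det
  -- (M' 0).
  have hMM' : ∀ s, (M s).det = s * (M' s).det := by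
    intro s
    have h : M s = (M s).updateCol (Sum.inr ()) (s • col s) := by
      ext i j
      rcases j with j | j
      · rw [Matrix.updateCol_ne (by simp)]
      · rw [Matrix.updateCol_self]
        simp only [M, Matrix.of_apply, u', Sum.elim_inr, col, Pi.smul_apply]
        rw [hexp, hw, zero_add, map_add, map_smul, map_smul, smul_eq_mul, smul_eq_mul, smul_eq_mul]
        ring
    rw [h, Matrix.det_updateCol_smul]
  have hcont : ContinuousAt (fun s => (M' s).det) 0 := by
    refine Continuous.continuousAt (Continuous.matrix_det ?_)
    refine continuous_matrix fun i j => ?_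
    rcases j with j | j
    · have h : (fun s => M' s i (Sum.inl j)) = fun s => φ' i (B x x (u' (Sum.inl j))) +
          s * φ' i (B x v (u' (Sum.inl j)) + B v x (u' (Sum.inl j))) +
          s * s * φ' i (B v v (u' (Sum.inl j))) := by
        funext s
        simp only [M']
        rw [Matrix.updateCol_ne (by simp)]
        simp only [M, Matrix.of_apply]
        rw [hexp, map_add, map_add, map_smul, map_smul, smul_eq_mul, smul_eq_mul]
      rw [h]
      fun_prop
    · simp only [M', Matrix.updateCol_self, col]
      fun_prop
  have hder' : HasDerivAt (fun s => (M s).det) ((M' 0).det) 0 := by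
    rw [hasDerivAt_iff_tendsto_slope]
    refine (hcont.tendsto.mono_left nhdsWithin_le_nhds).congr' ?_
    filter_upwards [self_mem_nhdsWithin] with s hs
    have hs' : s ≠ 0 := hs
    rw [slope_def_field, hMM' s, hMM' 0]
    field_simp
    ring
  have h0 : (M' 0).det = 0 := hder'.unique hder
  -- At s = 0 the matrix is block triangular with an identity block, so its determinant is the value
  -- of ψ that must vanish.
  have hblock : M' 0 = Matrix.fromBlocks 1 (Matrix.of fun i _ => φ i (B x v w + B v x w)) 0
      (Matrix.of fun _ _ => ψ (B x v w + B v x w)) := by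
    ext i j
    rcases j with j | j
    · simp only [M']
      rw [Matrix.updateCol_ne (by simp)]
      simp only [M, Matrix.of_apply, zero_smul, add_zero, u', Sum.elim_inl, φ']
      rcases i with i | i
      · rw [Matrix.fromBlocks_apply₁₁, ← h1]; rfl
      · rw [Matrix.fromBlocks_apply₂₁]
        exact hψ _ ⟨_, rfl⟩
    · simp only [M', Matrix.updateCol_self, col, zero_mul, add_zero, φ']
      rcases i with i | i <;> simp
  rw [hblock, Matrix.det_fromBlocks_zero₂₁, Matrix.det_one, one_mul, Matrix.det_unique] at h0
  exact h0

end Determinantal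

end ShortGrading

end

/-! ### Closure order and projective duality of the orbits -/

noncomputable section

namespace ShortGrading

open LieAlgebra LieAlgebra.IsKilling

section Action

variable {𝔩 : Type*} [LieRing 𝔩] [LieAlgebra ℂ 𝔩] {𝒢 : Type*} [Group 𝒢]
  {ξ : 𝔩} {ρ : Representation ℂ 𝒢 𝔩}

variable (ρ) in
/-- The orbit of `x`. -/
def repOrbit (x : 𝔩) : Set 𝔩 := {y | ∃ g, y = ρ g x}

theorem self_mem_repOrbit (x : 𝔩) : x ∈ repOrbit ρ x := ⟨1, by simp⟩

theorem map_mem_repOrbit (g : 𝒢) {x y : 𝔩} (h : y ∈ repOrbit ρ x) : ρ g y ∈ repOrbit ρ x := by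
  obtain ⟨g', rfl⟩ := h
  exact ⟨g * g', by rw [rep_mul_apply]⟩

theorem repOrbit_eq_of_map_eq {x y : 𝔩} {g : 𝒢} (h : ρ g x = y) : repOrbit ρ x = repOrbit ρ y := by
  subst h
  ext z
  constructor
  · rintro ⟨g', rfl⟩
    exact ⟨g' * g⁻¹, by rw [rep_mul_apply, rep_inv_apply]⟩
  · rintro ⟨g', rfl⟩
    exact ⟨g' * g, by rw [rep_mul_apply]⟩

theorem repOrbit_subset_zariskiClosure {x y : 𝔩} (h : x ∈ zariskiClosure (repOrbit ρ y)) :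
    repOrbit ρ x ⊆ zariskiClosure (repOrbit ρ y) := by
  rintro _ ⟨g, rfl⟩
  exact map_mem_zariskiClosure (ρ g) (fun s hs => map_mem_repOrbit g hs) h

variable (𝔩) in
/-- The bilinear map `(x, y) ↦ ad x ∘ ad y`. -/
def adMul : 𝔩 →ₗ[ℂ] 𝔩 →ₗ[ℂ] 𝔩 →ₗ[ℂ] 𝔩 :=
  LinearMap.mk₂ ℂ (fun x y => (ad ℂ 𝔩 x) * (ad ℂ 𝔩 y) : 𝔩 → 𝔩 → Module.End ℂ 𝔩)
    (fun x x' y => by rw [map_add, add_mul]) (fun c x y => by rw [map_smul, smul_mul_assoc])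
    (fun x y y' => by rw [map_add, mul_add]) (fun c x y => by rw [map_smul, mul_smul_comm])

theorem adMul_apply (x y z : 𝔩) : adMul 𝔩 x y z = ⁅x, ⁅y, z⁆⁆ := rfl

theorem adMul_self (x : 𝔩) : adMul 𝔩 x x = (ad ℂ 𝔩 x) ^ 2 := (pow_two _).symm

theorem killingForm_lie_left (x y z : 𝔩) :
    killingForm ℂ 𝔩 ⁅x, y⁆ z = -killingForm ℂ 𝔩 y ⁅x, z⁆ := by
  rw [← lie_skew, map_neg, LinearMap.neg_apply, LieModule.traceForm_apply_lie_apply]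

namespace IsGradedAction

variable (A : IsGradedAction ξ ρ)
include A

theorem killingForm_map (g : 𝒢) (x y : 𝔩) :
    killingForm ℂ 𝔩 (ρ g x) (ρ g y) = killingForm ℂ 𝔩 x y := by
  let E : 𝔩 ≃ₗ⁅ℂ⁆ 𝔩 :=
    { toFun := ρ g
      map_add' := map_add _
      map_smul' := map_smul _
      map_lie' := A.map_lie g _ _
      invFun := ρ g⁻¹
      left_inv := rep_inv_apply g
      right_inv := rep_apply_inv g }
  exact killingForm_of_equiv_apply E x y

/-- The action on the part of degree one. -/
def restrictOne (g : 𝒢) : lieEigenspace ξ 1 →ₗ[ℂ] lieEigenspace ξ 1 :=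
  (ρ g).restrict fun _ hy => A.map_mem_grading g hy

theorem coe_restrictOne (g : 𝒢) (y : lieEigenspace ξ 1) : (A.restrictOne g y : 𝔩) = ρ g y := rfl

theorem restrictOne_injective (g : 𝒢) : Function.Injective (A.restrictOne g) := by
  intro x y h
  have h' := congrArg Subtype.val h
  exact Subtype.ext (rep_injective g h')

theorem restrictOne_mem_zariskiClosure (g : 𝒢) (x : 𝔩) :
    ∀ y ∈ zariskiClosure (Subtype.val ⁻¹' repOrbit ρ x : Set (lieEigenspace ξ 1)),
      A.restrictOne g y ∈ zariskiClosure (Subtype.val ⁻¹' repOrbit ρ x : Set (lieEigenspace ξ 1)) :=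
  fun _ hy => map_mem_zariskiClosure (A.restrictOne g)
    (fun _ hs => map_mem_repOrbit (ρ := ρ) g hs) hy

end IsGradedAction

end Action

section Frame

variable {𝔩 : Type*} [LieRing 𝔩] [LieAlgebra ℂ 𝔩] [FiniteDimensional ℂ 𝔩]
  [LieAlgebra.IsKilling ℂ 𝔩] {H : LieSubalgebra ℂ 𝔩} [H.IsCartanSubalgebra]
  {ξ : 𝔩} {d : H.root → ℤ} {r : ℕ} {α : Fin r → H.root} {e f : Fin r → 𝔩}
  {𝒢 : Type*} [Group 𝒢] {ρ : Representation ℂ 𝒢 𝔩}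

namespace IsFrame

variable (F : IsFrame H ξ d α e f)
include F

/-- The linear endomorphism of `𝔩_1` given by `∑ i ∈ T, α_i^∨`. -/
def weightEnd (T : Finset (Fin r)) :
    lieEigenspace ξ 1 →ₗ[ℂ] lieEigenspace ξ 1 :=
  (ad ℂ 𝔩 (corootSum α T) : 𝔩 →ₗ[ℂ] 𝔩).restrict fun _ hy => F.stable_one (corootSum_mem T) hy

theorem coe_weightEnd (T : Finset (Fin r)) (y : lieEigenspace ξ 1) :
    (F.weightEnd T y : 𝔩) = ⁅corootSum α T, (y : 𝔩)⁆ := rfl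

/-- The vector `∑ i ∈ T, e_i` as an element of `𝔩_1`. -/
def vec (T : Finset (Fin r)) : lieEigenspace ξ 1 := ⟨vecSum e T, F.vecSum_mem_one T⟩

/-- Pairings of roots of degree one are non-negative, so a zero sum forces each of them to be zero.
-/
theorem mem_orthPart_of_corootSum {T : Finset (Fin r)} {y : 𝔩} (hy1 : y ∈ lieEigenspace ξ 1)
    (hy : y ∈ lieEigenspace (corootSum α T) 0) : y ∈ orthPart ξ α T := by
  refine F.induction_one (lieEigenspace ξ 1 ⊓ lieEigenspace (corootSum α T) 0)
    (fun h hh y hy => ⟨F.stable_one hh hy.1, cartan_stable_lieEigenspace (corootSum_mem T) hh hy.2⟩)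
    inf_le_left (p := fun y => y ∈ orthPart ξ α T) (Submodule.zero_mem _)
    (fun _ _ => Submodule.add_mem _) ?_ ⟨hy1, hy⟩
  intro β hβ v hv hv'
  by_cases hv0 : v = 0
  · rw [hv0]; exact Submodule.zero_mem _
  have hs : ∑ i ∈ T, (rootSystem H).pairingIn ℤ β (α i) = 0 := by
    by_contra hne
    exact hv0 (eq_zero_of_mem_lieEigenspace hv.2 (corootSum_lie hv' T)
      (by exact_mod_cast Ne.symm hne))
  rw [Finset.sum_eq_zero_iff_of_nonneg
    fun i _ => F.isShortDegree.pairingIn_nonneg (F.degree_one i) hβ] at hs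
  rw [mem_orthPart]
  refine ⟨hv.1, fun i hi => ?_⟩
  rw [mem_lieEigenspace, corootElement_lie hv', hs i hi, Int.cast_zero]

theorem exists_degree_decomposition (x : 𝔩) : ∃ a ∈ lieEigenspace ξ (-1), ∃ b ∈ lieEigenspace ξ 0,
    ∃ c ∈ lieEigenspace ξ 1, x = a + b + c := by
  refine stable_induction (H := H) ⊤ (fun _ _ _ _ => Submodule.mem_top)
    (p := fun x => ∃ a ∈ lieEigenspace ξ (-1), ∃ b ∈ lieEigenspace ξ 0,
      ∃ c ∈ lieEigenspace ξ 1, x = a + b + c) ?_ ?_ ?_ ?_ (Submodule.mem_top (x := x))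
  · exact ⟨0, Submodule.zero_mem _, 0, Submodule.zero_mem _, 0, Submodule.zero_mem _, by simp⟩
  · rintro _ _ ⟨a, ha, b, hb, c, hc, rfl⟩ ⟨a', ha', b', hb', c', hc', rfl⟩
    exact ⟨a + a', Submodule.add_mem _ ha ha', b + b', Submodule.add_mem _ hb hb', c + c',
      Submodule.add_mem _ hc hc', by abel⟩
  · intro β v _ hv
    have h := F.lie_grading hv
    rcases F.degree_mem β with hβ | hβ | hβ <;> rw [hβ] at h
    · exact ⟨v, by simpa using h, 0, Submodule.zero_mem _, 0, Submodule.zero_mem _, by simp⟩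
    · exact ⟨0, Submodule.zero_mem _, v, by simpa using h, 0, Submodule.zero_mem _, by simp⟩
    · exact ⟨0, Submodule.zero_mem _, 0, Submodule.zero_mem _, v, by simpa using h, by simp⟩
  · intro v _ hv
    exact ⟨0, Submodule.zero_mem _, v, F.cartan_lie_grading hv, 0, Submodule.zero_mem _, by simp⟩

omit F in
theorem _root_.ShortGrading.killingForm_eq_zero {a b : ℂ} (hab : a + b ≠ 0) {x y : 𝔩}
    (hx : x ∈ lieEigenspace ξ a) (hy : y ∈ lieEigenspace ξ b) : killingForm ℂ 𝔩 x y = 0 := by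
  have h := killingForm_lie_left ξ x y
  rw [mem_lieEigenspace] at hx hy
  rw [hx, hy, map_smul, map_smul, LinearMap.smul_apply, smul_eq_mul, smul_eq_mul] at h
  have h' : (a + b) * killingForm ℂ 𝔩 x y = 0 := by rw [add_mul, h, neg_add_cancel]
  exact (mul_eq_zero.1 h').resolve_left hab

theorem eq_zero_of_killingForm {w : 𝔩} (hw : w ∈ lieEigenspace ξ (-1))
    (h : ∀ y ∈ lieEigenspace ξ 1, killingForm ℂ 𝔩 w y = 0) : w = 0 := by
  have hnd := LieAlgebra.IsKilling.killingForm_nondegenerate ℂ 𝔩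
  refine hnd.1 w fun x => ?_
  obtain ⟨a, ha, b, hb, c, hc, rfl⟩ := F.exists_degree_decomposition x
  rw [map_add, map_add, h c hc, killingForm_eq_zero (by norm_num) hw ha,
    killingForm_eq_zero (by norm_num) hw hb]
  simp

/-- Non-degeneracy represents an extension of φ by some w, and only the component of w of degree -1
pairs non-trivially with 𝔩_1. -/
theorem exists_eq_killingForm (φ : Dual ℂ (lieEigenspace ξ 1)) :
    ∃ w ∈ lieEigenspace ξ (-1), (killingForm ℂ 𝔩 w).domRestrict (lieEigenspace ξ 1) = φ := by
  obtain ⟨φ', hφ'⟩ := LinearMap.exists_extend φ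
  have hnd := LieAlgebra.IsKilling.killingForm_nondegenerate ℂ 𝔩
  obtain ⟨w, hw⟩ := (LinearMap.BilinForm.toDual (killingForm ℂ 𝔩) hnd).surjective φ'
  have hw' : ∀ x, killingForm ℂ 𝔩 w x = φ' x := fun x => by
    rw [← hw, LinearMap.BilinForm.toDual_def]
  obtain ⟨a, ha, b, hb, c, hc, rfl⟩ := F.exists_degree_decomposition w
  refine ⟨a, ha, ?_⟩
  ext y
  have h := hw' y
  rw [map_add, map_add, LinearMap.add_apply, LinearMap.add_apply,
    killingForm_eq_zero (by norm_num) hb y.2, killingForm_eq_zero (by norm_num) hc y.2] at h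
  rw [← hφ']
  simpa using h

variable (A : IsGradedAction ξ ρ)
include A

theorem adSqRank_le_of_mem_zariskiClosure {T : Finset (Fin r)} {x : 𝔩}
    (hx : x ∈ zariskiClosure (repOrbit ρ (vecSum e T))) :
    finrank ℂ (LinearMap.range ((ad ℂ 𝔩 x) ^ 2)) ≤ adSqRank e T := by
  rw [← adMul_self]
  refine finrank_range_le_of_mem_zariskiClosure (adMul 𝔩) (fun s hs => ?_) hx
  obtain ⟨g, rfl⟩ := hs
  rw [adMul_self, A.finrank_range_ad_sq]
  rfl

/-- Scaling by s ≠ 0 the e_i with i outside `S` gives the punctured line e_S + s e_{T \ S} in the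
orbit. -/
theorem vecSum_mem_zariskiClosure_of_subset {S T : Finset (Fin r)} (h : S ⊆ T) :
    vecSum e S ∈ zariskiClosure (repOrbit ρ (vecSum e T)) := by
  refine mem_zariskiClosure_of_line (v := vecSum e (T \ S)) fun s hs => ?_
  obtain ⟨g, -, hg, -⟩ := F.exists_scaling A (fun i => if i ∈ S then 1 else s) (fun i => by
    split_ifs <;> simp [hs])
  refine ⟨g, ?_⟩
  rw [vecSum, vecSum, vecSum, map_sum, ← Finset.sum_sdiff h, add_comm, Finset.smul_sum]
  congr 1 <;> refine Finset.sum_congr rfl fun i hi => ?_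
  · rw [hg, if_neg (Finset.mem_sdiff.1 hi).2]
  · rw [hg, if_pos hi, one_smul]

variable [(rootSystem H).IsIrreducible]

theorem repOrbit_subset_of_card_le {S T : Finset (Fin r)} (h : S.card ≤ T.card) :
    repOrbit ρ (vecSum e S) ⊆ zariskiClosure (repOrbit ρ (vecSum e T)) := by
  obtain ⟨S', hS'T, hS'⟩ := Finset.exists_subset_card_eq h
  obtain ⟨g, hg⟩ := F.exists_map_vecSum_eq A hS'.symm
  rw [repOrbit_eq_of_map_eq hg]
  exact repOrbit_subset_zariskiClosure (F.vecSum_mem_zariskiClosure_of_subset A hS'T)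

/-- If `S` were larger, it would properly contain a set of the size of `T`, making the rank of (ad
e_S)² exceed that of (ad e_T)², against semicontinuity. -/
theorem card_le_of_mem_zariskiClosure {S T : Finset (Fin r)}
    (h : vecSum e S ∈ zariskiClosure (repOrbit ρ (vecSum e T))) : S.card ≤ T.card := by
  by_contra hlt
  obtain ⟨S', hS'S, hS'⟩ := Finset.exists_subset_card_eq (not_le.1 hlt).le
  obtain ⟨g, hg⟩ := F.exists_map_vecSum_eq A hS'
  have h1 := F.adSqRank_le_of_mem_zariskiClosure A h
  have h2 := A.finrank_range_ad_sq g (vecSum e S')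
  rw [hg] at h2
  have h3 : S' ⊂ S := by
    refine Finset.ssubset_iff_subset_ne.2 ⟨hS'S, fun hh => hlt ?_⟩
    rw [← hh, hS']
  have h4 := F.adSqRank_lt h3
  simp only [adSqRank] at h1 h4
  omega

/-- The closure order on the orbits. -/
theorem repOrbit_subset_zariskiClosure_iff {S T : Finset (Fin r)} :
    repOrbit ρ (vecSum e S) ⊆ zariskiClosure (repOrbit ρ (vecSum e T)) ↔ S.card ≤ T.card :=
  ⟨fun h => F.card_le_of_mem_zariskiClosure A (h (self_mem_repOrbit _)),
    F.repOrbit_subset_of_card_le A⟩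

theorem disjoint_repOrbit {S T : Finset (Fin r)} (h : S.card ≠ T.card) :
    Disjoint (repOrbit ρ (vecSum e S)) (repOrbit ρ (vecSum e T)) := by
  rw [Set.disjoint_left]
  rintro _ ⟨g, rfl⟩ ⟨g', hg'⟩
  have heq : repOrbit ρ (vecSum e S) = repOrbit ρ (vecSum e T) := by
    rw [repOrbit_eq_of_map_eq hg', repOrbit_eq_of_map_eq (rfl : ρ g' (vecSum e T) = _)]
  apply h
  apply le_antisymm
  · rw [← F.repOrbit_subset_zariskiClosure_iff A, heq]
    exact subset_zariskiClosure _
  · rw [← F.repOrbit_subset_zariskiClosure_iff A, heq]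
    exact subset_zariskiClosure _

theorem exists_mem_repOrbit {y : 𝔩} (hy : y ∈ lieEigenspace ξ 1) :
    ∃ T, y ∈ repOrbit ρ (vecSum e T) := by
  obtain ⟨g, -, T, -, hg⟩ := F.exists_map_eq_vecSum A ∅ (y := y)
    (mem_orthPart.2 ⟨hy, fun i hi => absurd hi (Finset.notMem_empty i)⟩)
  exact ⟨T, g⁻¹, by rw [← hg, rep_inv_apply]⟩

/-- The representative is chosen with S ⊆ T so that tangent vectors at e_T can be carried to e_S
along the degeneration. -/
theorem exists_subset_of_mem_zariskiClosure {T : Finset (Fin r)} {y : lieEigenspace ξ 1}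
    (hy : y ∈ zariskiClosure (Subtype.val ⁻¹' repOrbit ρ (vecSum e T) :
      Set (lieEigenspace ξ 1))) :
    ∃ S ⊆ T, ∃ g, y = A.restrictOne g (F.vec S) := by
  have hy' : (y : 𝔩) ∈ zariskiClosure (repOrbit ρ (vecSum e T)) :=
    map_mem_zariskiClosure (lieEigenspace ξ 1).subtype (fun _ hs => hs) hy
  obtain ⟨S, hS⟩ := F.exists_mem_repOrbit A y.2
  obtain ⟨g, hg⟩ := hS
  have hSmem : vecSum e S ∈ zariskiClosure (repOrbit ρ (vecSum e T)) := by
    have := map_mem_zariskiClosure (ρ g⁻¹) (fun s hs => map_mem_repOrbit g⁻¹ hs) hy'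
    rwa [hg, rep_inv_apply] at this
  obtain ⟨S', hS'T, hS'⟩ := Finset.exists_subset_card_eq (F.card_le_of_mem_zariskiClosure A hSmem)
  obtain ⟨g', hg'⟩ := F.exists_map_vecSum_eq A hS'
  refine ⟨S', hS'T, g * g', Subtype.ext ?_⟩
  rw [A.coe_restrictOne, vec, rep_mul_apply, hg', hg]

omit [(rootSystem H).IsIrreducible] in
theorem vec_mem_zariskiClosure {S T : Finset (Fin r)} (h : S ⊆ T) :
    F.vec S ∈ zariskiClosure (Subtype.val ⁻¹' repOrbit ρ (vecSum e T) :
      Set (lieEigenspace ξ 1)) := by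
  refine mem_zariskiClosure_of_line (v := F.vec (T \ S)) fun s hs => ?_
  obtain ⟨g, -, hg, -⟩ := F.exists_scaling A (fun i => if i ∈ S then 1 else s) (fun i => by
    split_ifs <;> simp [hs])
  refine ⟨g, ?_⟩
  rw [Submodule.coe_add, Submodule.coe_smul, vec, vec]
  dsimp only
  rw [vecSum, vecSum, vecSum, map_sum, ← Finset.sum_sdiff h, add_comm, Finset.smul_sum]
  congr 1 <;> refine Finset.sum_congr rfl fun i hi => ?_
  · rw [hg, if_neg (Finset.mem_sdiff.1 hi).2]
  · rw [hg, if_pos hi, one_smul]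

omit [(rootSystem H).IsIrreducible] in
-- With z = -[f_T, y] in 𝔩_0 one has [z, e_T] = [h_T, y], the velocity of the orbit curve generated
-- by z.
theorem weightEnd_mem_tangentSpace_self (T : Finset (Fin r)) (y : lieEigenspace ξ 1) :
    F.weightEnd T y ∈ tangentSpace (zariskiClosure (Subtype.val ⁻¹' repOrbit ρ (vecSum e T) :
      Set (lieEigenspace ξ 1))) (F.vec T) := by
  set z : 𝔩 := -⁅vecSum f T, (y : 𝔩)⁆ with hz
  have hz0 : ⁅ξ, z⁆ = 0 := by
    have h : z ∈ lieEigenspace ξ 0 := Submodule.neg_mem _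
      (lie_mem_lieEigenspace (a := -1) (b := 1)
        (sum_mem fun i _ => F.f_mem_neg_one i) y.2 (by ring))
    simpa [mem_lieEigenspace] using h
  have hze : ⁅z, vecSum e T⁆ = F.weightEnd T y := by
    rw [hz, neg_lie, lie_skew, F.coe_weightEnd, ← F.lie_vecSum, lie_lie,
      F.lie_eq_zero_of_one (F.vecSum_mem_one T) y.2, lie_zero, sub_zero]
  obtain ⟨γ, E⟩ := A.exists_isExpCurve hz0
  have h0 : A.restrictOne (γ 0) (F.vec T) = F.vec T := Subtype.ext (by
    rw [A.coe_restrictOne, E.map_zero, map_one, Module.End.one_apply])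
  have h := mem_tangentSpace_of_curve (c := fun t => A.restrictOne (γ t) (F.vec T))
    (v := F.weightEnd T y) (Y := zariskiClosure (Subtype.val ⁻¹' repOrbit ρ (vecSum e T) :
      Set (lieEigenspace ξ 1)))
    (fun t => subset_zariskiClosure _ ⟨γ t, rfl⟩) (fun φ => by
      obtain ⟨φ', hφ'⟩ := LinearMap.exists_extend φ
      have hφ : ∀ u : lieEigenspace ξ 1, φ u = φ' u := fun u => by rw [← hφ']; rfl
      simp only [hφ, A.coe_restrictOne]
      have h := E.hasDerivAt (vecSum e T) φ' 0
      rwa [E.map_zero, map_one, Module.End.one_apply, hze] at h)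
  simpa only [h0] using h

omit [(rootSystem H).IsIrreducible] in
-- The points e_S + s e_{T \ S}, s ≠ 0, are torus conjugates of e_T. The torus fixes h_T and so
-- preserves [h_T, 𝔩_1], which is therefore tangent along the punctured line and at its limit.
theorem weightEnd_mem_tangentSpace {S T : Finset (Fin r)} (hST : S ⊆ T) (y : lieEigenspace ξ 1) :
    F.weightEnd T y ∈ tangentSpace (zariskiClosure (Subtype.val ⁻¹' repOrbit ρ (vecSum e T) :
      Set (lieEigenspace ξ 1))) (F.vec S) := by
  refine mem_tangentSpace_of_line (v := F.vec (T \ S)) fun s hs => ?_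
  obtain ⟨g, hgH, hg, -⟩ := F.exists_scaling A (fun i => if i ∈ S then 1 else s) (fun i => by
    split_ifs <;> simp [hs])
  have h1 : F.vec S + s • F.vec (T \ S) = A.restrictOne g (F.vec T) := by
    apply Subtype.ext
    rw [Submodule.coe_add, Submodule.coe_smul, A.coe_restrictOne, vec, vec, vec]
    dsimp only
    rw [vecSum, vecSum, vecSum, map_sum, ← Finset.sum_sdiff hST, add_comm, Finset.smul_sum]
    congr 1 <;> refine Finset.sum_congr rfl fun i hi => ?_
    · rw [hg, if_neg (Finset.mem_sdiff.1 hi).2]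
    · rw [hg, if_pos hi, one_smul]
  have h2 : F.weightEnd T y = A.restrictOne g (F.weightEnd T (A.restrictOne g⁻¹ y)) := by
    apply Subtype.ext
    rw [A.coe_restrictOne, F.coe_weightEnd, F.coe_weightEnd, A.map_lie, hgH _ (corootSum_mem T),
      A.coe_restrictOne, rep_apply_inv]
  rw [h1, h2]
  exact map_mem_tangentSpace _ (A.restrictOne_mem_zariskiClosure g _)
    (F.weightEnd_mem_tangentSpace_self A T _)

omit A [(rootSystem H).IsIrreducible] in
/-- An element of degree zero and weight one is in the image of `ad e_T`. -/
theorem exists_lie_vecSum_eq {T : Finset (Fin r)} {u : 𝔩} (hu0 : u ∈ lieEigenspace ξ 0)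
    (hu : u ∈ lieEigenspace (corootSum α T) 1) :
    ∃ w ∈ lieEigenspace ξ (-1), w ∈ lieEigenspace (corootSum α T) (-1) ∧ ⁅vecSum e T, w⁆ = u := by
  have he := F.corootSum_lie_vecSum T
  have hf : vecSum f T ∈ lieEigenspace (corootSum α T) (-2) := by
    rw [mem_lieEigenspace, F.corootSum_lie_vecSum_f, neg_smul]
  have hf1 : vecSum f T ∈ lieEigenspace ξ (-1) := sum_mem fun i _ => F.f_mem_neg_one i
  refine ⟨⁅vecSum f T, u⁆, lie_mem_lieEigenspace hf1 hu0 (by ring),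
    lie_mem_lieEigenspace hf hu (by ring), ?_⟩
  have h3 : ⁅vecSum e T, u⁆ = 0 := F.eq_zero_of_weight T (k := 3) (by norm_num) (by norm_num)
    (by norm_num) (lie_mem_lieEigenspace (F.vecSum_mem_one T) hu0 (by ring))
    (lie_mem_lieEigenspace he hu (by ring))
  rw [leibniz_lie, F.lie_vecSum, h3, lie_zero, add_zero, mem_lieEigenspace.1 hu, one_smul]

omit A in
-- The elements v of this kind form an H-stable subspace, so v may be a root vector for some β. Take
-- δ of degree one linked to β with pairing sum 1 on `T`, and w, f' root vectors for δ, -β: then u =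
-- [w, f'] is admissible and [v, u] is a non-zero multiple of w.
theorem eq_zero_of_lie_eq_zero {T : Finset (Fin r)} (hT : T.Nonempty) {v : 𝔩}
    (hv1 : v ∈ lieEigenspace ξ 1) (hv0 : v ∈ lieEigenspace (corootSum α T) 0)
    (hv : ∀ u ∈ lieEigenspace ξ 0, u ∈ lieEigenspace (corootSum α T) 1 → ⁅v, u⁆ = 0) : v = 0 := by
  let N : Submodule ℂ 𝔩 :=
    { carrier := {v | v ∈ lieEigenspace ξ 1 ∧ v ∈ lieEigenspace (corootSum α T) 0 ∧
        ∀ u ∈ lieEigenspace ξ 0, u ∈ lieEigenspace (corootSum α T) 1 → ⁅v, u⁆ = 0}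
      add_mem' := fun {a b} ha hb => ⟨Submodule.add_mem _ ha.1 hb.1,
        Submodule.add_mem _ ha.2.1 hb.2.1, fun u hu hu' => by
          rw [add_lie, ha.2.2 u hu hu', hb.2.2 u hu hu', add_zero]⟩
      zero_mem' := ⟨Submodule.zero_mem _, Submodule.zero_mem _, fun u _ _ => zero_lie u⟩
      smul_mem' := fun c a ha => ⟨Submodule.smul_mem _ _ ha.1, Submodule.smul_mem _ _ ha.2.1,
        fun u hu hu' => by rw [smul_lie, ha.2.2 u hu hu', smul_zero]⟩ }
  refine F.induction_one N (fun h hh y hy => ⟨F.stable_one hh hy.1,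
    cartan_stable_lieEigenspace (corootSum_mem T) hh hy.2.1, fun u hu hu' => ?_⟩) (fun y hy => hy.1)
    (p := fun y => y = 0) rfl (fun x y hx hy => by rw [hx, hy, add_zero]) ?_
    (y := v) ⟨hv1, hv0, hv⟩
  · rw [lie_lie, hy.2.2 u hu hu', lie_zero, zero_sub, neg_eq_zero]
    exact hy.2.2 _ (cartan_stable_lieEigenspace F.mem_cartan hh hu)
      (cartan_stable_lieEigenspace (corootSum_mem T) hh hu')
  · intro β hβ v hv hvβ
    by_contra hvne
    have hs : ∑ i ∈ T, (rootSystem H).pairingIn ℤ β (α i) = 0 := by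
      by_contra hne
      exact hvne (eq_zero_of_mem_lieEigenspace hv.2.1 (corootSum_lie hvβ T)
        (by exact_mod_cast Ne.symm hne))
    obtain ⟨δ, hδ, hβδ, hδT⟩ := F.isShortDegree.exists_sum_pairingIn_eq_one F.degree_one T hT
      (fun i _ j _ hij => F.orthogonal i j hij) hβ hs
    obtain ⟨h, e', f', ht, he', hf'⟩ :=
      exists_isSl2Triple_of_weight_isNonZero (LieSubalgebra.isNonZero_coe_root β)
    have hh : h = corootElement H β :=
      ht.h_eq_coroot (LieSubalgebra.isNonZero_coe_root β) he' hf'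
    obtain ⟨c, rfl⟩ := exists_eq_smul_of_mem_rootSpace hvβ hvne he'
    have hfr : f' ∈ rootSpace H ((rootSystem H).reflectionPerm β β).1 := by
      rw [coe_reflectionPerm_self]; exact hf'
    obtain ⟨w, hw, hw0⟩ := δ.1.exists_ne_zero
    have hw1 : w ∈ lieEigenspace ξ 1 := by
      have := F.lie_grading hw
      rwa [hδ, Int.cast_one] at this
    have hf1 : f' ∈ lieEigenspace ξ (-1) := by
      have := F.lie_grading hfr
      rwa [F.isShortDegree.degree_neg, hβ, Int.cast_neg, Int.cast_one] at this
    have hwT : w ∈ lieEigenspace (corootSum α T) 1 := by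
      have := corootSum_lie (α := α) hw T
      rwa [hδT, Int.cast_one] at this
    have hfT : f' ∈ lieEigenspace (corootSum α T) 0 := by
      have := corootSum_lie (α := α) hfr T
      simp only [RootPairing.pairingIn_reflectionPerm_self_left, Finset.sum_neg_distrib, hs,
        neg_zero, Int.cast_zero] at this
      exact this
    have h0 := hv.2.2 ⁅w, f'⁆ (lie_mem_lieEigenspace hw1 hf1 (by ring))
      (lie_mem_lieEigenspace hwT hfT (by ring))
    have h1 : ⁅c • v, ⁅w, f'⁆⁆ = 0 := by rw [smul_lie, h0, smul_zero]
    rw [leibniz_lie, smul_lie, F.lie_eq_zero_of_one hv.1 hw1, smul_zero, zero_lie, zero_add,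
      ht.lie_e_f, hh, ← lie_skew, corootElement_lie hw, neg_eq_zero] at h1
    have h2 : ((rootSystem H).pairingIn ℤ δ β : ℂ) ≠ 0 := by
      exact_mod_cast fun h => hβδ ((rootSystem H).pairingIn_eq_zero_comm.1 h)
    exact hw0 ((smul_eq_zero.1 h1).resolve_left h2)

/-- Subtracting the weights 1 and 2 leaves a tangent vector y₀ of weight 0. Each u of degree 0 and
weight 1 is [e_T, w] with (ad e_T)² w = 0, so the determinantal lemma puts 2 [y₀, u] into the image
of (ad e_T)². That image has weight 2 while [y₀, u] has weight 1, so y₀ commutes with all such u and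
vanishes. -/
theorem tangentSpace_vec_le (T : Finset (Fin r)) :
    tangentSpace (zariskiClosure (Subtype.val ⁻¹' repOrbit ρ (vecSum e T) :
      Set (lieEigenspace ξ 1))) (F.vec T) ≤ LinearMap.range (F.weightEnd T) := by
  intro v hv
  obtain ⟨y₀, h0, y₁, h1, y₂, h2, hvy, h0', h1', h2'⟩ := F.exists_weight_decomposition T
    (lieEigenspace ξ 1) (fun h hh y hy => F.stable_one hh hy) le_rfl v.2
  have hrange : (⟨y₁ + y₂, Submodule.add_mem _ h1 h2⟩ : lieEigenspace ξ 1) ∈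
      LinearMap.range (F.weightEnd T) := by
    refine ⟨⟨y₁ + (2⁻¹ : ℂ) • y₂, Submodule.add_mem _ h1 (Submodule.smul_mem _ _ h2)⟩,
      Subtype.ext ?_⟩
    rw [mem_lieEigenspace] at h1' h2'
    rw [F.coe_weightEnd]
    dsimp only
    rw [lie_add, lie_smul, h1', h2', smul_smul]
    norm_num
  suffices hz : y₀ = 0 by
    convert hrange
    rw [hvy, hz, zero_add]
  have hv0 : (⟨y₀, h0⟩ : lieEigenspace ξ 1) ∈
      tangentSpace (zariskiClosure (Subtype.val ⁻¹' repOrbit ρ (vecSum e T) :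
        Set (lieEigenspace ξ 1))) (F.vec T) := by
    have h3 : (⟨y₀, h0⟩ : lieEigenspace ξ 1) = v - ⟨y₁ + y₂, Submodule.add_mem _ h1 h2⟩ := by
      apply Subtype.ext
      rw [Submodule.coe_sub, hvy]
      dsimp only
      abel
    rw [h3]
    obtain ⟨x, hx⟩ := hrange
    rw [← hx]
    exact Submodule.sub_mem _ hv (F.weightEnd_mem_tangentSpace_self A T x)
  -- For empty `T` the orbit is {0}, and the linear forms already show that its tangent space is
  -- zero.
  rcases T.eq_empty_or_nonempty with rfl | hT
  · have hzero : ∀ φ : Dual ℂ (lieEigenspace ξ 1), φ ⟨y₀, h0⟩ = 0 := by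
      intro φ
      have h := mem_tangentSpace.1 hv0 (MvPolynomial.X φ) (by
        rw [vanishing_zariskiClosure]
        rintro s ⟨g, hg⟩
        have hs : s = 0 := Subtype.ext (by rw [hg]; simp [vecSum])
        rw [hs]
        simp [polyEval])
      rwa [differential_X] at h
    exact congrArg Subtype.val ((Module.forall_dual_apply_eq_zero_iff ℂ _).1 hzero)
  refine F.eq_zero_of_lie_eq_zero hT h0 h0' fun u hu hu' => ?_
  obtain ⟨w, hw1, hwT, rfl⟩ := F.exists_lie_vecSum_eq hu hu'
  have he := F.corootSum_lie_vecSum T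
  have he1 := F.vecSum_mem_one T
  let B := (adMul 𝔩).compl₁₂ (lieEigenspace ξ 1).subtype (lieEigenspace ξ 1).subtype
  have hB : ∀ x y : lieEigenspace ξ 1, B x y = adMul 𝔩 x y := fun _ _ => rfl
  have hmem := mem_range_of_mem_tangentSpace B (x := F.vec T) (fun y hy => by
      rw [hB, hB, adMul_self, adMul_self]
      exact F.adSqRank_le_of_mem_zariskiClosure A
        (map_mem_zariskiClosure (lieEigenspace ξ 1).subtype (fun _ hs => hs) hy)) hv0 (w := w) (by
      rw [hB, adMul_apply]
      exact F.eq_zero_of_weight T (k := 3) (by norm_num) (by norm_num) (by norm_num)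
        (lie_mem_lieEigenspace he1 (lie_mem_lieEigenspace he1 hw1 rfl) (by ring))
        (lie_mem_lieEigenspace he (lie_mem_lieEigenspace he hwT rfl) (by ring)))
  rw [hB, hB, hB, adMul_self, adMul_apply, adMul_apply] at hmem
  have hcomm : ⁅vecSum e T, ⁅y₀, w⁆⁆ = ⁅y₀, ⁅vecSum e T, w⁆⁆ := by
    rw [leibniz_lie, F.lie_eq_zero_of_one he1 h0, zero_lie, zero_add]
  have hmem2 : ⁅y₀, ⁅vecSum e T, w⁆⁆ + ⁅y₀, ⁅vecSum e T, w⁆⁆ ∈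
      LinearMap.range ((ad ℂ 𝔩 (vecSum e T)) ^ 2) := by
    nth_rewrite 1 [← hcomm]
    exact hmem
  rw [F.range_ad_sq, ← two_smul ℂ] at hmem2
  have h4 := eq_zero_of_mem_lieEigenspace hmem2.2
    (Submodule.smul_mem _ 2 (lie_mem_lieEigenspace h0' hu' (zero_add 1))) (by norm_num)
  exact (smul_eq_zero.1 h4).resolve_left (by norm_num)

theorem tangentSpace_vec (T : Finset (Fin r)) :
    tangentSpace (zariskiClosure (Subtype.val ⁻¹' repOrbit ρ (vecSum e T) :
      Set (lieEigenspace ξ 1))) (F.vec T) = LinearMap.range (F.weightEnd T) := by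
  refine le_antisymm (F.tangentSpace_vec_le A T) ?_
  rintro _ ⟨y, rfl⟩
  exact F.weightEnd_mem_tangentSpace_self A T y

omit [(rootSystem H).IsIrreducible] in
theorem map_range_weightEnd_le {S T : Finset (Fin r)} (hST : S ⊆ T) (g : 𝒢) :
    (LinearMap.range (F.weightEnd T)).map (A.restrictOne g) ≤
      tangentSpace (zariskiClosure (Subtype.val ⁻¹' repOrbit ρ (vecSum e T) :
        Set (lieEigenspace ξ 1))) (A.restrictOne g (F.vec S)) := by
  rintro _ ⟨_, ⟨y, rfl⟩, rfl⟩
  exact map_mem_tangentSpace _ (A.restrictOne_mem_zariskiClosure g _)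
    (F.weightEnd_mem_tangentSpace A hST y)

omit [(rootSystem H).IsIrreducible] in
theorem finrank_map_range_weightEnd (T : Finset (Fin r)) (g : 𝒢) :
    finrank ℂ ((LinearMap.range (F.weightEnd T)).map (A.restrictOne g)) =
      finrank ℂ (LinearMap.range (F.weightEnd T)) :=
  (Submodule.equivMapOfInjective _ (A.restrictOne_injective g) _).finrank_eq.symm

/-- At every point of the closure the tangent space contains a conjugate of [h_T, 𝔩_1], which is all
of the tangent space at e_T. -/
theorem isSmoothPoint_vec (T : Finset (Fin r)) :
    IsSmoothPoint (zariskiClosure (Subtype.val ⁻¹' repOrbit ρ (vecSum e T) :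
      Set (lieEigenspace ξ 1))) (F.vec T) := by
  refine ⟨F.vec_mem_zariskiClosure A subset_rfl, fun z hz => ?_⟩
  obtain ⟨S, hST, g, rfl⟩ := F.exists_subset_of_mem_zariskiClosure A hz
  rw [F.tangentSpace_vec A, ← F.finrank_map_range_weightEnd A T g]
  exact Submodule.finrank_mono (F.map_range_weightEnd_le A hST g)

/-- The tangent spaces at the smooth points of the closure of an orbit are conjugate. -/
theorem exists_tangentSpace_eq {T : Finset (Fin r)} {y : lieEigenspace ξ 1}
    (hy : IsSmoothPoint (zariskiClosure (Subtype.val ⁻¹' repOrbit ρ (vecSum e T) :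
      Set (lieEigenspace ξ 1))) y) :
    ∃ g, (LinearMap.range (F.weightEnd T)).map (A.restrictOne g) ≤
      tangentSpace (zariskiClosure (Subtype.val ⁻¹' repOrbit ρ (vecSum e T) :
        Set (lieEigenspace ξ 1))) y := by
  obtain ⟨S, hST, g, rfl⟩ := F.exists_subset_of_mem_zariskiClosure A hy.1
  exact ⟨g, F.map_range_weightEnd_le A hST g⟩

omit A [(rootSystem H).IsIrreducible] in
theorem lie_corootSum_compl (T : Finset (Fin r)) : ⁅corootSum α T, vecSum f Tᶜ⁆ = 0 := by
  rw [vecSum, lie_sum]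
  refine Finset.sum_eq_zero fun i hi => ?_
  have h := F.neg.corootSum_lie_e T i
  rw [corootSum_reflectionPerm, if_neg (Finset.mem_compl.1 hi), zero_smul, neg_lie,
    neg_eq_zero] at h
  exact h

/-- The Pyasetskii pairing of the orbits. -/
theorem pyasetskiiCorresponds (T : Finset (Fin r)) :
    PyasetskiiCorresponds (V := lieEigenspace ξ 1)
      (Subtype.val ⁻¹' repOrbit ρ (vecSum e T))
      ((fun y => (killingForm ℂ 𝔩 y).domRestrict (lieEigenspace ξ 1)) ''
        repOrbit ρ (vecSum f Tᶜ)) := by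
  let ι : 𝔩 →ₗ[ℂ] Dual ℂ (lieEigenspace ξ 1) :=
    (lieEigenspace ξ 1).subtype.dualMap ∘ₗ killingForm ℂ 𝔩
  have hι : ∀ w (y : lieEigenspace ξ 1), ι w y = killingForm ℂ 𝔩 w y := fun _ _ => rfl
  have hι' : (fun y => (killingForm ℂ 𝔩 y).domRestrict (lieEigenspace ξ 1)) = ι := rfl
  rw [PyasetskiiCorresponds, dualCone, hι']
  apply Set.Subset.antisymm
  · apply zariskiClosure_subset_of_subset
    rintro φ ⟨y, hy, hφ⟩
    obtain ⟨g, hg⟩ := F.exists_tangentSpace_eq A hy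
    obtain ⟨w, hw, rfl⟩ := F.exists_eq_killingForm φ
    have hw' : ρ g⁻¹ w ∈ lieEigenspace ξ (-1) := A.map_mem_grading _ hw
    -- The form vanishes on the conjugate by g of [h_T, 𝔩_1]; by invariance [h_T, g⁻¹ w] is
    -- Killing-orthogonal to 𝔩_1.
    have hzero : ⁅corootSum α T, ρ g⁻¹ w⁆ = 0 := by
      refine F.eq_zero_of_killingForm
        (lie_mem_lieEigenspace (F.cartan_lie_grading (corootSum_mem T)) hw' (zero_add _))
        fun x hx => ?_
      have h := hφ _ (hg ⟨_, ⟨⟨x, hx⟩, rfl⟩, rfl⟩)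
      rw [LinearMap.domRestrict_apply, A.coe_restrictOne, F.coe_weightEnd,
        ← rep_apply_inv (ρ := ρ) g w, A.killingForm_map] at h
      rw [killingForm_lie_left, h, neg_zero]
    have horth : ρ g⁻¹ w ∈ orthPart (-ξ) (fun i => (rootSystem H).reflectionPerm (α i) (α i)) T := by
      refine F.neg.mem_orthPart_of_corootSum (by rwa [lieEigenspace_neg]) ?_
      rw [corootSum_reflectionPerm, lieEigenspace_neg, mem_lieEigenspace, hzero, neg_zero, zero_smul]
    obtain ⟨g', -, S, hS, hgS⟩ := F.neg.exists_map_eq_vecSum A.neg T horth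
    -- The normal form inside the part killed by h_T uses only indices outside `T`, which bounds the
    -- orbit of w.
    have hSc : S.card ≤ Tᶜ.card :=
      Finset.card_le_card fun i hi => Finset.mem_compl.2 (Finset.disjoint_left.1 hS hi)
    have hmem : w ∈ repOrbit ρ (vecSum f S) :=
      ⟨g * g'⁻¹, by rw [← hgS, rep_mul_apply, rep_inv_apply, rep_apply_inv]⟩
    exact map_mem_zariskiClosure ι (fun s hs => Set.mem_image_of_mem ι hs)
      (F.neg.repOrbit_subset_of_card_le A.neg hSc hmem)
  · apply zariskiClosure_mono
    rintro _ ⟨_, ⟨g, rfl⟩, rfl⟩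
    have hsm := F.isSmoothPoint_vec A T
    have hy0 : A.restrictOne g (F.vec T) ∈ zariskiClosure
        (Subtype.val ⁻¹' repOrbit ρ (vecSum e T) : Set (lieEigenspace ξ 1)) :=
      A.restrictOne_mem_zariskiClosure g _ _ hsm.1
    have hle : tangentSpace (zariskiClosure (Subtype.val ⁻¹' repOrbit ρ (vecSum e T) :
        Set (lieEigenspace ξ 1))) (A.restrictOne g (F.vec T)) ≤
          (LinearMap.range (F.weightEnd T)).map (A.restrictOne g) := by
      intro v hv
      refine ⟨A.restrictOne g⁻¹ v, ?_, Subtype.ext (by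
        rw [A.coe_restrictOne, A.coe_restrictOne, rep_apply_inv])⟩
      have h := map_mem_tangentSpace _ (A.restrictOne_mem_zariskiClosure g⁻¹ _) hv
      have h' : A.restrictOne g⁻¹ (A.restrictOne g (F.vec T)) = F.vec T := Subtype.ext (by
        rw [A.coe_restrictOne, A.coe_restrictOne, rep_inv_apply])
      rw [h'] at h
      exact F.tangentSpace_vec_le A T h
    refine ⟨A.restrictOne g (F.vec T), ⟨hy0, fun z hz => ?_⟩, fun v hv => ?_⟩
    · refine (Submodule.finrank_mono hle).trans ?_
      rw [F.finrank_map_range_weightEnd A, ← F.tangentSpace_vec A]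
      exact hsm.2 z hz
    · obtain ⟨_, ⟨x, rfl⟩, rfl⟩ := hle hv
      -- By invariance this pairing reduces to [h_T, f_S] with S the complement of T, which is zero.
      rw [hι, A.coe_restrictOne, F.coe_weightEnd, A.killingForm_map, ← neg_eq_zero,
        ← killingForm_lie_left, F.lie_corootSum_compl, map_zero, LinearMap.zero_apply]

end IsFrame

end Frame

end ShortGrading

end

/-! ### The adjoint action of the identity component of the centralizer -/

noncomputable section

namespace ShortGrading

section MatrixGroups

variable {n : ℕ} {L : Subgroup (GL (Fin n) ℂ)} {𝔩 : LieSubalgebra ℂ (Matrix (Fin n) (Fin n) ℂ)}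

/-- Conjugation by elements of `L` preserves the Lie algebra of `L`. -/
theorem IsLieAlgebraOf.conj_mem (h𝔩 : IsLieAlgebraOf L 𝔩) {g : GL (Fin n) ℂ} (hg : g ∈ L)
    {X : Matrix (Fin n) (Fin n) ℂ} (hX : X ∈ 𝔩) :
    (g : Matrix (Fin n) (Fin n) ℂ) * X * ((g⁻¹ : GL (Fin n) ℂ) : Matrix (Fin n) (Fin n) ℂ) ∈ 𝔩 := by
  rw [h𝔩] at hX ⊢
  intro t
  obtain ⟨u, hu, hut⟩ := hX t
  refine ⟨g * u * g⁻¹, L.mul_mem (L.mul_mem hg hu) (L.inv_mem hg), ?_⟩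
  rw [Units.val_mul, Units.val_mul, hut, ← Matrix.exp_units_conj, mul_smul_comm, smul_mul_assoc]

/-- The adjoint action of a subgroup `G` of `L` on the Lie algebra of `L`. -/
def adRep (h𝔩 : IsLieAlgebraOf L 𝔩) {G : Subgroup (GL (Fin n) ℂ)} (hG : G ≤ L) :
    Representation ℂ G 𝔩 where
  toFun g :=
    { toFun := fun x => ⟨_, h𝔩.conj_mem (hG g.2) x.2⟩
      map_add' := fun x y => Subtype.ext (by simp [mul_add, add_mul])
      map_smul' := fun c x => Subtype.ext (by simp) }
  map_one' := LinearMap.ext fun x => Subtype.ext (by simp)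
  map_mul' g h := LinearMap.ext fun x => Subtype.ext (by simp [mul_assoc])

theorem coe_adRep (h𝔩 : IsLieAlgebraOf L 𝔩) {G : Subgroup (GL (Fin n) ℂ)} (hG : G ≤ L) (g : G)
    (x : 𝔩) : (adRep h𝔩 hG g x : Matrix (Fin n) (Fin n) ℂ) =
      ((g : GL (Fin n) ℂ) : Matrix (Fin n) (Fin n) ℂ) * x *
        (((g : GL (Fin n) ℂ)⁻¹ : GL (Fin n) ℂ) : Matrix (Fin n) (Fin n) ℂ) := rfl

theorem adOrbit_eq_repOrbit (h𝔩 : IsLieAlgebraOf L 𝔩) {G : Subgroup (GL (Fin n) ℂ)} (hG : G ≤ L)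
    (x : 𝔩) : adOrbit G x = repOrbit (adRep h𝔩 hG) x := by
  ext y
  constructor
  · rintro ⟨g, hg, h⟩
    exact ⟨⟨g, hg⟩, Subtype.ext h⟩
  · rintro ⟨g, rfl⟩
    exact ⟨g, g.2, rfl⟩

theorem identityComponent_le (C : Subgroup (GL (Fin n) ℂ)) : identityComponent C ≤ C :=
  fun _ hg => @connectedComponentIn_subset _ (zariskiGL n) _ _ _ hg

theorem identityComponent_centralizerIn_le (L : Subgroup (GL (Fin n) ℂ))
    (ξ : Matrix (Fin n) (Fin n) ℂ) : identityComponent (centralizerIn L ξ) ≤ L :=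
  fun _ hg => (identityComponent_le _ hg).1

/-- A Euclidean continuous map is continuous for the Zariski topology. -/
theorem continuous_zariskiTopology_of_dual {X V : Type*} [TopologicalSpace X] [AddCommGroup V]
    [Module ℂ V] {u : X → V} (hu : ∀ φ : Dual ℂ V, Continuous fun t => φ (u t)) :
    Continuous[_, zariskiTopology V] u := by
  let := zariskiTopology V
  refine continuous_iff_isClosed.2 fun Z hZ => ?_
  rw [isClosed_zariski_iff] at hZ
  have hset : u ⁻¹' Z = ⋂ p ∈ vanishing Z, {t | polyEval p (u t) = 0} := by
    ext t
    simp only [Set.mem_preimage, Set.mem_iInter]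
    exact ⟨fun h p hp => hp _ h, fun h => hZ fun p hp => h p hp⟩
  rw [hset]
  refine isClosed_biInter fun p _ => isClosed_eq ?_ continuous_const
  exact (MvPolynomial.continuous_eval p).comp (continuous_pi hu)

attribute [local instance] Matrix.linftyOpNormedRing Matrix.linftyOpNormedAlgebra

theorem continuous_exp_smul (z : Matrix (Fin n) (Fin n) ℂ) :
    Continuous fun t : ℂ => NormedSpace.exp (t • z) :=
  continuous_iff_continuousAt.2 fun t => (hasDerivAt_exp_smul_const z t).continuousAt

/-- A continuous curve through `1` in an algebraic group stays in the identity component. -/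
theorem mem_identityComponent_of_curve {C : Subgroup (GL (Fin n) ℂ)} {u : ℂ → GL (Fin n) ℂ}
    (hu : Continuous fun t => (u t : Matrix (Fin n) (Fin n) ℂ)) (huC : ∀ t, u t ∈ C)
    (h0 : u 0 = 1) (t : ℂ) : u t ∈ identityComponent C := by
  have hdual : ∀ φ : Dual ℂ (Matrix (Fin n) (Fin n) ℂ), Continuous fun t => φ (u t) :=
    fun φ => φ.continuous_of_finiteDimensional.comp hu
  let := zariskiTopology (Matrix (Fin n) (Fin n) ℂ)
  let := zariskiGL n
  have hcont : Continuous u := continuous_induced_rng.2 (continuous_zariskiTopology_of_dual hdual)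
  have hpre : IsPreconnected (Set.range u) := isPreconnected_range hcont
  exact hpre.subset_connectedComponentIn ⟨0, h0⟩ (Set.range_subset_iff.2 huC) ⟨t, rfl⟩

theorem hasDerivAt_exp_conj (z x : Matrix (Fin n) (Fin n) ℂ) (t : ℂ) :
    HasDerivAt (fun t : ℂ => NormedSpace.exp (t • z) * x * NormedSpace.exp (t • -z))
      (NormedSpace.exp (t • z) * ⁅z, x⁆ * NormedSpace.exp (t • -z)) t := by
  refine (((hasDerivAt_exp_smul_const z t).mul_const x).mul
    (hasDerivAt_exp_smul_const' (-z) t)).congr_deriv ?_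
  rw [LieRing.of_associative_ring_bracket]
  noncomm_ring

/-- If z commutes with ξ, the curve exp(tz) lies in the centralizer and is continuous through 1,
hence stays in the identity component. -/
theorem isGradedAction_adRep (h𝔩 : IsLieAlgebraOf L 𝔩) (ξ : 𝔩) :
    IsGradedAction ξ (adRep h𝔩
      (identityComponent_centralizerIn_le L (ξ : Matrix (Fin n) (Fin n) ℂ))) where
  map_lie g x y := by
    apply Subtype.ext
    simp only [LieSubalgebra.coe_bracket, coe_adRep, LieRing.of_associative_ring_bracket]
    simp [mul_sub, sub_mul, mul_assoc]
  map_grading g := by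
    apply Subtype.ext
    rw [coe_adRep, (identityComponent_le _ g.2).2, mul_assoc, Units.mul_inv, mul_one]
  exists_exp z hz := by
    have hcomm : Commute (ξ : Matrix (Fin n) (Fin n) ℂ) z := by
      have h := congrArg (Subtype.val : 𝔩 → Matrix (Fin n) (Fin n) ℂ) hz
      rw [LieSubalgebra.coe_bracket, LieRing.of_associative_ring_bracket] at h
      exact sub_eq_zero.1 h
    choose u hu hut using (h𝔩 z).1 z.2
    have h0 : u 0 = 1 := Units.ext (by rw [hut, zero_smul, NormedSpace.exp_zero, Units.val_one])
    have hmem : ∀ t, u t ∈ centralizerIn L (ξ : Matrix (Fin n) (Fin n) ℂ) := fun t => by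
      refine ⟨hu t, ?_⟩
      rw [hut]
      exact ((hcomm.smul_right t).exp_right).symm
    have hinv : ∀ t, (((u t)⁻¹ : GL (Fin n) ℂ) : Matrix (Fin n) (Fin n) ℂ) =
        NormedSpace.exp (t • -(z : Matrix (Fin n) (Fin n) ℂ)) := fun t => by
      rw [smul_neg, Matrix.exp_neg, ← hut, Matrix.coe_units_inv]
    have hcont : Continuous fun t => (u t : Matrix (Fin n) (Fin n) ℂ) := by
      simp only [hut]
      exact continuous_exp_smul _
    refine ⟨fun t => ⟨u t, mem_identityComponent_of_curve hcont hmem h0 t⟩, Subtype.ext h0,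
      fun x φ t => ?_⟩
    obtain ⟨Φ, hΦ⟩ := LinearMap.exists_extend (p := 𝔩.toSubmodule) φ
    have hφ : ∀ y : 𝔩, φ y = Φ y := fun y => by rw [← hΦ]; rfl
    simp only [hφ, coe_adRep, hut, hinv, LieSubalgebra.coe_bracket]
    exact Φ.toContinuousLinearMap.hasFDerivAt.comp_hasDerivAt t (hasDerivAt_exp_conj _ _ t)

end MatrixGroups

end ShortGrading

end

/-! ### Grading elements, normalized root vectors and indexed orbits -/

noncomputable section

namespace ShortGrading

open LieAlgebra LieAlgebra.IsKilling

section GradingElement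

variable {𝔩 : Type*} [LieRing 𝔩] [LieAlgebra ℂ 𝔩] (ℒ : ℤ → Submodule ℂ 𝔩) [GradedLieAlgebra ℒ]

theorem decompose_degree_apply {T : 𝔩 →ₗ[ℂ] 𝔩} (hT : ∀ (k : ℤ), ∀ x ∈ ℒ k, T x = (k : ℂ) • x)
    (x : 𝔩) (k : ℤ) :
    (DirectSum.decompose ℒ (T x) k : 𝔩) = (k : ℂ) • (DirectSum.decompose ℒ x k : 𝔩) := by
  induction x using DirectSum.Decomposition.inductionOn ℒ with
  | zero => simp
  | @homogeneous i m =>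
    rw [hT i m m.2, DirectSum.decompose_smul, DirectSum.smul_apply, Submodule.coe_smul]
    by_cases h : i = k
    · subst h; rfl
    · rw [DirectSum.decompose_of_mem_ne ℒ m.2 h, smul_zero, smul_zero]
  | add a b ha hb =>
    rw [map_add, DirectSum.decompose_add, DirectSum.decompose_add, DirectSum.add_apply,
      DirectSum.add_apply, Submodule.coe_add, Submodule.coe_add, ha, hb, smul_add]

open Classical in
theorem degree_apply_eq_iff {T : 𝔩 →ₗ[ℂ] 𝔩} (hT : ∀ (k : ℤ), ∀ x ∈ ℒ k, T x = (k : ℂ) • x)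
    (k : ℤ) (x : 𝔩) : x ∈ ℒ k ↔ T x = (k : ℂ) • x := by
  refine ⟨hT k x, fun h => ?_⟩
  rw [← DirectSum.sum_support_decompose ℒ x]
  refine sum_mem fun i _ => ?_
  by_cases hik : i = k
  · rw [← hik]; exact SetLike.coe_mem _
  · have h1 := decompose_degree_apply ℒ hT x i
    rw [h, DirectSum.decompose_smul, DirectSum.smul_apply, Submodule.coe_smul, ← sub_eq_zero,
      ← sub_smul] at h1
    rw [(smul_eq_zero.1 h1).resolve_left (sub_ne_zero.2 (by exact_mod_cast Ne.symm hik))]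
    exact Submodule.zero_mem _

open Classical in
theorem exists_degree_eq {T : 𝔩 →ₗ[ℂ] 𝔩} (hT : ∀ (k : ℤ), ∀ x ∈ ℒ k, T x = (k : ℂ) • x)
    {x : 𝔩} (hx : x ≠ 0) {c : ℂ} (hc : T x = c • x) : ∃ k : ℤ, c = k ∧ ℒ k ≠ ⊥ := by
  obtain ⟨k, hk⟩ : ∃ k, (DirectSum.decompose ℒ x k : 𝔩) ≠ 0 := by
    by_contra! h
    apply hx
    rw [← DirectSum.sum_support_decompose ℒ x]
    exact Finset.sum_eq_zero fun i _ => h i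
  refine ⟨k, ?_, fun h => hk ?_⟩
  · have h1 := decompose_degree_apply ℒ hT x k
    rw [hc, DirectSum.decompose_smul, DirectSum.smul_apply, Submodule.coe_smul, ← sub_eq_zero,
      ← sub_smul] at h1
    exact sub_eq_zero.1 ((smul_eq_zero.1 h1).resolve_right hk)
  · exact (Submodule.eq_bot_iff _).1 h _ (DirectSum.decompose ℒ x k).2

open Classical in
/-- A grading of a semisimple Lie algebra is defined by a unique element. -/
theorem existsUnique_isGradingElement [FiniteDimensional ℂ 𝔩] [LieAlgebra.IsKilling ℂ 𝔩] :
    ∃! ξ : 𝔩, IsGradingElement ℒ ξ := by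
  -- Multiplication by k on the part of degree k is a derivation, hence inner.
  obtain ⟨ξ, hξ⟩ := LieDerivation.IsKilling.exists_eq_ad
    (LieDerivation.ofGrading ℒ (Int.castAddHom ℂ))
  have had : ∀ (k : ℤ), ∀ x ∈ ℒ k, ad ℂ 𝔩 ξ x = (k : ℂ) • x := fun k x hx => by
    have h := LieDerivation.ofGrading_apply_apply ℒ (Int.castAddHom ℂ) hx
    rw [← hξ, LieDerivation.ad_apply_apply] at h
    exact h
  refine ⟨ξ, fun k x => degree_apply_eq_iff ℒ had k x, fun η hη => ?_⟩
  have hzero : LieDerivation.ad ℂ 𝔩 (η - ξ) = 0 := by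
    ext x
    rw [← DirectSum.sum_support_decompose ℒ x, map_sum, LieDerivation.zero_apply]
    refine Finset.sum_eq_zero fun i _ => ?_
    have hi := SetLike.coe_mem (DirectSum.decompose ℒ x i)
    have h1 := had i _ hi
    rw [ad_apply] at h1
    rw [LieDerivation.ad_apply_apply, sub_lie, h1, (hη i _).1 hi, sub_self]
  exact sub_eq_zero.1 ((LieDerivation.IsKilling.ad_apply_eq_zero_iff ℂ 𝔩 _).1 hzero)

variable {ℒ}

theorem IsGradingElement.eq_lieEigenspace {ξ : 𝔩} (hξ : IsGradingElement ℒ ξ) (k : ℤ) :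
    ℒ k = lieEigenspace ξ k :=
  Submodule.ext fun x => hξ k x

variable [FiniteDimensional ℂ 𝔩] [LieAlgebra.IsKilling ℂ 𝔩] {H : LieSubalgebra ℂ 𝔩}
  [H.IsCartanSubalgebra]

/-- The element ξ centralizes 𝔩_0, so it normalizes H, and a Cartan subalgebra is self-normalizing.
-/
theorem IsGradingElement.mem_cartan {ξ : 𝔩} (hξ : IsGradingElement ℒ ξ)
    (hH : H.toSubmodule ≤ ℒ 0) : ξ ∈ H := by
  rw [← LieSubalgebra.IsCartanSubalgebra.self_normalizing (H := H),
    LieSubalgebra.mem_normalizer_iff]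
  intro y hy
  rw [(hξ 0 y).1 (hH hy), Int.cast_zero, zero_smul]
  exact H.zero_mem

theorem IsGradingElement.exists_degree {ξ : 𝔩} (hξ : IsGradingElement ℒ ξ) (hshort : IsShort ℒ)
    (hmem : ξ ∈ H) : ∃ d : H.root → ℤ, ∀ β, β.1 ⟨ξ, hmem⟩ = d β ∧
      (d β = -1 ∨ d β = 0 ∨ d β = 1) ∧ ∀ k, β ∈ rootsOfDegree H ℒ k ↔ d β = k := by
  have key : ∀ β : H.root, ∃ k : ℤ, β.1 ⟨ξ, hmem⟩ = k ∧ (k = -1 ∨ k = 0 ∨ k = 1) := fun β => by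
    obtain ⟨v, hv, hv0⟩ := β.1.exists_ne_zero
    obtain ⟨k, hk, hk'⟩ := exists_degree_eq ℒ (T := ad ℂ 𝔩 ξ) (fun k x hx => (hξ k x).1 hx) hv0
      (lie_rootVector hv hmem)
    exact ⟨k, hk, (hshort k).1 hk'⟩
  choose d hd hd' using key
  refine ⟨d, fun β => ⟨hd β, hd' β, fun k => ⟨fun h => ?_, ?_⟩⟩⟩
  · obtain ⟨v, hv, hv0⟩ := β.1.exists_ne_zero
    have h1 := (hξ k v).1 (h hv)
    by_contra hne
    exact hv0 (eq_zero_of_mem_lieEigenspace h1 (lie_rootVector hv hmem)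
      (by rw [hd]; exact_mod_cast Ne.symm hne))
  · rintro rfl v hv
    rw [hξ, ← hd]
    exact lie_rootVector hv hmem

theorem isOrthogonal_iff_pairingIn {a b : H.root} :
    (rootSystem H).IsOrthogonal a b ↔ (rootSystem H).pairingIn ℤ a b = 0 := by
  refine ⟨fun h => ?_, fun h => ?_⟩
  · have h1 := (rootSystem H).algebraMap_pairingIn ℤ a b
    rw [h.1] at h1
    exact (map_eq_zero_iff _ (algebraMap ℤ ℂ).injective_int).1 h1
  · have h' := (rootSystem H).pairingIn_eq_zero_comm.1 h
    constructor
    · rw [← (rootSystem H).algebraMap_pairingIn ℤ a b, h, map_zero]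
    · rw [← (rootSystem H).algebraMap_pairingIn ℤ b a, h', map_zero]

/-- The frame given by a maximal sequence of orthogonal long roots and normalized root vectors. -/
theorem IsGradingElement.exists_isFrame {ξ : 𝔩} (hξ : IsGradingElement ℒ ξ) (hshort : IsShort ℒ)
    (hH : H.toSubmodule ≤ ℒ 0) {r : ℕ} {α : Fin r → H.root} (hα : IsMaximalOrthogonalLong H ℒ α) :
    ∃ d : H.root → ℤ, ∀ e f : Fin r → 𝔩, (∀ i, e i ∈ rootSpace H (α i).1) →
      (∀ i, f i ∈ rootSpace H (-(α i).1 : LieModule.Weight ℂ H 𝔩)) →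
      (∀ i, IsSl2Triple (corootElement H (α i)) (e i) (f i)) → IsFrame H ξ d α e f := by
  obtain ⟨d, hd⟩ := hξ.exists_degree hshort (hξ.mem_cartan hH)
  exact ⟨d, fun e f he hf ht =>
    { mem_cartan := hξ.mem_cartan hH
      apply_eq := fun β => (hd β).1
      degree_mem := fun β => (hd β).2.1
      degree_one := fun i => ((hd _).2.2 1).1 (hα.mem i)
      long := fun i => hα.long i
      orthogonal := fun i j hij => isOrthogonal_iff_pairingIn.1 (hα.orthogonal i j hij)
      maximal := fun β hβ hl => by
        obtain ⟨i, hi⟩ := hα.maximal β (((hd β).2.2 1).2 hβ) hl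
        exact ⟨i, fun h => hi (isOrthogonal_iff_pairingIn.2 h)⟩
      triple := ht
      e_mem := he
      f_mem := hf }⟩

theorem exists_isSl2Triple_of_mem_rootSpace (a : H.root) {e : 𝔩} (he : e ∈ rootSpace H a.1)
    (he0 : e ≠ 0) : ∃ f ∈ rootSpace H (-a.1 : LieModule.Weight ℂ H 𝔩),
      IsSl2Triple (corootElement H a) e f := by
  have ha := LieSubalgebra.isNonZero_coe_root a
  obtain ⟨h, e', f', ht, he', hf'⟩ := exists_isSl2Triple_of_weight_isNonZero ha
  have hh : h = corootElement H a := ht.h_eq_coroot ha he' hf'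
  subst hh
  obtain ⟨c, rfl⟩ := exists_eq_smul_of_mem_rootSpace he' ht.e_ne_zero he
  have hc : c ≠ 0 := fun h => he0 (by rw [h, zero_smul])
  refine ⟨c⁻¹ • f', Submodule.smul_mem _ _ hf', ht.h_ne_zero, ?_, ?_, ?_⟩
  · rw [smul_lie, lie_smul, smul_smul, mul_inv_cancel₀ hc, one_smul, ht.lie_e_f]
  · rw [lie_smul, ht.lie_h_e_nsmul, smul_comm]
  · rw [lie_smul, ht.lie_h_f_nsmul, smul_neg, smul_comm]

theorem isSl2Triple_of_lie_eq_corootElement (a : H.root) {e f : 𝔩} (he : e ∈ rootSpace H a.1)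
    (hf : f ∈ rootSpace H (-a.1 : LieModule.Weight ℂ H 𝔩)) (h : ⁅e, f⁆ = corootElement H a) :
    IsSl2Triple (corootElement H a) e f := by
  have h2 : a.1 (coroot a.1) = 2 := root_apply_coroot (LieSubalgebra.isNonZero_coe_root a)
  have h2e : ⁅corootElement H a, e⁆ = a.1 (coroot a.1) • e :=
    lie_eq_smul_of_mem_rootSpace he (coroot a.1)
  have h2f : ⁅corootElement H a, f⁆ = (-a.1 : LieModule.Weight ℂ H 𝔩) (coroot a.1) • f :=
    lie_eq_smul_of_mem_rootSpace hf (coroot a.1)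
  refine ⟨fun h0 => ?_, h, ?_, ?_⟩
  · have h3 : coroot a.1 = 0 := Subtype.ext h0
    rw [h3, ← LieModule.Weight.toLinear_apply, map_zero] at h2
    exact two_ne_zero h2.symm
  · rw [h2e, h2, two_smul, two_smul]
  · rw [h2f, LieModule.Weight.coe_neg, Pi.neg_apply, h2, neg_smul, two_smul, two_smul]

end GradingElement

section InitialSegment

/-- The first `k` elements of `Fin r`. -/
def initialSegment (r k : ℕ) : Finset (Fin r) := Finset.univ.filter fun i => i.val < k

theorem card_initialSegment {r k : ℕ} (hk : k ≤ r) : (initialSegment r k).card = k := by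
  rw [initialSegment, Fin.card_filter_val_lt, min_eq_right hk]

end InitialSegment

section Orbits

variable {𝔩 : Type*} [LieRing 𝔩] [LieAlgebra ℂ 𝔩] [FiniteDimensional ℂ 𝔩]
  [LieAlgebra.IsKilling ℂ 𝔩] {H : LieSubalgebra ℂ 𝔩} [H.IsCartanSubalgebra]
  {ξ : 𝔩} {d : H.root → ℤ} {r : ℕ} {α : Fin r → H.root} {e f : Fin r → 𝔩}
  {𝒢 : Type*} [Group 𝒢] {ρ : Representation ℂ 𝒢 𝔩}

namespace IsFrame

variable (F : IsFrame H ξ d α e f) (A : IsGradedAction ξ ρ)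
include F A

/-- The torus absorbs the scalars, so the orbits do not depend on the normalization of the root
vectors. -/
theorem repOrbit_partialSum_eq {v : Fin r → 𝔩} (hv : ∀ i, ∃ c : ℂ, c ≠ 0 ∧ v i = c • e i) (k : ℕ) :
    repOrbit ρ (partialSum v k) = repOrbit ρ (vecSum e (initialSegment r k)) := by
  choose c hc hv using hv
  obtain ⟨g, -, hg, -⟩ := F.exists_scaling A c hc
  refine (repOrbit_eq_of_map_eq (g := g) ?_).symm
  rw [vecSum, map_sum]
  exact Finset.sum_congr rfl fun i _ => by rw [hg, hv]

variable [(rootSystem H).IsIrreducible]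

theorem iUnion_repOrbit : (lieEigenspace ξ 1 : Set 𝔩) =
    ⋃ k ∈ Set.Iic r, repOrbit ρ (vecSum e (initialSegment r k)) := by
  ext y
  simp only [Set.mem_iUnion]
  constructor
  · intro hy
    obtain ⟨T, hT⟩ := F.exists_mem_repOrbit A hy
    have hle : T.card ≤ r := by simpa using T.card_le_univ
    obtain ⟨g, hg⟩ := F.exists_map_vecSum_eq A (card_initialSegment hle).symm
    exact ⟨T.card, hle, repOrbit_eq_of_map_eq hg ▸ hT⟩
  · rintro ⟨k, -, g, rfl⟩
    exact A.map_mem_grading g (F.vecSum_mem_one _)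

theorem pairwiseDisjoint_repOrbit :
    (Set.Iic r).PairwiseDisjoint fun k => repOrbit ρ (vecSum e (initialSegment r k)) :=
  fun i hi j hj hij => F.disjoint_repOrbit A (by
    rwa [card_initialSegment hi, card_initialSegment hj])

theorem repOrbit_initialSegment_subset_iff {i j : ℕ} (hi : i ≤ r) (hj : j ≤ r) :
    repOrbit ρ (vecSum e (initialSegment r i)) ⊆
      zariskiClosure (repOrbit ρ (vecSum e (initialSegment r j))) ↔ i ≤ j := by
  rw [F.repOrbit_subset_zariskiClosure_iff A, card_initialSegment hi, card_initialSegment hj]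

theorem pyasetskiiCorresponds_initialSegment {V : Submodule ℂ 𝔩} (hV : V = lieEigenspace ξ 1)
    {k : ℕ} (hk : k ≤ r) :
    PyasetskiiCorresponds (V := V) (Subtype.val ⁻¹' repOrbit ρ (vecSum e (initialSegment r k)))
      ((fun y => (killingForm ℂ 𝔩 y).domRestrict V) ''
        repOrbit ρ (vecSum f (initialSegment r (r - k)))) := by
  subst hV
  -- Duality produces the complementary index set; only its size r - k matters for the orbit.
  have hcard : (initialSegment r k)ᶜ.card = (initialSegment r (r - k)).card := by
    rw [Finset.card_compl, card_initialSegment hk, card_initialSegment (Nat.sub_le r k),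
      Fintype.card_fin]
  obtain ⟨g, hg⟩ := F.neg.exists_map_vecSum_eq A.neg hcard
  rw [← repOrbit_eq_of_map_eq hg]
  exact F.pyasetskiiCorresponds A _

end IsFrame

end Orbits

end ShortGrading

end

/-! ### The theorem -/

open ShortGrading in
theorem theorem2p17 {n : ℕ}
    -- a simple complex algebraic group `L` with Lie algebra `𝔩`
    (L : Subgroup (GL (Fin n) ℂ)) (hL : IsConnectedAlgebraicGroup L)
    (𝔩 : LieSubalgebra ℂ (Matrix (Fin n) (Fin n) ℂ)) (h𝔩 : IsLieAlgebraOf L 𝔩)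
    [LieAlgebra.IsSimple ℂ 𝔩]
    -- a short grading of `𝔩`
    (ℒ : ℤ → Submodule ℂ 𝔩) [GradedLieAlgebra ℒ] (hshort : IsShort ℒ)
    -- a Cartan subalgebra `H` of `𝔩` contained in `𝔩_0` (the Lie algebra of a maximal torus of `G`)
    (H : LieSubalgebra ℂ 𝔩) [H.IsCartanSubalgebra] (hH : H.toSubmodule ≤ ℒ 0)
    -- a maximal sequence of pairwise orthogonal long roots of degree one, and root vectors
    {r : ℕ} (α : Fin r → H.root) (hα : IsMaximalOrthogonalLong H ℒ α)
    (e f : Fin r → 𝔩)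
    (he : ∀ i, e i ∈ LieAlgebra.rootSpace H (α i).1 ∧ e i ≠ 0)
    (hf : ∀ i, f i ∈ LieAlgebra.rootSpace H (-(α i).1 : LieModule.Weight ℂ H 𝔩) ∧ f i ≠ 0) :
    (∃! ξ : 𝔩, IsGradingElement ℒ ξ) ∧
    ∀ ξ : 𝔩, IsGradingElement ℒ ξ →
      let G : Subgroup (GL (Fin n) ℂ) :=
        identityComponent (centralizerIn L (ξ : Matrix (Fin n) (Fin n) ℂ))
      let O : ℕ → Set 𝔩 := fun k => adOrbit G (partialSum e k)
      let O' : ℕ → Set 𝔩 := fun k => adOrbit G (partialSum f k)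
      -- orbit decompositions
      ((ℒ 1 : Set 𝔩) = ⋃ k ∈ Set.Iic r, O k) ∧ (Set.Iic r).PairwiseDisjoint O ∧
      ((ℒ (-1) : Set 𝔩) = ⋃ k ∈ Set.Iic r, O' k) ∧ (Set.Iic r).PairwiseDisjoint O' ∧
      -- closure order
      (∀ i ≤ r, ∀ j ≤ r, (O i ⊆ zariskiClosure (O j) ↔ i ≤ j) ∧
        (i ≤ j ↔ O' i ⊆ zariskiClosure (O' j))) ∧
      -- Pyasetskii pairing, where `𝔩_1` and `𝔩_{-1}` are dual to each other by the Killing form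
      (∀ k ≤ r,
        PyasetskiiCorresponds (V := ℒ 1) (Subtype.val ⁻¹' O k)
          ((fun y => (killingForm ℂ 𝔩 y).domRestrict (ℒ 1)) '' O' (r - k)) ∧
        PyasetskiiCorresponds (V := ℒ (-1)) (Subtype.val ⁻¹' O' (r - k))
          ((fun x => (killingForm ℂ 𝔩 x).domRestrict (ℒ (-1))) '' O k)) ∧
      -- homogeneous `sl_2`-triples, for root vectors normalized by `[e_α, e_{-α}] = α^∨`
      ((∀ i, ⁅e i, f i⁆ = corootElement H (α i)) →
        ∀ k, 1 ≤ k → k ≤ r →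
          let h : Fin r → 𝔩 := fun i => corootElement H (α i)
          IsSl2Triple (partialSum h k) (partialSum e k) (partialSum f k) ∧
          partialSum e k ∈ ℒ 1 ∧ partialSum h k ∈ ℒ 0 ∧ partialSum f k ∈ ℒ (-1)) := by
  refine ⟨existsUnique_isGradingElement ℒ, fun ξ hξ => ?_⟩
  intro G O O'
  have A := isGradedAction_adRep h𝔩 ξ
  set ρ := adRep h𝔩 (identityComponent_centralizerIn_le L (ξ : Matrix (Fin n) (Fin n) ℂ))
  obtain ⟨d, hd⟩ := hξ.exists_isFrame hshort hH hα
  -- The given f_i need not be normalized against e_i, so the frame uses normalized multiples of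
  -- them.
  choose f' hf' ht using fun i => exists_isSl2Triple_of_mem_rootSpace (α i) (he i).1 (he i).2
  have F := hd e f' (fun i => (he i).1) hf' ht
  have hscale : ∀ i, ∃ c : ℂ, c ≠ 0 ∧ f i = c • f' i := fun i => by
    have hfi := (hf i).1
    rw [← coe_reflectionPerm_self] at hfi
    obtain ⟨c, hc⟩ := exists_eq_smul_of_mem_rootSpace (F.f_mem_reflectionPerm i)
      (ht i).f_ne_zero hfi
    exact ⟨c, fun h => (hf i).2 (by rw [hc, h, zero_smul]), hc⟩
  have hO : O = fun k => repOrbit ρ (vecSum e (initialSegment r k)) :=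
    funext fun k => adOrbit_eq_repOrbit h𝔩 _ _
  have hO' : O' = fun k => repOrbit ρ (vecSum f' (initialSegment r k)) :=
    funext fun k => (adOrbit_eq_repOrbit h𝔩 _ _).trans (F.neg.repOrbit_partialSum_eq A.neg hscale k)
  have h1 : ℒ 1 = lieEigenspace ξ 1 := by rw [hξ.eq_lieEigenspace, Int.cast_one]
  have h1' : ℒ (-1) = lieEigenspace (-ξ) 1 := by
    rw [hξ.eq_lieEigenspace, lieEigenspace_neg, Int.cast_neg, Int.cast_one]
  rw [hO, hO']
  refine ⟨?_, F.pairwiseDisjoint_repOrbit A, ?_, F.neg.pairwiseDisjoint_repOrbit A.neg,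
    fun i hi j hj => ⟨F.repOrbit_initialSegment_subset_iff A hi hj,
      (F.neg.repOrbit_initialSegment_subset_iff A.neg hi hj).symm⟩, fun k hk => ⟨?_, ?_⟩,
    fun hef k hk _ => ?_⟩
  · rw [h1]; exact F.iUnion_repOrbit A
  · rw [h1']; exact F.neg.iUnion_repOrbit A.neg
  · exact F.pyasetskiiCorresponds_initialSegment A h1 hk
  -- The opposite frame with r - k in place of k, where r - (r - k) = k.
  · have h := F.neg.pyasetskiiCorresponds_initialSegment A.neg h1' (Nat.sub_le r k)
    rwa [Nat.sub_sub_self hk] at h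
  -- Under the normalization hypothesis the given e and f themselves form a frame.
  · have F₀ := hd e f (fun i => (he i).1) (fun i => (hf i).1) fun i =>
      isSl2Triple_of_lie_eq_corootElement (α i) (he i).1 (hf i).1 (hef i)
    have hne : (initialSegment r k).Nonempty := by
      rw [← Finset.card_pos, card_initialSegment ‹k ≤ r›]
      exact hk
    refine ⟨F₀.isSl2Triple_sum hne, ?_, ?_, ?_⟩
    · rw [h1]; exact F₀.vecSum_mem_one _
    · rw [hξ.eq_lieEigenspace, Int.cast_zero]
      exact F₀.cartan_lie_grading (corootSum_mem (initialSegment r k))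
    · rw [h1']; exact F₀.neg.vecSum_mem_one (initialSegment r k)
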